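/- Let $K$ be an algebraically closed field of characteristic $0$, let $N\ge 5$, and let $S\subset\mathbb{P}^N$ be a surface over $K$, i.e. an irreducible Zariski closed subset of dimension $2$. For a non-singular point $p=[x]$ of a projective variety $X\subset\mathbb{P}^N$ let $\mathbb{T}_pX$ be its embedded tangent space, let $T_pX\cong\hat{\mathbb{T}}_pX/\langle x\rangle$ be its tangent space (where $\hat{\mathbb{T}}_pX\subset K^{N+1}$ is the linear subspace with projectivization $\mathbb{T}_pX$), and let $II_p\colon T_pX\times T_pX\to K^{N+1}/\hat{\mathbb{T}}_pX$ be the second fundamental form, i.e. the differential of the Gauss map $q\mapsto\mathbb{T}_qX$. The second osculating space of $X$ at $p$ is the intersection of all hyperplanes whose equation, restricted to $X$, vanishes at $p$ to order at least $3$ (equivalently, the projective span of $p$ and of all first and second derivatives at $p$ of a local parametrization of $X$). Two tangent directions $[v],[w]\in\mathbb{P}(T_pX)$ are conjugate if $II_p(v,w)=0$; a direction conjugate to itself is called asymptotic. A property holds at a general point of $S$ if it holds at all points of some non-empty Zariski open subset of $S$ consisting of non-singular points. Then the following are equivalent: (i) $S$ is a $\Phi$ surface, i.e. at a general point $p$ of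 $S$ the second osculating space has dimension $4$; (ii) at a general point $p$ of $S$ there is exactly one unordered pair of conjugate directions, where the two directions of the pair may be distinct or may coincide (in the latter case the pair is one asymptotic direction); (iii) the Zariski closure $V\subset\mathbb{P}^N$ of the union of the tangent planes $\mathbb{T}_pS$ at the non-singular points $p$ of $S$ is a variety (irreducible) of dimension $4$, and its embedded tangent space is fixed along those planes: for every non-singular point $p$ of $S$ and all $q,q'\in\mathbb{T}_pS$ that are non-singular points of $V$, $\mathbb{T}_qV=\mathbb{T}_{q'}V$. -/

import Mathlib

namespace ProjSurf

noncomputable section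

open MvPolynomial

variable {K : Type*} [Field K] {N : ℕ}

/-- The projective space `ℙ^N` over `K`, as the set of lines in `K^(N+1)`. -/
abbrev PSpace (K : Type*) [Field K] (N : ℕ) : Type _ :=
  Projectivization K (Fin (N + 1) → K)

/-- The punctured affine cone over a subset of `ℙ^N`. -/
def affineCone (A : Set (PSpace K N)) : Set (Fin (N + 1) → K) :=
  {x | ∃ h : x ≠ 0, Projectivization.mk K x h ∈ A}

/-- The ideal `I(A)` of all polynomials vanishing on `A`, that is, on its affine cone. -/
def idealOf (A : Set (PSpace K N)) : Ideal (MvPolynomial (Fin (N + 1)) K) :=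
  vanishingIdeal K (affineCone A)

/-- The homogeneous coordinate ring of `A`. -/
abbrev CoordRing (A : Set (PSpace K N)) : Type _ :=
  MvPolynomial (Fin (N + 1)) K ⧸ idealOf A

/-- Zariski closed subsets of `ℙ^N`: common zero loci of homogeneous polynomials. -/
def IsZariskiClosed (A : Set (PSpace K N)) : Prop :=
  ∃ F : Set (MvPolynomial (Fin (N + 1)) K), (∀ f ∈ F, ∃ n, f.IsHomogeneous n) ∧
    A = {p | ∀ f ∈ F, eval p.rep f = 0}

/-- The Zariski closure of `A`: the points where all polynomials vanishing on `A` vanish. -/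
def zariskiClosure (A : Set (PSpace K N)) : Set (PSpace K N) :=
  {p | ∀ f ∈ idealOf A, eval p.rep f = 0}

/-- A projective variety: an irreducible (in particular non-empty) closed subset of `ℙ^N`. -/
structure IsProjVariety (X : Set (PSpace K N)) : Prop where
  closed : IsZariskiClosed X
  prime : (idealOf X).IsPrime

/-- `X` has dimension `d`: its homogeneous coordinate ring, which is the coordinate ring of the
`(d+1)`-dimensional affine cone, has transcendence degree `d + 1` over `K`. -/
def HasDim (X : Set (PSpace K N)) (d : ℕ) : Prop :=
  Algebra.trdeg K (CoordRing X) = ((d + 1 : ℕ) : Cardinal)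

/-- The first differential `df_x(v) = ∑ᵢ ∂ᵢf(x) vᵢ`. -/
def diff1 (f : MvPolynomial (Fin (N + 1)) K) (x v : Fin (N + 1) → K) : K :=
  ∑ i, eval x (pderiv i f) * v i

/-- The second differential `d²f_x(v, w) = ∑ᵢⱼ ∂ᵢ∂ⱼf(x) vᵢ wⱼ`. -/
def diff2 (f : MvPolynomial (Fin (N + 1)) K) (x v w : Fin (N + 1) → K) : K :=
  ∑ i, ∑ j, eval x (pderiv i (pderiv j f)) * v i * w j

/-- The linear subspace of `K^(N+1)` whose projectivization is the embedded (Zariski) tangent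
space to `X` at `p`. -/
def tangentSpace (X : Set (PSpace K N)) (p : PSpace K N) :
    Submodule K (Fin (N + 1) → K) where
  carrier := {v | ∀ f ∈ idealOf X, diff1 f p.rep v = 0}
  zero_mem' := by intro f _; simp [diff1]
  add_mem' := by
    intro v w hv hw f hf
    have h1 := hv f hf
    have h2 := hw f hf
    simp only [diff1] at h1 h2 ⊢
    simp [mul_add, Finset.sum_add_distrib, h1, h2]
  smul_mem' := by
    intro c v hv f hf
    have h1 := hv f hf
    simp only [diff1] at h1 ⊢
    have : ∀ i, eval p.rep (pderiv i f) * (c • v) i = c * (eval p.rep (pderiv i f) * v i) := by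
      intro i; simp [mul_left_comm]
    rw [Finset.sum_congr rfl fun i _ => this i, ← Finset.mul_sum, h1, mul_zero]

/-- `p` is a non-singular point of the variety `X`: it lies on `X` and the embedded tangent space
there has the dimension of `X` (both dimensions are increased by one here, by passing to cones). -/
def IsNonsingularPoint (X : Set (PSpace K N)) (p : PSpace K N) : Prop :=
  p ∈ X ∧ Module.rank K (tangentSpace X p) = Algebra.trdeg K (CoordRing X)

/-- A property holds at a general point of `X`: it holds on a non-empty Zariski open subset. -/
def AtGeneralPoint (X : Set (PSpace K N)) (P : PSpace K N → Prop) : Prop :=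
  ∃ U : Set (PSpace K N), IsZariskiClosed Uᶜ ∧ (X ∩ U).Nonempty ∧ ∀ p ∈ X ∩ U, P p

/-- The linear form `∑ᵢ aᵢ Xᵢ`. -/
def linForm (a : Fin (N + 1) → K) : MvPolynomial (Fin (N + 1)) K :=
  ∑ i, C (a i) * X i

/-- The linear subspace of `K^(N+1)` whose projectivization is the `k`-th osculating space to `X`
at `p`: the intersection of all hyperplanes `∑ᵢ aᵢ Xᵢ = 0` which have contact of order `> k` with
`X` at `p`, i.e. whose equation restricted to `X` lies in the `(k+1)`-st power of the maximal
ideal of `p`. For a non-singular point and `k = 2`, this is the span of the point and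
of the derivatives of order at most two of a local parametrization. -/
def osculatingSpace (k : ℕ) (X : Set (PSpace K N)) (p : PSpace K N) :
    Submodule K (Fin (N + 1) → K) where
  carrier := {v | ∀ a : Fin (N + 1) → K,
    linForm a ∈ idealOf X ⊔ (RingHom.ker (eval p.rep)) ^ (k + 1) → ∑ i, a i * v i = 0}
  zero_mem' := by intro a _; simp
  add_mem' := by
    intro v w hv hw a ha
    simp [mul_add, Finset.sum_add_distrib, hv a ha, hw a ha]
  smul_mem' := by
    intro c v hv a ha
    have : ∀ i, a i * (c • v) i = c * (a i * v i) := by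
      intro i; simp [mul_left_comm]
    rw [Finset.sum_congr rfl fun i _ => this i, ← Finset.mul_sum, hv a ha, mul_zero]

/-- The (intrinsic) tangent space `T_p X`, identified by the choice of the representative of `p`
with the quotient of the cone over the embedded tangent space by the line `p`. -/
abbrev TangentVectors (X : Set (PSpace K N)) (p : PSpace K N) : Type _ :=
  tangentSpace X p ⧸ p.submodule.submoduleOf (tangentSpace X p)

/-- The value of the second fundamental form of `X` at `p` on the classes of `v` and `w`
(both in the cone over the embedded tangent space) is the class of `u` in the normal space
`K^(N+1) / tangentSpace X p`.

The second fundamental form is the differential of the Gauss map `q ↦ tangentSpace X q`: its value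
on `v` is the homomorphism which sends `w` to the class of any `u` such that, over the dual numbers
`K[ε]`, the vector `w + ε u` is tangent at the point `x + ε v`, that is `df_{x + ε v}(w + ε u) = 0`
for all `f` in the ideal of `X`. The coefficient of `ε` in this equation is the expression below. -/
def IsSecondFundamentalFormValue (X : Set (PSpace K N)) (p : PSpace K N)
    (v w u : Fin (N + 1) → K) : Prop :=
  ∀ f ∈ idealOf X, diff1 f p.rep u + diff2 f p.rep v w = 0

/-- Two tangent vectors are conjugate: the second fundamental form takes the value `0` on them. -/
def IsConjugate (X : Set (PSpace K N)) (p : PSpace K N) (v w : TangentVectors X p) : Prop :=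
  ∀ v' w' : tangentSpace X p, Submodule.Quotient.mk v' = v → Submodule.Quotient.mk w' = w →
    IsSecondFundamentalFormValue X p v' w' 0

/-- Tangent directions at `p`: points of `ℙ(T_p X)`. -/
abbrev Direction (X : Set (PSpace K N)) (p : PSpace K N) : Type _ :=
  Projectivization K (TangentVectors X p)

/-- Two directions are conjugate if the tangent vectors representing them are. A direction is
asymptotic if it is conjugate to itself. -/
def AreConjugateDirections (X : Set (PSpace K N)) (p : PSpace K N) (d e : Direction X p) : Prop :=
  IsConjugate X p d.rep e.rep

/-- An unordered pair of directions, possibly coincident, is a conjugate pair. A coincident pair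
`s(d, d)` is conjugate if and only if `d` is an asymptotic direction. -/
def IsConjugatePair (X : Set (PSpace K N)) (p : PSpace K N) (s : Sym2 (Direction X p)) : Prop :=
  ∀ d e : Direction X p, s = s(d, e) → AreConjugateDirections X p d e

/-- `S` is a `Φ` surface: its second osculating space at the general point has (projective)
dimension `4`. -/
def IsPhiSurface (S : Set (PSpace K N)) : Prop :=
  AtGeneralPoint S fun p => IsNonsingularPoint S p ∧
    Module.finrank K (osculatingSpace 2 S p) = 4 + 1

/-- At a general point of `S` there is exactly one unordered pair of conjugate directions:
either two distinct conjugate directions, or one (doubly counted) asymptotic direction. -/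
def HasUniqueConjugatePair (S : Set (PSpace K N)) : Prop :=
  AtGeneralPoint S fun p => IsNonsingularPoint S p ∧
    ∃! s : Sym2 (Direction S p), IsConjugatePair S p s

/-- The embedded tangent space to `X` at `p`, as a subset of `ℙ^N`. -/
def embeddedTangentSpace (X : Set (PSpace K N)) (p : PSpace K N) : Set (PSpace K N) :=
  {q | q.submodule ≤ tangentSpace X p}

/-- The tangent variety: the closure of the union of the embedded tangent spaces to `X` at its
non-singular points. -/
def tangentVariety (X : Set (PSpace K N)) : Set (PSpace K N) :=
  zariskiClosure {q | ∃ p, IsNonsingularPoint X p ∧ q ∈ embeddedTangentSpace X p}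

/-- The union of the tangent planes to `S` is a variety of dimension `4`, whose embedded tangent
space is fixed along those planes (at its non-singular points). -/
def TangentVarietyIsFourfoldWithFixedTangent (S : Set (PSpace K N)) : Prop :=
  IsProjVariety (tangentVariety S) ∧ HasDim (tangentVariety S) 4 ∧
    ∀ p, IsNonsingularPoint S p → ∀ q ∈ embeddedTangentSpace S p, ∀ q' ∈ embeddedTangentSpace S p,
      IsNonsingularPoint (tangentVariety S) q → IsNonsingularPoint (tangentVariety S) q' →
        embeddedTangentSpace (tangentVariety S) q = embeddedTangentSpace (tangentVariety S) q'

end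

end ProjSurf

/-! Everything takes place on the affine cone over `S`, which has dimension 3. Near a non-singular
point its tangent spaces are spanned by three polynomial vector fields B₀, B₁, B₂ (`IsFrame`,
`exists_isFrame`). Differentiating df(Bᵢ) = 0 along Bⱼ shows that the derivative of Bᵢ along Bⱼ
represents the second fundamental form II modulo the tangent space (`conormalMap_dirDeriv`). By
Euler's relation II kills the position vector x, so it descends to the plane T_pS. The cone over the
second osculating space is the span of the Bᵢ and their derivatives along the frame
(`osculatingSpace_mk`). Its dimension is therefore 3 + r, where r is the dimension of the span of
the values of II, and a Φ surface is one with r = 2 at the general point.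

A symmetric bilinear map on a plane is the same as a linear map ψ on the 3-dimensional space of
coefficients of binary quadratic forms. Over an algebraically closed field every nonzero form is a
product of two linear forms, uniquely up to order and scalars. So conjugate pairs correspond to
points of ℙ(ker ψ). There is exactly one pair iff ker ψ is a line, that is, iff r = 2
(`existsUnique_pair_iff`). This gives (i) ⇔ (ii) point by point.

The cone over the tangent variety V is parametrized by (x, t) ↦ v = ∑ tᵢ Bᵢ(x). The derivatives of
this map span a space which contains the tangent space at x and is, modulo it, the image of II(v,
·). In characteristic 0 this span is the whole tangent space of V at a general (x, t)
(`exists_tangentAt_eq_rulingTangent`). If r = 2, then II(v, ·) is injective on T_pS for v off the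
two conjugate lines, so the rank is 5. The tangent space of V at v then fills the cone over the
second osculating space, which depends on x alone; a density argument carries this to all the
non-singular points in question (`IsPhiSurface.tangentAt_rulingPoint_le`). Conversely, suppose the
tangent space of V is one fixed W for general t. The derivatives along the frame are linear in t, so
W contains each second derivative (`secondSpan_le_of_forall_rulingTangent_le`). Hence W is the cone
over the second osculating space, of dimension 5. -/

namespace ProjSurf

open MvPolynomial

/-! ### Derivations of function fields and the tangent space at the generic point -/

section Differentials

set_option linter.unusedSectionVars false

universe u v

variable {K : Type u} [Field K] {σ : Type v} [Fintype σ]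

/-- The differential of a polynomial at a point with values in an extension `F` of `K`. -/
noncomputable def diffAt {F : Type*} [CommRing F] [Algebra K F] (f : MvPolynomial σ K)
    (x w : σ → F) : F :=
  ∑ i, aeval x (pderiv i f) * w i

/-- The chain rule. An equation f = 0 along a parametrization is differentiated by applying a
derivation to it. -/
theorem derivation_aeval {F : Type*} [CommRing F] [Algebra K F] (D : Derivation K F F)
    (x : σ → F) (f : MvPolynomial σ K) :
    D (aeval x f) = diffAt f x (fun i => D (x i)) := by
  classical
  unfold diffAt
  induction f using MvPolynomial.induction_on with
  | C a => simp
  | add p q hp hq => simp [hp, hq, add_mul, Finset.sum_add_distrib]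
  | mul_X p i hp =>
    simp only [map_mul, aeval_X, Derivation.leibniz, hp, smul_eq_mul, pderiv_X, map_add, add_mul,
      Finset.sum_add_distrib]
    congr 1
    · rw [Finset.sum_eq_single i]
      · simp
      · intro j _ hj; simp [hj.symm]
      · simp
    · rw [Finset.mul_sum]
      exact Finset.sum_congr rfl fun j _ => by ring

theorem diffAt_add {F : Type*} [CommRing F] [Algebra K F] (f g : MvPolynomial σ K)
    (x w : σ → F) : diffAt (f + g) x w = diffAt f x w + diffAt g x w := by
  simp [diffAt, add_mul, Finset.sum_add_distrib]

theorem diffAt_mul {F : Type*} [CommRing F] [Algebra K F] (f g : MvPolynomial σ K)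
    (x w : σ → F) :
    diffAt (f * g) x w = aeval x f * diffAt g x w + aeval x g * diffAt f x w := by
  simp only [diffAt, Derivation.leibniz, smul_eq_mul, map_add, map_mul, add_mul,
    Finset.sum_add_distrib, Finset.mul_sum]
  congr 1 <;> exact Finset.sum_congr rfl fun j _ => by ring

theorem diffAt_C {F : Type*} [CommRing F] [Algebra K F] (a : K)
    (x w : σ → F) : diffAt (C a) x w = 0 := by
  simp [diffAt]

theorem diffAt_smul {F : Type*} [CommRing F] [Algebra K F] (a : K) (f : MvPolynomial σ K)
    (x w : σ → F) : diffAt (a • f) x w = a • diffAt f x w := by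
  rw [smul_eq_C_mul, diffAt_mul, diffAt_C]
  simp [Algebra.smul_def]

/-- `F` is reached from `A` by a localization, a purely transcendental extension and an algebraic
extension. The last is separable in characteristic 0, so every stage is formally smooth. -/
theorem formallySmooth_of_subring_field {A F : Type*} [CommRing A] [IsDomain A] [Field F]
    [CharZero F] [Algebra A F] [FaithfulSMul A F] : Algebra.FormallySmooth A F := by
  let : Algebra (FractionRing A) F := FractionRing.liftAlgebra A F
  have : IsScalarTower A (FractionRing A) F := FractionRing.isScalarTower_liftAlgebra A F
  have : Algebra.FormallySmooth A (FractionRing A) := .of_isLocalization (nonZeroDivisors A)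
  have : CharZero (FractionRing A) := ⟨fun a b h => by
    have h1 := congrArg (algebraMap (FractionRing A) F) h
    simpa using h1⟩
  obtain ⟨ι, v, hv⟩ := exists_isTranscendenceBasis' (FractionRing A) F
  have := hv.isAlgebraic_field
  have : Algebra.FormallySmooth (FractionRing A) F :=
    .of_algebraicIndependent_of_isSeparable hv.1
  exact .comp A (FractionRing A) F

/-- Formal smoothness of `F` over `A` kills the first cotangent homology, so the base change of the
differentials of `A` injects into those of `F`. An `F`-linear left inverse of this injection extends
the functional that corresponds to `d`. -/
theorem exists_derivation_extend {A F : Type*} [CommRing A] [IsDomain A] [Field F]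
    [CharZero F] [Algebra K A] [Algebra K F] [Algebra A F] [IsScalarTower K A F]
    [FaithfulSMul A F] (d : Derivation K A F) :
    ∃ D : Derivation K F F, ∀ a, D (algebraMap A F a) = d a := by
  have := formallySmooth_of_subring_field (A := A) (F := F)
  have hinj : Function.Injective (KaehlerDifferential.mapBaseChange K A F) := by
    rw [injective_iff_map_eq_zero]
    intro y hy
    obtain ⟨z, hz⟩ := (Algebra.H1Cotangent.exact_δ_mapBaseChange K A F y).1 hy
    rw [← hz, Subsingleton.elim z 0, map_zero]
  obtain ⟨g, hg⟩ := LinearMap.exists_leftInverse_of_injective _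
    (LinearMap.ker_eq_bot.2 hinj)
  refine ⟨((d.liftKaehlerDifferential.liftBaseChange F).comp g).compDer
    (KaehlerDifferential.D K F), fun a => ?_⟩
  have h1 : KaehlerDifferential.D K F (algebraMap A F a)
      = KaehlerDifferential.mapBaseChange K A F (1 ⊗ₜ KaehlerDifferential.D K A a) := by
    simp
  have h2 := LinearMap.congr_fun hg (1 ⊗ₜ KaehlerDifferential.D K A a)
  simp only [LinearMap.comp_apply, LinearMap.id_apply] at h2
  change (d.liftKaehlerDifferential.liftBaseChange F)
    (g (KaehlerDifferential.D K F (algebraMap A F a))) = _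
  rw [h1, h2]
  simp

/-- The hypothesis says precisely that f(x) ↦ df_x(w) is well defined on the subring K[x] of `F`.
There it is a derivation, and it extends to `F`. -/
theorem exists_derivation [CharZero K] {F : Type*} [Field F] [Algebra K F] (x w : σ → F)
    (h : ∀ f : MvPolynomial σ K, aeval x f = 0 → diffAt f x w = 0) :
    ∃ D : Derivation K F F, ∀ i, D (x i) = w i := by
  have : CharZero F := charZero_of_injective_algebraMap (algebraMap K F).injective
  let A := (aeval x : MvPolynomial σ K →ₐ[K] F).range
  have hs : ∀ a : A, ∃ f : MvPolynomial σ K, aeval x f = (a : F) := fun a => a.2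
  choose g hg using hs
  have key : ∀ (a : A) (f : MvPolynomial σ K), aeval x f = (a : F) → diffAt (g a) x w = diffAt f x w := by
    intro a f hf
    have h1 := h (g a + (-1 : K) • f) (by simp [hg, hf])
    rw [diffAt_add, diffAt_smul] at h1
    simpa [add_neg_eq_zero] using h1
  let d : Derivation K A F := Derivation.mk'
    { toFun := fun a => diffAt (g a) x w
      map_add' := fun a b => by
        rw [key (a + b) (g a + g b) (by simp [hg]), diffAt_add]
      map_smul' := fun c a => by
        rw [key (c • a) (c • g a) (by simp [hg]), diffAt_smul]; rfl }
    (fun a b => by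
      change diffAt (g (a * b)) x w = _
      rw [key (a * b) (g a * g b) (by simp [hg]), diffAt_mul, hg, hg]; rfl)
  obtain ⟨D, hD⟩ := exists_derivation_extend d
  refine ⟨D, fun i => ?_⟩
  have h1 := hD ⟨x i, ⟨X i, by simp⟩⟩
  have h2 : d ⟨x i, ⟨X i, by simp⟩⟩ = w i := by
    classical
    change diffAt (g _) x w = _
    rw [key _ (X i) (by simp)]
    simp [diffAt, pderiv_X, Pi.single_apply]
  rw [← h2, ← h1]; rfl

/-- The tangent space at an `F`-valued point of the scheme defined by an ideal. -/
noncomputable def tangentAt {F : Type*} [CommRing F] [Algebra K F] (P : Ideal (MvPolynomial σ K))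
    (x : σ → F) : Submodule F (σ → F) where
  carrier := {w | ∀ f ∈ P, diffAt f x w = 0}
  zero_mem' := by intro f _; simp [diffAt]
  add_mem' := by
    intro v w hv hw f hf
    have h1 := hv f hf
    have h2 := hw f hf
    simp only [diffAt] at h1 h2 ⊢
    simp [mul_add, Finset.sum_add_distrib, h1, h2]
  smul_mem' := by
    intro c v hv f hf
    have h1 := hv f hf
    simp only [diffAt] at h1 ⊢
    have : ∀ i, aeval x (pderiv i f) * (c • v) i = c * (aeval x (pderiv i f) * v i) := by
      intro i; simp [mul_left_comm]
    rw [Finset.sum_congr rfl fun i _ => this i, ← Finset.mul_sum, h1, mul_zero]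

theorem mem_tangentAt {F : Type*} [CommRing F] [Algebra K F] {P : Ideal (MvPolynomial σ K)}
    {x w : σ → F} : w ∈ tangentAt P x ↔ ∀ f ∈ P, diffAt f x w = 0 := Iff.rfl

/-- A derivation killing a transcendence basis is zero. -/
theorem derivation_eq_zero_of_transcendenceBasis [CharZero K] {F : Type*} [Field F] [Algebra K F]
    {ι : Type*} {y : ι → F} (hy : IsTranscendenceBasis K y) (D : Derivation K F F)
    (h : ∀ i, D (y i) = 0) : D = 0 := by
  let E : IntermediateField K F :=
    { carrier := {a | D a = 0}
      mul_mem' := fun {a b} ha hb => by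
        simp only [Set.mem_ofPred_eq] at ha hb ⊢; rw [D.leibniz, ha, hb]; simp
      add_mem' := fun {a b} ha hb => by
        simp only [Set.mem_ofPred_eq] at ha hb ⊢; rw [D.map_add, ha, hb]; simp
      algebraMap_mem' := fun r => D.map_algebraMap r
      inv_mem' := fun a ha => by
        simp only [Set.mem_ofPred_eq] at ha ⊢; rw [D.leibniz_inv, ha]; simp }
  have hE : IntermediateField.adjoin K (Set.range y) ≤ E := by
    rw [IntermediateField.adjoin_le_iff]
    rintro _ ⟨i, rfl⟩
    exact h i
  have := hy.isAlgebraic_field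
  ext a
  have ha : IsIntegral (IntermediateField.adjoin K (Set.range y)) a :=
    (Algebra.IsAlgebraic.isAlgebraic a).isIntegral
  -- Read over the intermediate field, `D` can be applied to a minimal polynomial m: this gives
  -- m'(a) · D a = 0, and m'(a) ≠ 0 by separability.
  let D' : Derivation (IntermediateField.adjoin K (Set.range y)) F F := Derivation.mk'
    { toFun := D
      map_add' := D.map_add
      map_smul' := fun c b => by
        have hc : D (c : F) = 0 := hE c.2
        rw [Algebra.smul_def, D.leibniz]
        change (c : F) • D b + b • D (c : F) = _
        rw [hc, smul_zero, add_zero]; rfl } (fun a b => D.leibniz a b)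
  have h1 := D'.map_aeval (minpoly (IntermediateField.adjoin K (Set.range y)) a) a
  rw [minpoly.aeval, map_zero] at h1
  have h2 : Polynomial.aeval a (Polynomial.derivative
      (minpoly (IntermediateField.adjoin K (Set.range y)) a)) ≠ 0 :=
    (minpoly.irreducible ha).separable.aeval_derivative_ne_zero (minpoly.aeval _ _)
  have h3 : D' a = 0 := by
    simpa [h2] using h1.symm
  exact h3

/-- The generic point of the scheme of a prime ideal. -/
noncomputable def genericPoint (P : Ideal (MvPolynomial σ K)) :
    σ → FractionRing (MvPolynomial σ K ⧸ P) :=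
  fun i => algebraMap (MvPolynomial σ K ⧸ P) _ (Ideal.Quotient.mk P (X i))

theorem aeval_genericPoint (P : Ideal (MvPolynomial σ K)) (f : MvPolynomial σ K) :
    aeval (genericPoint P) f = algebraMap (MvPolynomial σ K ⧸ P) _ (Ideal.Quotient.mk P f) := by
  have : (aeval (genericPoint P) : MvPolynomial σ K →ₐ[K] _) =
    (IsScalarTower.toAlgHom K (MvPolynomial σ K ⧸ P) (FractionRing (MvPolynomial σ K ⧸ P))).comp
      (Ideal.Quotient.mkₐ K P) := by
    ext i; simp [genericPoint]
  rw [this]; rfl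

theorem aeval_genericPoint_eq_zero {P : Ideal (MvPolynomial σ K)} [P.IsPrime]
    {f : MvPolynomial σ K} : aeval (genericPoint P) f = 0 ↔ f ∈ P := by
  rw [aeval_genericPoint, FaithfulSMul.algebraMap_eq_zero_iff, Ideal.Quotient.eq_zero_iff_mem]

/-- Tangent vectors at the generic point are the values on the coordinates of derivations of the
function field. A derivation is determined by its values on a transcendence basis, and these can be
prescribed freely. -/
theorem finrank_tangentAt_genericPoint [CharZero K] (P : Ideal (MvPolynomial σ K)) [P.IsPrime]
    {d : ℕ} (hd : Algebra.trdeg K (MvPolynomial σ K ⧸ P) = d) :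
    Module.finrank (FractionRing (MvPolynomial σ K ⧸ P)) (tangentAt P (genericPoint P)) = d := by
  classical
  let A := MvPolynomial σ K ⧸ P
  let F := FractionRing A
  let ξ := genericPoint P
  have hgen : Algebra.adjoin K (Set.range fun i : σ => (Ideal.Quotient.mk P (X i) : A)) = ⊤ := by
    rw [eq_top_iff]
    rintro a -
    obtain ⟨f, rfl⟩ := Ideal.Quotient.mk_surjective a
    rw [Algebra.adjoin_range_eq_range_aeval]
    refine ⟨f, ?_⟩
    have : (aeval (fun i : σ => (Ideal.Quotient.mk P (X i) : A)) : MvPolynomial σ K →ₐ[K] A) =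
      Ideal.Quotient.mkₐ K P := by ext i; rw [aeval_X]; rfl
    change aeval _ f = _
    rw [this]; rfl
  have : Algebra.IsAlgebraic (Algebra.adjoin K
      (Set.range fun i : σ => (Ideal.Quotient.mk P (X i) : A))) A := by
    rw [hgen]
    exact ⟨fun a => isAlgebraic_algebraMap (R := (⊤ : Subalgebra K A)) ⟨a, trivial⟩⟩
  have : FaithfulSMul K A := (faithfulSMul_iff_algebraMap_injective K A).2
    (algebraMap K A).injective
  -- Taking the basis among the coordinate classes makes the restriction map `L` a coordinate
  -- projection.
  obtain ⟨t, hts, ht⟩ := exists_isTranscendenceBasis_subset (R := K)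
    (Set.range fun i : σ => (Ideal.Quotient.mk P (X i) : A))
  have htc : ∀ a : t, ∃ i : σ, (Ideal.Quotient.mk P (X i) : A) = a := fun a => hts a.2
  choose q hq using htc
  have : Finite t := (Set.finite_range _).subset hts
  have : Fintype t := Fintype.ofFinite t
  have hcard : Fintype.card t = d := by
    have := ht.cardinalMk_eq_trdeg
    rw [hd, Cardinal.mk_fintype] at this
    exact_mod_cast this
  have hy : IsTranscendenceBasis K (fun a : t => ξ (q a)) := by
    have : Algebra.IsAlgebraic (MvPolynomial σ K ⧸ P) F :=
      IsLocalization.isAlgebraic _ (nonZeroDivisors (MvPolynomial σ K ⧸ P))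
    convert! ht.algebraMap_comp (A := F) using 1
    funext a
    rw [Function.comp_apply, ← hq a]; rfl
  let L : tangentAt P ξ →ₗ[F] (t → F) :=
    (LinearMap.funLeft F F q).comp (tangentAt P ξ).subtype
  have hL : Function.Bijective L := by
    constructor
    · rw [injective_iff_map_eq_zero]
      intro w hw
      obtain ⟨D, hD⟩ := exists_derivation ξ w.1 (fun f hf =>
        w.2 f (aeval_genericPoint_eq_zero.1 hf))
      have hD0 := derivation_eq_zero_of_transcendenceBasis hy D (fun a => by
        rw [hD]; exact congrFun hw a)
      ext i
      rw [← hD, hD0]; rfl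
    · intro c
      obtain ⟨D, hD⟩ := exists_derivation (K := K) (fun a : t => ξ (q a)) c (fun f hf => by
        have : f = 0 := hy.1 (by simpa using hf)
        simp [this, diffAt])
      refine ⟨⟨fun i => D (ξ i), fun f hf => ?_⟩, funext fun a => hD a⟩
      rw [← derivation_aeval, aeval_genericPoint_eq_zero.2 hf, map_zero]
  rw [(LinearEquiv.ofBijective L hL).finrank_eq, Module.finrank_fintype_fun_eq_card, hcard]

end Differentials

end ProjSurf

namespace ProjSurf

open MvPolynomial

/-! ### Polynomial moving frames of the tangent spaces -/

section Frames

set_option linter.unusedSectionVars false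

universe u

variable {K : Type u} [Field K] {σ : Type} [Fintype σ]

/-- A moving frame of the tangent spaces along the locus of a prime ideal, where `Δ ≠ 0`. -/
structure IsFrame (P : Ideal (MvPolynomial σ K)) {d : ℕ} (Δ : MvPolynomial σ K)
    (B : Fin d → σ → MvPolynomial σ K) (e : Fin d → σ) : Prop where
  tangent : ∀ f ∈ P, ∀ j, ∑ i, pderiv i f * B j i ∈ P
  normalized : ∀ j j', B j (e j') = if j = j' then Δ else 0
  -- Cramer's rule with denominator `Δ`. It is required over every extension field, so that it
  -- applies both at `K`-points and at generic points.
  expand : ∀ (F : Type u) [Field F] [Algebra K F] (x w : σ → F), w ∈ tangentAt P x →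
    ∀ i, aeval x Δ * w i = ∑ j, w (e j) * aeval x (B j i)

variable {P : Ideal (MvPolynomial σ K)} {d : ℕ} {Δ : MvPolynomial σ K}
    {B : Fin d → σ → MvPolynomial σ K} {e : Fin d → σ}

/-- The value of a polynomial vector field at a point. -/
noncomputable def evalVec {F : Type*} [CommRing F] [Algebra K F] (b : σ → MvPolynomial σ K)
    (x : σ → F) : σ → F := fun i => aeval x (b i)

theorem IsFrame.evalVec_mem {F : Type*} [Field F] [Algebra K F] (h : IsFrame P Δ B e)
    {x : σ → F} (hx : ∀ f ∈ P, aeval x f = 0) (j : Fin d) :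
    evalVec (B j) x ∈ tangentAt P x := by
  intro f hf
  have := hx _ (h.tangent f hf j)
  simpa [diffAt, evalVec, map_sum] using this

theorem IsFrame.linearIndependent {F : Type*} [Field F] [Algebra K F] (h : IsFrame P Δ B e)
    {x : σ → F} (hΔ : aeval x Δ ≠ 0) : LinearIndependent F fun j => evalVec (B j) x := by
  classical
  rw [Fintype.linearIndependent_iff]
  intro g hg j
  have h1 := congrFun hg (e j)
  simp only [Finset.sum_apply, Pi.smul_apply, evalVec, h.normalized, smul_eq_mul,
    Pi.zero_apply] at h1
  rw [Finset.sum_eq_single j] at h1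
  · simpa [hΔ] using h1
  · intro b _ hb; simp [hb]
  · simp

theorem IsFrame.mem_span {F : Type u} [Field F] [Algebra K F] (h : IsFrame P Δ B e)
    {x w : σ → F} (hΔ : aeval x Δ ≠ 0) (hw : w ∈ tangentAt P x) :
    w = ∑ j, ((aeval x Δ)⁻¹ * w (e j)) • evalVec (B j) x := by
  funext i
  have h1 := h.expand F x w hw i
  simp only [Finset.sum_apply, Pi.smul_apply, smul_eq_mul, evalVec, mul_assoc]
  rw [← Finset.mul_sum, ← h1, inv_mul_cancel_left₀ hΔ]

theorem IsFrame.tangentAt_eq {F : Type u} [Field F] [Algebra K F] (h : IsFrame P Δ B e)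
    {x : σ → F} (hx : ∀ f ∈ P, aeval x f = 0) (hΔ : aeval x Δ ≠ 0) :
    tangentAt P x = Submodule.span F (Set.range fun j => evalVec (B j) x) := by
  apply le_antisymm
  · intro w hw
    rw [h.mem_span hΔ hw]
    exact Submodule.sum_mem _ fun j _ => Submodule.smul_mem _ _ (Submodule.subset_span ⟨j, rfl⟩)
  · rw [Submodule.span_le]
    rintro _ ⟨j, rfl⟩
    exact h.evalVec_mem hx j

theorem IsFrame.finrank_tangentAt {F : Type u} [Field F] [Algebra K F]
    (h : IsFrame P Δ B e) {x : σ → F} (hx : ∀ f ∈ P, aeval x f = 0) (hΔ : aeval x Δ ≠ 0) :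
    Module.finrank F (tangentAt P x) = d := by
  rw [h.tangentAt_eq hx hΔ, finrank_span_eq_card (h.linearIndependent hΔ), Fintype.card_fin]

/-- The differential of a polynomial at a point, as a linear functional. -/
noncomputable def diffFunctional {F : Type*} [CommRing F] [Algebra K F] (x : σ → F)
    (f : MvPolynomial σ K) : Module.Dual F (σ → F) :=
  ∑ i, aeval x (pderiv i f) • LinearMap.proj i

theorem diffFunctional_apply {F : Type*} [CommRing F] [Algebra K F] (x w : σ → F)
    (f : MvPolynomial σ K) : diffFunctional x f w = diffAt f x w := by
  simp [diffFunctional, diffAt, LinearMap.sum_apply]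

theorem tangentAt_eq_dualCoannihilator {F : Type*} [CommRing F] [Algebra K F] (x : σ → F) :
    tangentAt P x =
      (Submodule.span F (diffFunctional x '' (P : Set (MvPolynomial σ K)))).dualCoannihilator := by
  ext w
  rw [mem_tangentAt, Submodule.mem_dualCoannihilator]
  constructor
  · intro h φ hφ
    induction hφ using Submodule.span_induction with
    | mem φ hφ => obtain ⟨f, hf, rfl⟩ := hφ; rw [diffFunctional_apply]; exact h f hf
    | zero => simp
    | add a b _ _ ha hb => simp [ha, hb]
    | smul c a _ ha => simp [ha]
  · intro h f hf
    rw [← diffFunctional_apply]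
    exact h _ (Submodule.subset_span ⟨f, hf, rfl⟩)

/-- Differentials of elements of `P` and coordinate functionals forming a basis. -/
theorem exists_basis_rows {F : Type*} [Field F] [Algebra K F] (x : σ → F) :
    ∃ (p : σ → Prop) (f : σ → MvPolynomial σ K) (r : σ → σ),
      (∀ k, f k ∈ P) ∧
      (∀ [DecidablePred p], LinearIndependent F fun k => if p k then diffFunctional x (f k) else
        (LinearMap.proj (r k) : Module.Dual F (σ → F))) ∧
      Nat.card {k // ¬ p k} = Module.finrank F (tangentAt P x) := by
  classical
  set s : Set (Module.Dual F (σ → F)) := diffFunctional x '' (P : Set (MvPolynomial σ K)) with hs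
  let co : Set (Module.Dual F (σ → F)) := Set.range fun i : σ => LinearMap.proj i
  -- A basis of the span of the differentials is completed to a basis of the dual space by
  -- coordinate functionals.
  obtain ⟨b, hbs, hbspan, hbli⟩ := exists_linearIndependent F s
  have hbli' : LinearIndepOn F id b := hbli
  have hsub : b ⊆ s ∪ co := hbs.trans Set.subset_union_left
  set b' := hbli'.extend hsub with hb'
  have hb'li : LinearIndepOn F id b' := hbli'.linearIndepOn_extend hsub
  have hb'sub : b' ⊆ s ∪ co := hbli'.extend_subset hsub
  have hbb' : b ⊆ b' := hbli'.subset_extend hsub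
  have hco : Submodule.span F co = ⊤ := by
    rw [eq_top_iff]
    intro φ _
    have : φ = ∑ i, φ (Pi.single i 1) • (LinearMap.proj i : Module.Dual F (σ → F)) := by
      apply LinearMap.pi_ext
      intro i c
      rw [LinearMap.sum_apply, Finset.sum_eq_single i]
      · have : (Pi.single i c : σ → F) = c • Pi.single i 1 := by
          rw [← Pi.single_smul]; simp
        rw [this]
        simp [mul_comm]
      · intro j _ hj; simp [hj]
      · simp
    rw [this]
    exact Submodule.sum_mem _ fun i _ => Submodule.smul_mem _ _ (Submodule.subset_span ⟨i, rfl⟩)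
  have hspan : Submodule.span F b' = ⊤ := by
    rw [hb', hbli'.span_extend_eq_span hsub, eq_top_iff, ← hco]
    exact Submodule.span_mono Set.subset_union_right
  let bas : Module.Basis b' F (Module.Dual F (σ → F)) :=
    Module.Basis.mk hb'li (by rw [← hspan]; exact (congrArg _ (by simp)).le)
  have hfin : Finite b' := Module.Finite.finite_basis bas
  have : Fintype b' := Fintype.ofFinite _
  have hcard : Fintype.card σ = Fintype.card b' := by
    rw [← Module.finrank_eq_card_basis bas, Subspace.dual_finrank_eq,
      Module.finrank_fintype_fun_eq_card]
  let ε : σ ≃ b' := Fintype.equivOfCardEq hcard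
  have h1 : ∀ v : b, ∃ f ∈ P, diffFunctional x f = v.1 := fun v => hbs v.2
  -- A member of `b'` outside `b` cannot be a differential: it would lie in the span of `b`, against
  -- the independence of `b'`.
  have h2 : ∀ v : b', v.1 ∉ b → ∃ i : σ, LinearMap.proj i = v.1 := by
    intro v hv
    rcases hb'sub v.2 with h | h
    · exfalso
      have hvspan : v.1 ∈ Submodule.span F (b' \ {v.1}) := by
        have : v.1 ∈ Submodule.span F b := by rw [hbspan]; exact Submodule.subset_span h
        exact Submodule.span_mono (show b ⊆ b' \ {v.1} from
          fun y hy => ⟨hbb' hy, fun h' => hv (h' ▸ hy)⟩) this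
      have := (linearIndepOn_iff_notMem_span).1 hb'li v.1 v.2
      simp only [id_eq, Set.image_id'] at this
      exact this hvspan
    · exact h
  let p : σ → Prop := fun k => (ε k).1 ∈ b
  have h3 : ∀ k, ∃ f ∈ P, p k → diffFunctional x f = (ε k).1 := fun k => by
    by_cases hk : p k
    · obtain ⟨f, hf, h⟩ := h1 ⟨_, hk⟩; exact ⟨f, hf, fun _ => h⟩
    · exact ⟨0, P.zero_mem, fun h => absurd h hk⟩
  have h4 : ∀ k, ∃ i : σ, ¬ p k → (LinearMap.proj i : Module.Dual F (σ → F)) = (ε k).1 :=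
    fun k => by
      by_cases hk : p k
      · exact ⟨k, fun h => absurd hk h⟩
      · obtain ⟨i, hi⟩ := h2 _ hk; exact ⟨i, fun _ => hi⟩
  choose f hf hf' using h3
  choose r hr using h4
  refine ⟨p, f, r, hf, ?_, ?_⟩
  · intro _
    have : (fun k => if p k then diffFunctional x (f k) else
        (LinearMap.proj (r k) : Module.Dual F (σ → F))) = (fun v : b' => v.1) ∘ ε := by
      funext k
      by_cases hk : p k
      · simp [hk, hf']
      · simp [hk, hr]
    rw [this]
    exact (linearIndependent_equiv ε).2 hb'li
  · have hbfin : Finite b := (Set.toFinite b').subset hbb'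
    have : Fintype b := Fintype.ofFinite _
    have e1 : Module.finrank F (Submodule.span F s) = Fintype.card b := by
      rw [← hbspan]
      have := finrank_span_eq_card hbli
      rwa [Subtype.range_coe] at this
    -- The differentials in `b` count the codimension of the tangent space, so the coordinate rows
    -- count its dimension.
    have e2 := Subspace.finrank_add_finrank_dualCoannihilator_eq (Submodule.span F s)
    rw [← tangentAt_eq_dualCoannihilator, e1, Module.finrank_fintype_fun_eq_card] at e2
    have e3 : Nat.card {k // p k} = Fintype.card b := by
      rw [← Nat.card_eq_fintype_card]
      refine Nat.card_congr ⟨fun k => ⟨(ε k.1).1, k.2⟩, fun v => ⟨ε.symm ⟨v.1, hbb' v.2⟩, ?_⟩,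
        ?_, ?_⟩
      · simp [p]
      · intro k; simp
      · intro v; simp
    have e4 : Nat.card {k // p k} + Nat.card {k // ¬ p k} = Fintype.card σ := by
      simp only [Nat.card_eq_fintype_card]
      rw [Fintype.card_subtype_compl]
      have := Fintype.card_subtype_le p
      omega
    omega

theorem sum_aeval_rows [DecidableEq σ] {F : Type*} [Field F] [Algebra K F] (p : σ → Prop)
    [DecidablePred p] (f : σ → MvPolynomial σ K) (r : σ → σ) (x w : σ → F) (k : σ) :
    ∑ i, aeval x (if p k then pderiv i (f k) else if i = r k then 1 else 0) * w i =
      if p k then diffAt (f k) x w else w (r k) := by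
  by_cases hk : p k
  · simp [hk, diffAt]
  · simp [hk, apply_ite (aeval x)]

/-- Stack differentials of equations and coordinate functionals that form a basis at `x` into a
square polynomial matrix. Take its determinant for `Δ`, and for the frame the columns of the
adjugate that belong to the coordinate rows. Cramer's rule expands every tangent vector in these
columns. The columns themselves are tangent because they are tangent at the generic point, by a
dimension count. As the frame is nondegenerate at the given `x`, it can be adapted to any chosen
non-singular point. -/
theorem exists_isFrame [CharZero K] [P.IsPrime] (hd : Algebra.trdeg K (MvPolynomial σ K ⧸ P) = d)
    {F : Type*} [Field F] [Algebra K F] {x : σ → F} (hx : ∀ f ∈ P, aeval x f = 0)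
    (hT : Module.finrank F (tangentAt P x) = d) :
    ∃ (Δ : MvPolynomial σ K) (B : Fin d → σ → MvPolynomial σ K) (e : Fin d → σ),
      IsFrame P Δ B e ∧ aeval x Δ ≠ 0 := by
  classical
  obtain ⟨p, f, r, hf, hli, hcard⟩ := exists_basis_rows (P := P) x
  specialize hli
  rw [hT] at hcard
  let q : Fin d ≃ {k // ¬ p k} := (Fintype.equivFinOfCardEq
    (by rw [← hcard, Nat.card_eq_fintype_card])).symm
  let M : Matrix σ σ (MvPolynomial σ K) := fun k i =>
    if p k then pderiv i (f k) else if i = r k then 1 else 0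
  let Δ := M.det
  let B : Fin d → σ → MvPolynomial σ K := fun j i => M.adjugate i (q j).1
  let e : Fin d → σ := fun j => r (q j).1
  have hΔx : aeval x Δ ≠ 0 := by
    have h1 : aeval x Δ = (M.map (aeval x)).det := by
      change (aeval x : MvPolynomial σ K →ₐ[K] F).toRingHom M.det = _
      rw [RingHom.map_det]; rfl
    rw [h1, ← isUnit_iff_ne_zero, ← Matrix.isUnit_iff_isUnit_det,
      ← Matrix.linearIndependent_rows_iff_isUnit, Fintype.linearIndependent_iff]
    rw [Fintype.linearIndependent_iff] at hli
    intro g hg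
    apply hli g
    apply LinearMap.ext
    intro w
    have : ∀ k, (if p k then diffFunctional x (f k) else
        (LinearMap.proj (r k) : Module.Dual F (σ → F))) w = ∑ i, (M.map (aeval x)) k i * w i := by
      intro k
      refine Eq.trans ?_ (sum_aeval_rows p f r x w k).symm
      by_cases hk : p k
      · simp [hk, diffFunctional_apply]
      · simp [hk]
    simp only [LinearMap.sum_apply, LinearMap.smul_apply, this, smul_eq_mul, Finset.mul_sum]
    rw [Finset.sum_comm]
    simp only [← mul_assoc, ← Finset.sum_mul]
    refine Finset.sum_eq_zero fun i _ => ?_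
    have h2 := congrFun hg i
    simp only [Finset.sum_apply, Pi.smul_apply, smul_eq_mul, Pi.zero_apply] at h2
    change (∑ k, g k * (M.map (aeval x)) k i) * w i = 0
    rw [show (∑ k, g k * (M.map (aeval x)) k i) = 0 from h2, zero_mul]
  have hexp : ∀ (F : Type u) [Field F] [Algebra K F] (x w : σ → F), w ∈ tangentAt P x →
      ∀ i, aeval x Δ * w i = ∑ j, w (e j) * aeval x (B j i) := by
    intro F' _ _ y w hw i
    have h1 : aeval y Δ * w i = ∑ k, aeval y (M.adjugate i k) *
        ∑ i', aeval y (M k i') * w i' := by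
      simp only [Finset.mul_sum]
      rw [Finset.sum_comm]
      simp only [← mul_assoc, ← Finset.sum_mul, ← map_mul, ← map_sum, ← Matrix.mul_apply,
        Matrix.adjugate_mul]
      simp [Matrix.one_apply, Δ, apply_ite (aeval y)]
    rw [h1]
    have h2 : ∀ k, ∑ i', aeval y (M k i') * w i' = if p k then 0 else w (r k) := by
      intro k
      rw [sum_aeval_rows p f r y w k]
      by_cases hk : p k
      · simp [hk, hw _ (hf k)]
      · simp [hk]
    simp only [h2, mul_ite, mul_zero]
    simp only [← ite_not (p := p _)]
    rw [← Finset.sum_filter, Finset.sum_subtype (p := fun k => ¬ p k) _ (by simp),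
      ← q.sum_comp]
    exact Finset.sum_congr rfl fun j _ => mul_comm _ _
  have hnorm : ∀ j j', B j (e j') = if j = j' then Δ else 0 := by
    intro j j'
    have h1 := congrFun (congrFun (Matrix.mul_adjugate M) (q j').1) (q j).1
    rw [Matrix.mul_apply] at h1
    have h2 : ∀ i, M (q j').1 i = if i = e j' then 1 else 0 := fun i => by
      simp [M, (q j').2, e]
    simp only [h2, ite_mul, one_mul, zero_mul, Finset.sum_ite_eq', Finset.mem_univ, if_true] at h1
    change M.adjugate (e j') (q j).1 = _
    rw [h1]
    by_cases hjj : j = j'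
    · simp [hjj, Δ]
    · have : (q j').1 ≠ (q j).1 := fun h => hjj (q.injective (Subtype.ext h)).symm
      simp [hjj, this]
  -- Only tangency remains. At the generic point the span of the `d` columns contains the
  -- `d`-dimensional tangent space, hence equals it, and vanishing at the generic point is
  -- membership in `P`.
  refine ⟨Δ, B, e, ⟨?_, hnorm, hexp⟩, hΔx⟩
  have hΔP : Δ ∉ P := fun h => hΔx (hx _ h)
  have hΔξ : aeval (genericPoint P) Δ ≠ 0 := fun h => hΔP (aeval_genericPoint_eq_zero.1 h)
  have hle : tangentAt P (genericPoint P) ≤ Submodule.span _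
      (Set.range fun j => evalVec (B j) (genericPoint P)) := by
    intro w hw
    have : w = ∑ j, ((aeval (genericPoint P) Δ)⁻¹ * w (e j)) •
        evalVec (B j) (genericPoint P) := by
      funext i
      have h1 := hexp _ (genericPoint P) w hw i
      simp only [Finset.sum_apply, Pi.smul_apply, smul_eq_mul, evalVec, mul_assoc]
      rw [← Finset.mul_sum, ← h1, inv_mul_cancel_left₀ hΔξ]
    rw [this]
    exact Submodule.sum_mem _ fun j _ => Submodule.smul_mem _ _ (Submodule.subset_span ⟨j, rfl⟩)
  have heq := Submodule.eq_of_le_of_finrank_le hle (by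
    rw [finrank_tangentAt_genericPoint P hd]
    exact (finrank_range_le_card _).trans (by simp))
  intro f hf j
  have h1 : evalVec (B j) (genericPoint P) ∈ tangentAt P (genericPoint P) := by
    rw [heq]; exact Submodule.subset_span ⟨j, rfl⟩
  have h2 := h1 f hf
  rw [← aeval_genericPoint_eq_zero]
  simpa [diffAt, evalVec, map_sum] using h2

theorem exists_isFrame_generic [CharZero K] [P.IsPrime]
    (hd : Algebra.trdeg K (MvPolynomial σ K ⧸ P) = d) :
    ∃ (Δ : MvPolynomial σ K) (B : Fin d → σ → MvPolynomial σ K) (e : Fin d → σ),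
      IsFrame P Δ B e ∧ Δ ∉ P := by
  obtain ⟨Δ, B, e, h, hΔ⟩ := exists_isFrame hd (x := genericPoint P)
    (fun f hf => aeval_genericPoint_eq_zero.2 hf) (finrank_tangentAt_genericPoint P hd)
  exact ⟨Δ, B, e, h, fun hm => hΔ (aeval_genericPoint_eq_zero.2 hm)⟩

end Frames

end ProjSurf

namespace ProjSurf

open MvPolynomial

/-! ### The parametrized union of the tangent spaces and its generic smoothness -/

section Rulings

universe u

set_option linter.unusedSectionVars false

variable {K : Type u} [Field K] {σ : Type} [Fintype σ] {τ : Type} [Fintype τ]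

theorem map_diffAt {F F' : Type*} [CommRing F] [Algebra K F] [CommRing F'] [Algebra K F']
    (φ : F →ₐ[K] F') (f : MvPolynomial σ K) (x w : σ → F) :
    φ (diffAt f x w) = diffAt f (fun i => φ (x i)) (fun i => φ (w i)) := by
  simp only [diffAt, map_sum, map_mul]
  refine Finset.sum_congr rfl fun i _ => ?_
  congr 1
  rw [← AlgHom.comp_apply, comp_aeval]

theorem map_aeval' {F F' : Type*} [CommRing F] [Algebra K F] [CommRing F'] [Algebra K F']
    (φ : F →ₐ[K] F') (f : MvPolynomial σ K) (x : σ → F) :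
    φ (aeval x f) = aeval (fun i => φ (x i)) f := by
  rw [← AlgHom.comp_apply, comp_aeval]

/-- Evaluation of a polynomial in the parameters `t` with coefficients polynomial in `x`. -/
noncomputable def evalPair (x : σ → K) (t : τ → K) :
    MvPolynomial τ (MvPolynomial σ K) →ₐ[K] K :=
  (aeval t).comp (mapAlgHom (aeval x))

@[simp] theorem evalPair_C (x : σ → K) (t : τ → K) (f : MvPolynomial σ K) :
    evalPair x t (C f) = aeval x f := by
  simp [evalPair]

@[simp] theorem evalPair_X (x : σ → K) (t : τ → K) (i : τ) :
    evalPair x t (X i) = t i := by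
  simp [evalPair]

/-- The field of rational functions in the parameters `t` over the function field of a cone. -/
abbrev PairField (τ : Type) (I : Ideal (MvPolynomial σ K)) : Type _ :=
  FractionRing (MvPolynomial τ (MvPolynomial σ K ⧸ I))

/-- Evaluation at the generic point of the product of a cone and the parameter space. -/
noncomputable def genPair (I : Ideal (MvPolynomial σ K)) :
    MvPolynomial τ (MvPolynomial σ K) →ₐ[K] PairField τ I :=
  (IsScalarTower.toAlgHom K (MvPolynomial τ (MvPolynomial σ K ⧸ I)) (PairField τ I)).comp
    (mapAlgHom (Ideal.Quotient.mkₐ K I))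

theorem genPair_apply (I : Ideal (MvPolynomial σ K)) (g : MvPolynomial τ (MvPolynomial σ K)) :
    genPair I g = algebraMap _ (PairField τ I) (map (Ideal.Quotient.mk I) g) := rfl

theorem genPair_eq_zero_iff_map (I : Ideal (MvPolynomial σ K)) [I.IsPrime]
    {g : MvPolynomial τ (MvPolynomial σ K)} :
    genPair I g = 0 ↔ map (Ideal.Quotient.mk I) g = 0 := by
  rw [genPair_apply]
  exact (injective_iff_map_eq_zero' _).1 (IsFractionRing.injective
    (MvPolynomial τ (MvPolynomial σ K ⧸ I)) (PairField τ I)) _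

/-- Clears denominators and lifts to polynomials, so that relations over the function field become
polynomial identities that can be evaluated at `K`-points. -/
theorem exists_common_denominator (I : Ideal (MvPolynomial σ K)) [I.IsPrime] {ι : Type*} [Finite ι]
    (c : ι → PairField τ I) :
    ∃ (h : MvPolynomial τ (MvPolynomial σ K)) (g : ι → MvPolynomial τ (MvPolynomial σ K)),
      genPair I h ≠ 0 ∧ ∀ i, genPair I (g i) = genPair I h * c i := by
  obtain ⟨b, hb⟩ := IsLocalization.exist_integer_multiples_of_finite
    (nonZeroDivisors (MvPolynomial τ (MvPolynomial σ K ⧸ I))) c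
  have hsurj : Function.Surjective
      (map (Ideal.Quotient.mk I) : MvPolynomial τ (MvPolynomial σ K) →+* _) :=
    map_surjective _ Ideal.Quotient.mk_surjective
  obtain ⟨h, hh⟩ := hsurj b.1
  choose g' hg' using hb
  choose g hg using fun i => hsurj (g' i)
  refine ⟨h, g, ?_, fun i => ?_⟩
  · rw [Ne, genPair_eq_zero_iff_map, hh]
    exact nonZeroDivisors.ne_zero b.2
  · rw [genPair_apply, genPair_apply, hg, hg', hh, Algebra.smul_def]

/-- The bridge between generic and closed points. Over an infinite field a polynomial in the
parameters that vanishes everywhere is zero, so vanishing can be tested coefficient by coefficient.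
-/
theorem genPair_eq_zero [Infinite K] {S : Set (σ → K)} [(vanishingIdeal K S).IsPrime]
    {g : MvPolynomial τ (MvPolynomial σ K)} :
    genPair (vanishingIdeal K S) g = 0 ↔ ∀ x ∈ S, ∀ t, evalPair x t g = 0 := by
  rw [genPair_eq_zero_iff_map]
  have h1 : map (Ideal.Quotient.mk (vanishingIdeal K S)) g = 0 ↔
      ∀ m, ∀ x ∈ S, aeval x (coeff m g) = 0 := by
    rw [MvPolynomial.ext_iff]
    simp only [coeff_map, coeff_zero, Ideal.Quotient.eq_zero_iff_mem, mem_vanishingIdeal_iff]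
  have h2 : ∀ x, (∀ t, evalPair x t g = 0) ↔ ∀ m, aeval x (coeff m g) = 0 := by
    intro x
    have h3 : (∀ t, evalPair x t g = 0) ↔ map (aeval x : MvPolynomial σ K →ₐ[K] K).toRingHom g = 0 := by
      constructor
      · intro h
        apply MvPolynomial.funext
        intro t
        rw [map_zero]
        exact h t
      · intro h t
        change aeval t (map (aeval x : MvPolynomial σ K →ₐ[K] K).toRingHom g) = 0
        rw [h, map_zero]
    rw [h3, MvPolynomial.ext_iff]
    simp only [coeff_map, coeff_zero]
    rfl
  rw [h1]
  simp only [h2]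
  exact ⟨fun h x hx m => h m x hx, fun h m x hx => h x hx m⟩

/-- The coordinates of the generic point. -/
noncomputable def pairPoint (τ : Type) (I : Ideal (MvPolynomial σ K)) : σ → PairField τ I :=
  fun i => genPair I (C (X i))

theorem genPair_C (I : Ideal (MvPolynomial σ K)) (f : MvPolynomial σ K) :
    genPair (τ := τ) I (C f) = aeval (pairPoint τ I) f := by
  have h : (genPair (τ := τ) I).comp (IsScalarTower.toAlgHom K (MvPolynomial σ K) _) =
      aeval (pairPoint τ I) := by
    ext i; simp [pairPoint]
  rw [← h]; rfl

theorem aeval_pairPoint_eq_zero (I : Ideal (MvPolynomial σ K)) [I.IsPrime]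
    {f : MvPolynomial σ K} : aeval (pairPoint τ I) f = 0 ↔ f ∈ I := by
  rw [← genPair_C, genPair_eq_zero_iff_map, map_C,
    map_eq_zero_iff _ (C_injective _ _), Ideal.Quotient.eq_zero_iff_mem]

variable {d : ℕ}

/-- The point of the tangent space with the parameters `t` with respect to a frame. -/
noncomputable def rulingPoint {F : Type*} [CommRing F] [Algebra K F]
    (B : Fin d → σ → MvPolynomial σ K) (x : σ → F) (t : Fin d → F) : σ → F :=
  ∑ i, t i • evalVec (B i) x

/-- The derivative of a polynomial vector field `b'` along `b`. -/
noncomputable def dirDeriv (b b' : σ → MvPolynomial σ K) : σ → MvPolynomial σ K :=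
  fun k => ∑ l, pderiv l (b' k) * b l

/-- The span of the derivatives of the parametrization `(x, t) ↦ rulingPoint B x t`. -/
noncomputable def rulingTangent {F : Type*} [CommRing F] [Algebra K F]
    (B : Fin d → σ → MvPolynomial σ K) (x : σ → F) (t : Fin d → F) : Submodule F (σ → F) :=
  Submodule.span F (Set.range (Sum.elim (fun i => evalVec (B i) x)
    (fun j => rulingPoint (fun i => dirDeriv (B j) (B i)) x t)))

/-- The union of the tangent spaces spanned by a frame. -/
def rulingSet (S : Set (σ → K)) (B : Fin d → σ → MvPolynomial σ K) : Set (σ → K) :=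
  {v | ∃ x ∈ S, ∃ t, rulingPoint B x t = v}

/-- The parametrization `(x, t) ↦ rulingPoint B x t` as a vector of polynomials. -/
noncomputable def rulingVec (B : Fin d → σ → MvPolynomial σ K) :
    σ → MvPolynomial (Fin d) (MvPolynomial σ K) :=
  fun k => ∑ i, X i * C (B i k)

theorem evalPair_rulingVec (B : Fin d → σ → MvPolynomial σ K) (x : σ → K) (t : Fin d → K) :
    (fun k => evalPair x t (rulingVec B k)) = rulingPoint B x t := by
  funext k
  simp [rulingVec, rulingPoint, evalVec]

/-- The generic values of the parameters. -/
noncomputable def pairParam {τ : Type} (I : Ideal (MvPolynomial σ K)) : τ → PairField τ I :=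
  fun i => genPair I (X i)

theorem genPair_rulingVec (I : Ideal (MvPolynomial σ K)) (B : Fin d → σ → MvPolynomial σ K) :
    (fun k => genPair I (rulingVec B k)) =
      rulingPoint B (pairPoint (Fin d) I) (pairParam I) := by
  funext k
  simp [rulingVec, rulingPoint, evalVec, genPair_C, pairParam]

/-- The image of the generic point of the source is a generic point of the image. The ideal of the
union is thus the kernel of a homomorphism into a field, hence prime. -/
theorem mem_vanishingIdeal_rulingSet [Infinite K] {S : Set (σ → K)}
    [(vanishingIdeal K S).IsPrime] {B : Fin d → σ → MvPolynomial σ K} {f : MvPolynomial σ K} :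
    f ∈ vanishingIdeal K (rulingSet S B) ↔
      aeval (rulingPoint B (pairPoint (Fin d) (vanishingIdeal K S)) (pairParam _)) f = 0 := by
  rw [← genPair_rulingVec, ← map_aeval', genPair_eq_zero, mem_vanishingIdeal_iff]
  simp only [map_aeval', evalPair_rulingVec]
  constructor
  · intro h x hx t; exact h _ ⟨x, hx, t, rfl⟩
  · rintro h _ ⟨x, hx, t, rfl⟩; exact h x hx t

theorem isPrime_vanishingIdeal_rulingSet [Infinite K] (S : Set (σ → K))
    [(vanishingIdeal K S).IsPrime] (B : Fin d → σ → MvPolynomial σ K) :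
    (vanishingIdeal K (rulingSet S B)).IsPrime := by
  have : vanishingIdeal K (rulingSet S B) = RingHom.ker (aeval (rulingPoint B
      (pairPoint (Fin d) (vanishingIdeal K S)) (pairParam _)) : MvPolynomial σ K →ₐ[K] _) := by
    ext f
    rw [mem_vanishingIdeal_rulingSet, RingHom.mem_ker]
  rw [this]
  exact RingHom.ker_isPrime _

theorem mkDerivation_eq_sum (b : σ → MvPolynomial σ K) (f : MvPolynomial σ K) :
    mkDerivation K b f = ∑ l, pderiv l f * b l := by
  have h := derivation_aeval (mkDerivation K b) X f
  simpa [diffAt, aeval_X_left] using h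

/-- Differentiate f(∑ tᵢ Bᵢ(x)) = 0 in the parameters with x fixed, and along the fields Bⱼ with t
fixed. The latter is legitimate because the Bⱼ are tangent to `S`. -/
theorem rulingTangent_le_tangentAt [Infinite K] {S : Set (σ → K)} {Δ : MvPolynomial σ K}
    {B : Fin d → σ → MvPolynomial σ K} {e : Fin d → σ}
    (hB : IsFrame (vanishingIdeal K S) Δ B e) {x : σ → K} (hx : x ∈ S) (t : Fin d → K) :
    rulingTangent B x t ≤ tangentAt (vanishingIdeal K (rulingSet S B)) (rulingPoint B x t) := by
  rw [rulingTangent, Submodule.span_le]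
  rintro _ ⟨i | j, rfl⟩ f hf
  · let y : σ → MvPolynomial (Fin d) K := fun k => ∑ i, X i * C (aeval x (B i k))
    have hy : ∀ t, (fun k => aeval t (y k)) = rulingPoint B x t := fun t => by
      funext k; simp [y, rulingPoint, evalVec]
    have h0 : aeval y f = 0 := by
      apply MvPolynomial.funext
      intro t
      change aeval t (aeval y f) = aeval t 0
      rw [map_aeval', hy, map_zero]
      exact hf _ ⟨x, hx, t, rfl⟩
    have h1 := derivation_aeval (pderiv i) y f
    rw [h0, map_zero] at h1
    have h2 := congrArg (aeval t) h1
    rw [map_diffAt, hy, map_zero] at h2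
    rw [h2]
    congr 1
    funext k
    simp [y, evalVec, pderiv_X, Pi.single_apply]
  · let y : σ → MvPolynomial σ K := fun k => ∑ i, C (t i) * B i k
    have hy : ∀ x, (fun k => aeval x (y k)) = rulingPoint B x t := fun x => by
      funext k; simp [y, rulingPoint, evalVec]
    have h0 : aeval y f ∈ vanishingIdeal K S := by
      intro x' hx'
      rw [map_aeval', hy]
      exact hf _ ⟨x', hx', t, rfl⟩
    have h1 := derivation_aeval (mkDerivation K (B j)) y f
    have h2 := hB.tangent _ h0 j
    rw [← mkDerivation_eq_sum, h1] at h2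
    have h3 := h2 x hx
    rw [map_diffAt, hy] at h3
    rw [← h3]
    congr 1
    funext k
    simp [y, rulingPoint, evalVec, dirDeriv, mkDerivation_eq_sum]

/-- In characteristic 0 a tangent vector at the image of the generic point is induced by a
derivation `D` of the function field of the source. The vector D(ξ) is tangent to `S`, so it is a
combination of the frame. The product rule applied to ∑ sᵢ Bᵢ(ξ) then expresses `w` by the
derivatives of the parametrization. -/
theorem tangentAt_generic_le_rulingTangent [CharZero K] {S : Set (σ → K)}
    [(vanishingIdeal K S).IsPrime] {Δ : MvPolynomial σ K}
    {B : Fin d → σ → MvPolynomial σ K} {e : Fin d → σ}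
    (hB : IsFrame (vanishingIdeal K S) Δ B e) (hΔ : Δ ∉ vanishingIdeal K S) :
    tangentAt (vanishingIdeal K (rulingSet S B))
        (rulingPoint B (pairPoint (Fin d) (vanishingIdeal K S)) (pairParam _)) ≤
      rulingTangent B (pairPoint (Fin d) (vanishingIdeal K S)) (pairParam _) := by
  intro w hw
  set ξ := pairPoint (Fin d) (vanishingIdeal K S)
  set s : Fin d → PairField (Fin d) (vanishingIdeal K S) := pairParam _
  obtain ⟨D, hD⟩ := exists_derivation (K := K) (rulingPoint B ξ s) w
    (fun f hf => hw f (mem_vanishingIdeal_rulingSet.2 hf))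
  have hDξ : (fun i => D (ξ i)) ∈ tangentAt (vanishingIdeal K S) ξ := by
    intro f hf
    rw [← derivation_aeval, (aeval_pairPoint_eq_zero _).2 hf, map_zero]
  have h1 := hB.mem_span (fun h => hΔ ((aeval_pairPoint_eq_zero _).1 h)) hDξ
  set c : Fin d → PairField (Fin d) (vanishingIdeal K S) :=
    fun j => (aeval ξ Δ)⁻¹ * D (ξ (e j))
  have h2 : w = ∑ i, D (s i) • evalVec (B i) ξ +
      ∑ j, c j • rulingPoint (fun i => dirDeriv (B j) (B i)) ξ s := by
    funext k
    rw [← hD]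
    simp only [rulingPoint, Finset.sum_apply, Pi.smul_apply, smul_eq_mul, map_sum, evalVec,
      Derivation.leibniz, Pi.add_apply, derivation_aeval, Finset.sum_add_distrib]
    rw [add_comm]
    congr 1
    · exact Finset.sum_congr rfl fun i _ => mul_comm _ _
    · have h3 : ∀ i, diffAt (B i k) ξ (fun i => D (ξ i)) =
          ∑ j, c j * aeval ξ (dirDeriv (B j) (B i) k) := by
        intro i
        rw [h1]
        simp only [diffAt, dirDeriv, Finset.sum_apply, Pi.smul_apply, smul_eq_mul, map_sum,
          map_mul, Finset.mul_sum, evalVec]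
        rw [Finset.sum_comm]
        exact Finset.sum_congr rfl fun j _ => Finset.sum_congr rfl fun l _ => by ring
      simp only [h3, Finset.mul_sum]
      rw [Finset.sum_comm]
      exact Finset.sum_congr rfl fun j _ => Finset.sum_congr rfl fun i _ => by ring
  rw [h2]
  refine Submodule.add_mem _ (Submodule.sum_mem _ fun i _ => Submodule.smul_mem _ _
    (Submodule.subset_span ⟨Sum.inl i, rfl⟩)) (Submodule.sum_mem _ fun j _ =>
    Submodule.smul_mem _ _ (Submodule.subset_span ⟨Sum.inr j, rfl⟩))

/-- Generic smoothness of the parametrization of the union of the tangent spaces. -/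
theorem exists_tangentAt_eq_rulingTangent [CharZero K] {S : Set (σ → K)}
    [(vanishingIdeal K S).IsPrime] {Δ : MvPolynomial σ K}
    {B : Fin d → σ → MvPolynomial σ K} {e : Fin d → σ}
    (hB : IsFrame (vanishingIdeal K S) Δ B e) (hΔ : Δ ∉ vanishingIdeal K S) {d' : ℕ}
    (hd' : Algebra.trdeg K (MvPolynomial σ K ⧸ vanishingIdeal K (rulingSet S B)) = d') :
    ∃ h : MvPolynomial (Fin d) (MvPolynomial σ K), genPair (vanishingIdeal K S) h ≠ 0 ∧
      ∀ x ∈ S, ∀ t, evalPair x t h ≠ 0 →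
        tangentAt (vanishingIdeal K (rulingSet S B)) (rulingPoint B x t) = rulingTangent B x t ∧
        Module.finrank K (rulingTangent B x t) = d' := by
  have := isPrime_vanishingIdeal_rulingSet S B
  obtain ⟨Δ', B', e', hB', hΔ'⟩ := exists_isFrame_generic hd'
  set I := vanishingIdeal K S
  set ξ := pairPoint (Fin d) I
  set s : Fin d → PairField (Fin d) I := pairParam _
  let G : Fin d ⊕ Fin d → σ → MvPolynomial (Fin d) (MvPolynomial σ K) :=
    Sum.elim (fun i k => C (B i k)) (fun j => rulingVec fun i => dirDeriv (B j) (B i))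
  have hGgen : (fun a k => genPair I (G a k)) = Sum.elim (fun i => evalVec (B i) ξ)
      (fun j => rulingPoint (fun i => dirDeriv (B j) (B i)) ξ s) := by
    funext a
    rcases a with i | j
    · funext k; exact genPair_C _ _
    · exact genPair_rulingVec _ _
  have hGev : ∀ x t, (fun a k => evalPair x t (G a k)) = Sum.elim (fun i => evalVec (B i) x)
      (fun j => rulingPoint (fun i => dirDeriv (B j) (B i)) x t) := by
    intro x t
    funext a
    rcases a with i | j
    · funext k; exact evalPair_C _ _ _
    · exact evalPair_rulingVec _ _ _
  -- A frame of the image is generically a combination of the derivatives of the parametrization;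
  -- the denominators of the coefficients form part of the locus to be avoided.
  have hmem : ∀ j, ∃ c : Fin d ⊕ Fin d → PairField (Fin d) I,
      ∑ a, c a • (fun k => genPair I (G a k)) = evalVec (B' j) (rulingPoint B ξ s) := by
    intro j
    have hη : ∀ f ∈ vanishingIdeal K (rulingSet S B), aeval (rulingPoint B ξ s) f = 0 :=
      fun f hf => mem_vanishingIdeal_rulingSet.1 hf
    have h0 : evalVec (B' j) (rulingPoint B ξ s) ∈
        tangentAt (vanishingIdeal K (rulingSet S B)) (rulingPoint B ξ s) := hB'.evalVec_mem hη j
    have h1 : evalVec (B' j) (rulingPoint B ξ s) ∈ rulingTangent B ξ s :=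
      tangentAt_generic_le_rulingTangent hB hΔ h0
    rw [rulingTangent, ← hGgen, Submodule.mem_span_range_iff_exists_fun] at h1
    exact h1
  choose c hc using hmem
  obtain ⟨h0, g, hh0', hg⟩ := exists_common_denominator I
    (fun q : Fin d' × (Fin d ⊕ Fin d) => c q.1 q.2)
  have hrel : ∀ x ∈ S, ∀ t, ∀ j, evalPair x t h0 • evalVec (B' j) (rulingPoint B x t) =
      ∑ a, evalPair x t (g (j, a)) • (fun k => evalPair x t (G a k)) := by
    intro x hx t j
    funext k
    have h1 : genPair I (h0 * aeval (rulingVec B) (B' j k) - ∑ a, g (j, a) * G a k) = 0 := by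
      have h2 := congrFun (hc j) k
      simp only [Finset.sum_apply, Pi.smul_apply, smul_eq_mul, evalVec] at h2
      rw [map_sub, map_mul, map_aeval', genPair_rulingVec, ← h2, map_sum, Finset.mul_sum,
        sub_eq_zero]
      exact Finset.sum_congr rfl fun a _ => by rw [map_mul, hg, mul_assoc]
    have h3 := genPair_eq_zero.1 h1 x hx t
    rw [map_sub, map_mul, map_aeval', evalPair_rulingVec, sub_eq_zero] at h3
    simp only [Finset.sum_apply, Pi.smul_apply, smul_eq_mul, evalVec]
    rw [h3, map_sum]
    exact Finset.sum_congr rfl fun a _ => map_mul _ _ _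
  -- Off this product the coefficients specialize and the frame `B'` of the image still spans its
  -- tangent space.
  refine ⟨h0 * aeval (rulingVec B) Δ', ?_, ?_⟩
  · rw [map_mul, map_aeval', genPair_rulingVec]
    exact mul_ne_zero hh0' fun h => hΔ' (mem_vanishingIdeal_rulingSet.2 h)
  · intro x hx t hne
    rw [map_mul, map_aeval', evalPair_rulingVec] at hne
    have hne1 := left_ne_zero_of_mul hne
    have hne2 := right_ne_zero_of_mul hne
    have hz : ∀ f ∈ vanishingIdeal K (rulingSet S B), aeval (rulingPoint B x t) f = 0 :=
      fun f hf => hf _ ⟨x, hx, t, rfl⟩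
    have heq : tangentAt (vanishingIdeal K (rulingSet S B)) (rulingPoint B x t) =
        rulingTangent B x t := by
      refine le_antisymm ?_ (rulingTangent_le_tangentAt hB hx t)
      rw [hB'.tangentAt_eq hz hne2, Submodule.span_le]
      rintro _ ⟨j, rfl⟩
      have h1 := hrel x hx t j
      have h2 : evalVec (B' j) (rulingPoint B x t) = (evalPair x t h0)⁻¹ •
          ∑ a, evalPair x t (g (j, a)) • (fun k => evalPair x t (G a k)) := by
        rw [← h1, inv_smul_smul₀ hne1]
      change evalVec (B' j) (rulingPoint B x t) ∈ rulingTangent B x t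
      rw [h2]
      refine Submodule.smul_mem _ _ (Submodule.sum_mem _ fun a _ => Submodule.smul_mem _ _ ?_)
      rw [rulingTangent, ← hGev]
      exact Submodule.subset_span ⟨a, rfl⟩
    exact ⟨heq, heq ▸ hB'.finrank_tangentAt hz hne2⟩

end Rulings

end ProjSurf

namespace ProjSurf

/-! ### Binary quadratic forms and pairs annihilated by a symmetric bilinear map -/

section ConjugatePairs

variable {K : Type*} [Field K]

/-- The coefficients of the product of two binary linear forms. -/
def formMul (u v : Fin 2 → K) : Fin 3 → K :=
  ![u 0 * v 0, u 0 * v 1 + u 1 * v 0, u 1 * v 1]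

theorem formMul_comm (u v : Fin 2 → K) : formMul u v = formMul v u := by
  funext i; fin_cases i <;> simp [formMul] <;> ring

theorem formMul_smul_left (c : K) (u v : Fin 2 → K) : formMul (c • u) v = c • formMul u v := by
  funext i; fin_cases i <;> simp [formMul] <;> ring

theorem formMul_smul_right (c : K) (u v : Fin 2 → K) : formMul u (c • v) = c • formMul u v := by
  rw [formMul_comm, formMul_smul_left, formMul_comm]

theorem formMul_sub_right (u v w : Fin 2 → K) :
    formMul u (v - w) = formMul u v - formMul u w := by
  funext i; fin_cases i <;> simp [formMul] <;> ring

theorem fin_two_ne_zero {u : Fin 2 → K} (h : u ≠ 0) : u 0 ≠ 0 ∨ u 1 ≠ 0 := by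
  by_contra! h'
  exact h (by funext i; fin_cases i <;> simp [h'])

theorem formMul_ne_zero {u v : Fin 2 → K} (hu : u ≠ 0) (hv : v ≠ 0) : formMul u v ≠ 0 := by
  intro h
  have h0 : u 0 * v 0 = 0 := congrFun h 0
  have h1 : u 0 * v 1 + u 1 * v 0 = 0 := congrFun h 1
  have h2 : u 1 * v 1 = 0 := congrFun h 2
  rcases fin_two_ne_zero hu with hu' | hu'
  · have hv0 : v 0 = 0 := by simpa [hu'] using h0
    have hv1 : v 1 = 0 := by simpa [hu', hv0] using h1
    rcases fin_two_ne_zero hv with h | h <;> contradiction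
  · have hv1 : v 1 = 0 := by simpa [hu'] using h2
    have hv0 : v 0 = 0 := by simpa [hu', hv1] using h1
    rcases fin_two_ne_zero hv with h | h <;> contradiction

theorem formMul_surjective [IsAlgClosed K] (k : Fin 3 → K) : ∃ u v, formMul u v = k := by
  by_cases hr : k 2 = 0
  · refine ⟨![1, 0], ![k 0, k 1], ?_⟩
    funext i; fin_cases i <;> simp [formMul, hr]
  · obtain ⟨z, hz⟩ := IsAlgClosed.exists_root
      (Polynomial.C (k 2) * Polynomial.X ^ 2 + Polynomial.C (k 1) * Polynomial.X +
        Polynomial.C (k 0)) (by rw [Polynomial.degree_quadratic hr]; decide)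
    have hz' : k 2 * z ^ 2 + k 1 * z + k 0 = 0 := by simpa using hz
    -- This is k₀ + k₁Z + k₂Z² = (Z − z)(k₂Z + k₁ + k₂z).
    refine ⟨![-z, 1], ![k 1 + k 2 * z, k 2], ?_⟩
    funext i
    fin_cases i
    · simp [formMul]; linear_combination -hz'
    · simp [formMul]; ring
    · simp [formMul]

theorem exists_smul_of_det_eq_zero {u u' : Fin 2 → K} (hu : u ≠ 0) (hu' : u' ≠ 0)
    (h : u 0 * u' 1 - u 1 * u' 0 = 0) : ∃ c : K, c ≠ 0 ∧ u = c • u' := by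
  have key : ∃ c : K, u = c • u' := by
    rcases fin_two_ne_zero hu' with h' | h'
    · refine ⟨u 0 / u' 0, ?_⟩
      funext i
      fin_cases i
      · simp [h']
      · simp; field_simp; linear_combination -h
    · refine ⟨u 1 / u' 1, ?_⟩
      funext i
      fin_cases i
      · simp; field_simp; linear_combination h
      · simp [h']
  obtain ⟨c, hc⟩ := key
  refine ⟨c, ?_, hc⟩
  rintro rfl
  exact hu (by simpa using hc)

/-- A common linear factor may be cancelled, because a product of nonzero forms is nonzero. -/
theorem eq_of_formMul_eq_aux {u v u' v' : Fin 2 → K} {c a : K}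
    (hu' : u' ≠ 0) (hc : c ≠ 0) (ha : a ≠ 0) (hu : u = a • u')
    (h : formMul u v = c • formMul u' v') : ∃ b : K, b ≠ 0 ∧ v = b • v' := by
  have h1 : formMul u' (a • v - c • v') = 0 := by
    rw [formMul_sub_right, formMul_smul_right, formMul_smul_right, ← h, hu, formMul_smul_left,
      sub_self]
  have h2 : a • v - c • v' = 0 := by
    by_contra hne
    exact formMul_ne_zero hu' hne h1
  refine ⟨a⁻¹ * c, mul_ne_zero (inv_ne_zero ha) hc, ?_⟩
  rw [mul_smul, ← sub_eq_zero.1 h2, inv_smul_smul₀ ha]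

/-- Unique factorization of binary quadratic forms. -/
theorem eq_of_formMul_eq {u v u' v' : Fin 2 → K} {c : K} (hu : u ≠ 0) (hv : v ≠ 0)
    (hu' : u' ≠ 0) (hc : c ≠ 0) (h : formMul u v = c • formMul u' v') :
    (∃ a b : K, a ≠ 0 ∧ b ≠ 0 ∧ u = a • u' ∧ v = b • v') ∨
      (∃ a b : K, a ≠ 0 ∧ b ≠ 0 ∧ u = a • v' ∧ v = b • u') := by
  have h0 : u 0 * v 0 = c * (u' 0 * v' 0) := congrFun h 0
  have h1 : u 0 * v 1 + u 1 * v 0 = c * (u' 0 * v' 1 + u' 1 * v' 0) := congrFun h 1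
  have h2 : u 1 * v 1 = c * (u' 1 * v' 1) := congrFun h 2
  -- Both products are evaluated at the zero (u'₁, −u'₀) of u'.
  have h3 : (u 0 * u' 1 - u 1 * u' 0) * (v 0 * u' 1 - v 1 * u' 0) = 0 := by
    linear_combination (u' 1) ^ 2 * h0 - u' 0 * u' 1 * h1 + (u' 0) ^ 2 * h2
  rcases mul_eq_zero.1 h3 with h4 | h4
  · obtain ⟨a, ha, hau⟩ := exists_smul_of_det_eq_zero hu hu' h4
    obtain ⟨b, hb, hbv⟩ := eq_of_formMul_eq_aux hu' hc ha hau h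
    exact Or.inl ⟨a, b, ha, hb, hau, hbv⟩
  · obtain ⟨b, hb, hbv⟩ := exists_smul_of_det_eq_zero hv hu' h4
    obtain ⟨a, ha, hau⟩ := eq_of_formMul_eq_aux hu' hc hb hbv (by rw [formMul_comm]; exact h)
    exact Or.inr ⟨a, b, ha, hb, hau, hbv⟩

variable {U Q : Type*} [AddCommGroup U] [Module K U] [AddCommGroup Q] [Module K Q]

theorem exists_mk_rep_eq_smul {u : U} (hu : u ≠ 0) :
    ∃ a : K, a ≠ 0 ∧ (Projectivization.mk K u hu).rep = a • u := by
  obtain ⟨a, ha⟩ := Projectivization.exists_smul_eq_mk_rep K u hu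
  exact ⟨a, a.ne_zero, ha.symm⟩

/-- The pairs of directions annihilated by a symmetric bilinear map on a plane: there is exactly
one if and only if the values of the map span a plane. -/
theorem existsUnique_pair_iff [IsAlgClosed K] (hU : Module.finrank K U = 2)
    (β : U →ₗ[K] U →ₗ[K] Q) (hβ : ∀ u v, β u v = β v u) :
    (∃! s : Sym2 (Projectivization K U), ∀ d e, s = s(d, e) → β d.rep e.rep = 0) ↔
      Module.finrank K (Submodule.span K (Set.range fun p : U × U => β p.1 p.2)) = 2 := by
  have : Module.Finite K U := Module.finite_of_finrank_pos (by omega)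
  let bas : Module.Basis (Fin 2) K U := Module.finBasisOfFinrankEq K U hU
  let co : U ≃ₗ[K] (Fin 2 → K) := bas.equivFun
  let abc : Fin 3 → Q := ![β (bas 0) (bas 0), β (bas 0) (bas 1), β (bas 1) (bas 1)]
  -- `β` depends only on the product of its two arguments read as linear forms, so it is given by a
  -- linear map on a 3-dimensional space.
  let ψ : (Fin 3 → K) →ₗ[K] Q := Fintype.linearCombination K abc
  have hψ : ∀ u v, β u v = ψ (formMul (co u) (co v)) := by
    intro u v
    have hu : u = co u 0 • bas 0 + co u 1 • bas 1 := by
      rw [← Fin.sum_univ_two (fun i => co u i • bas i)]; exact (bas.sum_equivFun u).symm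
    have hv : v = co v 0 • bas 0 + co v 1 • bas 1 := by
      rw [← Fin.sum_univ_two (fun i => co v i • bas i)]; exact (bas.sum_equivFun v).symm
    conv_lhs => rw [hu, hv]
    simp only [map_add, map_smul, LinearMap.add_apply, LinearMap.smul_apply, ψ, formMul, abc,
      Fintype.linearCombination_apply, Fin.sum_univ_three, hβ (bas 1) (bas 0)]
    simp
    module
  have hrange : Submodule.span K (Set.range fun p : U × U => β p.1 p.2) = LinearMap.range ψ := by
    apply le_antisymm
    · rw [Submodule.span_le]
      rintro _ ⟨p, rfl⟩
      exact ⟨_, (hψ p.1 p.2).symm⟩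
    · rintro _ ⟨k, rfl⟩
      obtain ⟨u, v, rfl⟩ := formMul_surjective k
      refine Submodule.subset_span ⟨(co.symm u, co.symm v), ?_⟩
      simp [hψ]
  have hdim : Module.finrank K (LinearMap.range ψ) + Module.finrank K (LinearMap.ker ψ) = 3 := by
    rw [LinearMap.finrank_range_add_finrank_ker]; simp
  have hco : ∀ u : U, u ≠ 0 → co u ≠ 0 := fun u hu h => hu (by simpa using h)
  have hmk : ∀ (u v : U) (hu : u ≠ 0) (hv : v ≠ 0), β u v = 0 → ∀ d e,
      s(Projectivization.mk K u hu, Projectivization.mk K v hv) = s(d, e) →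
        β d.rep e.rep = 0 := by
    intro u v hu hv h d e hde
    obtain ⟨a, -, ha⟩ := exists_mk_rep_eq_smul (K := K) hu
    obtain ⟨b, -, hb⟩ := exists_mk_rep_eq_smul (K := K) hv
    rcases Sym2.eq_iff.1 hde with ⟨rfl, rfl⟩ | ⟨rfl, rfl⟩
    · rw [ha, hb]; simp [h]
    · rw [ha, hb]; simp [hβ v u, h]
  -- Annihilated pairs are the factorizations of nonzero elements of the kernel; since these are
  -- unique, one pair means that the kernel is one line. By rank and nullity the range then has
  -- dimension 3 − 1 = 2.
  have hker : (∃! s : Sym2 (Projectivization K U), ∀ d e, s = s(d, e) → β d.rep e.rep = 0) ↔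
      Module.finrank K (LinearMap.ker ψ) = 1 := by
    rw [finrank_eq_one_iff']
    constructor
    · rintro ⟨s, hs, huniq⟩
      induction s using Sym2.ind with
      | _ d e =>
      have h0 := hs d e rfl
      refine ⟨⟨formMul (co d.rep) (co e.rep), by rw [LinearMap.mem_ker, ← hψ, h0]⟩, ?_, ?_⟩
      · intro h
        exact formMul_ne_zero (hco _ d.rep_nonzero) (hco _ e.rep_nonzero) (congrArg Subtype.val h)
      · rintro ⟨k, hk⟩
        by_cases hk0 : k = 0
        · exact ⟨0, by ext1; simp [hk0]⟩
        obtain ⟨u, v, rfl⟩ := formMul_surjective k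
        have hu : u ≠ 0 := by rintro rfl; exact hk0 (by funext i; fin_cases i <;> simp [formMul])
        have hv : v ≠ 0 := by rintro rfl; exact hk0 (by funext i; fin_cases i <;> simp [formMul])
        have hu' : co.symm u ≠ 0 := by simpa using hu
        have hv' : co.symm v ≠ 0 := by simpa using hv
        have h1 := huniq s(Projectivization.mk K _ hu', Projectivization.mk K _ hv')
          (hmk _ _ hu' hv' (by rw [hψ]; simpa using hk))
        obtain ⟨a, ha0, ha⟩ := exists_mk_rep_eq_smul (K := K) hu'
        obtain ⟨b, hb0, hb⟩ := exists_mk_rep_eq_smul (K := K) hv'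
        refine ⟨a⁻¹ * b⁻¹, Subtype.ext ?_⟩
        change (a⁻¹ * b⁻¹) • formMul (co d.rep) (co e.rep) = formMul u v
        rcases Sym2.eq_iff.1 h1 with ⟨rfl, rfl⟩ | ⟨rfl, rfl⟩
        · rw [ha, hb, map_smul, map_smul, formMul_smul_left, formMul_smul_right]
          simp [smul_smul]
          field_simp
          simp
        · rw [formMul_comm, ha, hb, map_smul, map_smul, formMul_smul_left, formMul_smul_right]
          simp [smul_smul]
          field_simp
          simp
    · rintro ⟨⟨k, hk⟩, hk0, hspan⟩
      have hk0' : k ≠ 0 := fun h => hk0 (Subtype.ext h)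
      obtain ⟨u, v, rfl⟩ := formMul_surjective k
      have hu : u ≠ 0 := by rintro rfl; exact hk0' (by funext i; fin_cases i <;> simp [formMul])
      have hv : v ≠ 0 := by rintro rfl; exact hk0' (by funext i; fin_cases i <;> simp [formMul])
      have hu' : co.symm u ≠ 0 := by simpa using hu
      have hv' : co.symm v ≠ 0 := by simpa using hv
      refine ⟨s(Projectivization.mk K _ hu', Projectivization.mk K _ hv'),
          (hmk _ _ hu' hv' (by rw [hψ]; simpa using hk)), ?_⟩
      intro s hs
      induction s using Sym2.ind with
      | _ d e =>
      have h0 := hs d e rfl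
      have hne := formMul_ne_zero (hco _ d.rep_nonzero) (hco _ e.rep_nonzero)
      obtain ⟨c, hc⟩ := hspan ⟨formMul (co d.rep) (co e.rep), by rw [LinearMap.mem_ker, ← hψ, h0]⟩
      have hc' : formMul (co d.rep) (co e.rep) = c • formMul u v :=
        (congrArg Subtype.val hc).symm
      have hc0 : c ≠ 0 := by
        rintro rfl
        exact hne (by rw [hc', zero_smul])
      have hmk' : ∀ (d : Projectivization K U) (w : Fin 2 → K) (hw : co.symm w ≠ 0) (a : K),
          a ≠ 0 → co d.rep = a • w → d = Projectivization.mk K _ hw := by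
        intro d w hw a ha h
        rw [← d.mk_rep, Projectivization.mk_eq_mk_iff']
        refine ⟨a, ?_⟩
        apply co.injective
        rw [map_smul, LinearEquiv.apply_symm_apply, h]
      rcases eq_of_formMul_eq (hco _ d.rep_nonzero) (hco _ e.rep_nonzero) hu hc0 hc' with
        ⟨a, b, ha, hb, h1, h2⟩ | ⟨a, b, ha, hb, h1, h2⟩
      · rw [hmk' d u hu' a ha h1, hmk' e v hv' b hb h2]
      · rw [hmk' d v hv' a ha h1, hmk' e u hu' b hb h2, Sym2.eq_swap]
  rw [hker, hrange]
  omega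

end ConjugatePairs

end ProjSurf

namespace ProjSurf

open MvPolynomial

/-! ### The second fundamental form in terms of a frame -/

section SecondOrder

universe u

set_option linter.unusedSectionVars false

variable {K : Type u} [Field K] {N : ℕ}

theorem tangentSpace_eq (X : Set (PSpace K N)) (p : PSpace K N) :
    tangentSpace X p = tangentAt (idealOf X) p.rep := rfl

theorem pderiv_comm {σ : Type*} (i j : σ) (f : MvPolynomial σ K) :
    pderiv i (pderiv j f) = pderiv j (pderiv i f) := by
  classical
  have h : ⁅(pderiv i : Derivation K (MvPolynomial σ K) _), pderiv j⁆ = 0 :=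
    derivation_ext fun k => by
      rw [Derivation.commutator_apply, pderiv_X, pderiv_X, Derivation.zero_apply]
      simp only [Pi.single_apply]
      split_ifs <;> simp
  have h1 := Derivation.congr_fun h f
  rwa [Derivation.commutator_apply, Derivation.zero_apply, sub_eq_zero] at h1

theorem diff2_symm (f : MvPolynomial (Fin (N + 1)) K) (x v w : Fin (N + 1) → K) :
    diff2 f x v w = diff2 f x w v := by
  unfold diff2
  rw [Finset.sum_comm]
  refine Finset.sum_congr rfl fun i _ => Finset.sum_congr rfl fun j _ => ?_
  rw [pderiv_comm j i f]
  ring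

theorem diff2_add_left (f : MvPolynomial (Fin (N + 1)) K) (x v v' w : Fin (N + 1) → K) :
    diff2 f x (v + v') w = diff2 f x v w + diff2 f x v' w := by
  simp [diff2, mul_add, add_mul, Finset.sum_add_distrib]

theorem diff2_smul_left (f : MvPolynomial (Fin (N + 1)) K) (c : K) (x v w : Fin (N + 1) → K) :
    diff2 f x (c • v) w = c * diff2 f x v w := by
  simp only [diff2, Finset.mul_sum, Pi.smul_apply, smul_eq_mul]
  exact Finset.sum_congr rfl fun i _ => Finset.sum_congr rfl fun j _ => by ring

theorem diff2_add_right (f : MvPolynomial (Fin (N + 1)) K) (x v w w' : Fin (N + 1) → K) :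
    diff2 f x v (w + w') = diff2 f x v w + diff2 f x v w' := by
  rw [diff2_symm, diff2_add_left, diff2_symm f x w, diff2_symm f x w']

theorem diff2_smul_right (f : MvPolynomial (Fin (N + 1)) K) (c : K) (x v w : Fin (N + 1) → K) :
    diff2 f x v (c • w) = c * diff2 f x v w := by
  rw [diff2_symm, diff2_smul_left, diff2_symm]

/-- The second differential as a bilinear form. -/
noncomputable def hessian (f : MvPolynomial (Fin (N + 1)) K) (x : Fin (N + 1) → K) :
    (Fin (N + 1) → K) →ₗ[K] (Fin (N + 1) → K) →ₗ[K] K :=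
  LinearMap.mk₂ K (diff2 f x) (diff2_add_left f x) (fun c v w => diff2_smul_left f c x v w)
    (diff2_add_right f x) (fun c v w => diff2_smul_right f c x v w)

@[simp] theorem hessian_apply (f : MvPolynomial (Fin (N + 1)) K) (x v w : Fin (N + 1) → K) :
    hessian f x v w = diff2 f x v w := rfl

/-- A polynomial vector field is tangent to the scheme of an ideal. -/
def IsTangentField (I : Ideal (MvPolynomial (Fin (N + 1)) K))
    (b : Fin (N + 1) → MvPolynomial (Fin (N + 1)) K) : Prop :=
  ∀ f ∈ I, ∑ i, pderiv i f * b i ∈ I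

variable {I : Ideal (MvPolynomial (Fin (N + 1)) K)} {x : Fin (N + 1) → K}

/-- The second differentials of the equations along tangent fields are determined by
the derivatives of the fields. -/
theorem diffAt_dirDeriv_add_diff2 (hx : ∀ f ∈ I, aeval x f = 0)
    {b b' : Fin (N + 1) → MvPolynomial (Fin (N + 1)) K} (hb : IsTangentField I b)
    (hb' : IsTangentField I b') {f : MvPolynomial (Fin (N + 1)) K} (hf : f ∈ I) :
    diffAt f x (evalVec (dirDeriv b b') x) + diff2 f x (evalVec b x) (evalVec b' x) = 0 := by
  -- Tangency is used twice: differentiating `f` along `b'` and then along `b` stays in `I`. The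
  -- product rule splits the result into the two terms.
  have h := hx _ (hb _ (hb' f hf))
  simp only [map_sum, map_mul, Derivation.leibniz, smul_eq_mul, map_add, add_mul,
    Finset.sum_add_distrib, Finset.sum_mul] at h
  rw [← h]
  simp only [diffAt, diff2, evalVec, dirDeriv, map_sum, map_mul, Finset.mul_sum]
  congr 1
  · rw [Finset.sum_comm]
    exact Finset.sum_congr rfl fun i _ => Finset.sum_congr rfl fun j _ => by ring
  · exact Finset.sum_congr rfl fun i _ => Finset.sum_congr rfl fun j _ => by
      rw [← aeval_eq_eval]; ring

theorem diffAt_add_right (f : MvPolynomial (Fin (N + 1)) K) (x v w : Fin (N + 1) → K) :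
    diffAt f x (v + w) = diffAt f x v + diffAt f x w := by
  simp [diffAt, mul_add, Finset.sum_add_distrib]

theorem diffAt_smul_right (f : MvPolynomial (Fin (N + 1)) K) (c : K) (x v : Fin (N + 1) → K) :
    diffAt f x (c • v) = c * diffAt f x v := by
  simp only [diffAt, Finset.mul_sum, Pi.smul_apply, smul_eq_mul]
  exact Finset.sum_congr rfl fun i _ => by ring

/-- The differentials of all elements of an ideal at a point. -/
noncomputable def conormalMap (I : Ideal (MvPolynomial (Fin (N + 1)) K)) (x : Fin (N + 1) → K) :
    (Fin (N + 1) → K) →ₗ[K] (I → K) where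
  toFun v f := diffAt f.1 x v
  map_add' v w := by funext f; exact diffAt_add_right _ _ _ _
  map_smul' c v := by funext f; exact diffAt_smul_right _ _ _ _

theorem ker_conormalMap : LinearMap.ker (conormalMap I x) = tangentAt I x := by
  ext v
  rw [LinearMap.mem_ker, mem_tangentAt, funext_iff]
  exact ⟨fun h f hf => h ⟨f, hf⟩, fun h f => h f.1 f.2⟩

/-- The second differentials of all elements of an ideal at a point. -/
noncomputable def hessianMap (I : Ideal (MvPolynomial (Fin (N + 1)) K)) (x : Fin (N + 1) → K) :
    (Fin (N + 1) → K) →ₗ[K] (Fin (N + 1) → K) →ₗ[K] (I → K) :=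
  LinearMap.mk₂ K (fun v w f => diff2 f.1 x v w)
    (fun _ _ _ => funext fun _ => diff2_add_left _ _ _ _ _)
    (fun _ _ _ => funext fun _ => diff2_smul_left _ _ _ _ _)
    (fun _ _ _ => funext fun _ => diff2_add_right _ _ _ _ _)
    (fun _ _ _ => funext fun _ => diff2_smul_right _ _ _ _ _)

theorem hessianMap_symm (v w : Fin (N + 1) → K) : hessianMap I x v w = hessianMap I x w v :=
  funext fun _ => diff2_symm _ _ _ _

/-- Modulo the tangent space, the derivative of `b'` along `b` is thus the value of the second
fundamental form on the two vectors. Later ranks are computed through this identity. -/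
theorem conormalMap_dirDeriv (hx : ∀ f ∈ I, aeval x f = 0)
    {b b' : Fin (N + 1) → MvPolynomial (Fin (N + 1)) K} (hb : IsTangentField I b)
    (hb' : IsTangentField I b') :
    conormalMap I x (evalVec (dirDeriv b b') x) =
      - hessianMap I x (evalVec b x) (evalVec b' x) := by
  funext f
  exact eq_neg_of_add_eq_zero_left (diffAt_dirDeriv_add_diff2 hx hb hb' f.2)

variable {d : ℕ} {Δ : MvPolynomial (Fin (N + 1)) K}
  {B : Fin d → Fin (N + 1) → MvPolynomial (Fin (N + 1)) K} {e : Fin d → Fin (N + 1)}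

/-- The span of the first and second derivatives of a local parametrization of the cone. -/
noncomputable def secondSpan (B : Fin d → Fin (N + 1) → MvPolynomial (Fin (N + 1)) K)
    (x : Fin (N + 1) → K) : Submodule K (Fin (N + 1) → K) :=
  Submodule.span K (Set.range (Sum.elim (fun i => evalVec (B i) x)
    (fun q : Fin d × Fin d => evalVec (dirDeriv (B q.1) (B q.2)) x)))

theorem rulingTangent_le_secondSpan (x : Fin (N + 1) → K) (t : Fin d → K) :
    rulingTangent B x t ≤ secondSpan B x := by
  rw [rulingTangent, Submodule.span_le]
  rintro _ ⟨i | j, rfl⟩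
  · exact Submodule.subset_span ⟨Sum.inl i, rfl⟩
  · rw [Sum.elim_inr, SetLike.mem_coe, rulingPoint]
    exact Submodule.sum_mem _ fun i _ => Submodule.smul_mem _ _
      (Submodule.subset_span ⟨Sum.inr (j, i), rfl⟩)

theorem finrank_eq_add_finrank_map {V Q : Type*} [AddCommGroup V] [Module K V] [Module.Finite K V]
    [AddCommGroup Q] [Module K Q] (φ : V →ₗ[K] Q) (W : Submodule K V)
    (h : LinearMap.ker φ ≤ W) :
    Module.finrank K W = Module.finrank K (LinearMap.ker φ) + Module.finrank K (W.map φ) := by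
  have h1 := LinearMap.finrank_range_add_finrank_ker (φ.domRestrict W)
  rw [LinearMap.range_domRestrict, LinearMap.ker_domRestrict] at h1
  have h2 := (Submodule.submoduleOfEquivOfLe h).finrank_eq
  rw [Submodule.submoduleOf] at h2
  omega

/-- The conormal map kills exactly the `d`-dimensional tangent space and sends the second
derivatives, up to sign, to the values of the Hessian on the frame. -/
theorem finrank_secondSpan (h : IsFrame I Δ B e) (hx : ∀ f ∈ I, aeval x f = 0)
    (hΔ : aeval x Δ ≠ 0) :
    Module.finrank K (secondSpan B x) = d + Module.finrank K (Submodule.span K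
      (Set.range fun p : tangentAt I x × tangentAt I x => hessianMap I x p.1 p.2)) := by
  have hT := h.tangentAt_eq hx hΔ
  have hle : LinearMap.ker (conormalMap I x) ≤ secondSpan B x := by
    rw [ker_conormalMap, hT, Submodule.span_le]
    rintro _ ⟨i, rfl⟩
    exact Submodule.subset_span ⟨Sum.inl i, rfl⟩
  have hmap : (secondSpan B x).map (conormalMap I x) = Submodule.span K
      (Set.range fun p : tangentAt I x × tangentAt I x => hessianMap I x p.1 p.2) := by
    apply le_antisymm
    · rw [secondSpan, Submodule.map_span_le]
      rintro _ ⟨i | q, rfl⟩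
      · have : conormalMap I x (evalVec (B i) x) = 0 := by
          rw [← LinearMap.mem_ker, ker_conormalMap]; exact h.evalVec_mem hx i
        rw [Sum.elim_inl, this]
        exact Submodule.zero_mem _
      · rw [Sum.elim_inr, conormalMap_dirDeriv hx (fun f hf => h.tangent f hf _)
          (fun f hf => h.tangent f hf _)]
        exact Submodule.neg_mem _ (Submodule.subset_span
          ⟨(⟨_, h.evalVec_mem hx q.1⟩, ⟨_, h.evalVec_mem hx q.2⟩), rfl⟩)
    · rw [Submodule.span_le]
      rintro _ ⟨⟨v, w⟩, rfl⟩
      simp only [SetLike.mem_coe]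
      rw [h.mem_span hΔ v.2, h.mem_span hΔ w.2]
      simp only [map_sum, map_smul, LinearMap.sum_apply, LinearMap.smul_apply]
      refine Submodule.sum_mem _ fun j _ => Submodule.smul_mem _ _
        (Submodule.sum_mem _ fun i _ => Submodule.smul_mem _ _ ?_)
      rw [← neg_neg (hessianMap I x _ _), ← conormalMap_dirDeriv hx (fun f hf => h.tangent f hf _)
          (fun f hf => h.tangent f hf _)]
      exact Submodule.neg_mem _ (Submodule.mem_map_of_mem
        (Submodule.subset_span ⟨Sum.inr (i, j), rfl⟩))
  rw [finrank_eq_add_finrank_map (conormalMap I x) _ hle, ker_conormalMap,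
    h.finrank_tangentAt hx hΔ, hmap]

/-- The derivative of v = ∑ tᵢ Bᵢ along Bⱼ represents II(Bⱼ, v) = II(v, Bⱼ). Hence the rank of the
parametrization exceeds `d` by the rank of II(v, ·). -/
theorem map_rulingTangent (h : IsFrame I Δ B e) (hx : ∀ f ∈ I, aeval x f = 0)
    (hΔ : aeval x Δ ≠ 0) (t : Fin d → K) :
    (rulingTangent B x t).map (conormalMap I x) =
      (tangentAt I x).map ((hessianMap I x) (rulingPoint B x t)) := by
  have hval : ∀ j, conormalMap I x (rulingPoint (fun i => dirDeriv (B j) (B i)) x t) =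
      - hessianMap I x (rulingPoint B x t) (evalVec (B j) x) := by
    intro j
    simp only [rulingPoint, map_sum, map_smul, LinearMap.sum_apply, LinearMap.smul_apply,
      ← Finset.sum_neg_distrib]
    refine Finset.sum_congr rfl fun i _ => ?_
    rw [conormalMap_dirDeriv hx (fun f hf => h.tangent f hf _) (fun f hf => h.tangent f hf _),
      hessianMap_symm, smul_neg]
  apply le_antisymm
  · rw [rulingTangent, Submodule.map_span_le]
    rintro _ ⟨i | j, rfl⟩
    · have : conormalMap I x (evalVec (B i) x) = 0 := by
        rw [← LinearMap.mem_ker, ker_conormalMap]; exact h.evalVec_mem hx i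
      rw [Sum.elim_inl, this]
      exact Submodule.zero_mem _
    · rw [Sum.elim_inr, hval]
      exact Submodule.neg_mem _ (Submodule.mem_map_of_mem (h.evalVec_mem hx j))
  · rw [h.tangentAt_eq hx hΔ, Submodule.map_span_le]
    rintro _ ⟨j, rfl⟩
    rw [← neg_neg (hessianMap I x _ _), ← hval]
    exact Submodule.neg_mem _ (Submodule.mem_map_of_mem
      (Submodule.subset_span ⟨Sum.inr j, rfl⟩))

theorem finrank_rulingTangent (h : IsFrame I Δ B e) (hx : ∀ f ∈ I, aeval x f = 0)
    (hΔ : aeval x Δ ≠ 0) (t : Fin d → K) :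
    Module.finrank K (rulingTangent B x t) = d + Module.finrank K
      ((tangentAt I x).map ((hessianMap I x) (rulingPoint B x t))) := by
  have hle : LinearMap.ker (conormalMap I x) ≤ rulingTangent B x t := by
    rw [ker_conormalMap, h.tangentAt_eq hx hΔ, Submodule.span_le]
    rintro _ ⟨i, rfl⟩
    exact Submodule.subset_span ⟨Sum.inl i, rfl⟩
  rw [finrank_eq_add_finrank_map (conormalMap I x) _ hle, ker_conormalMap,
    h.finrank_tangentAt hx hΔ, map_rulingTangent h hx hΔ]

/-- Every linear form vanishing on the tangent space is the differential of an equation. -/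
theorem exists_diffAt_eq {φ : Module.Dual K (Fin (N + 1) → K)} (hφ : ∀ v ∈ tangentAt I x, φ v = 0) :
    ∃ f ∈ I, ∀ v, diffAt f x v = φ v := by
  let L : MvPolynomial (Fin (N + 1)) K →ₗ[K] Module.Dual K (Fin (N + 1) → K) :=
    { toFun := diffFunctional x
      map_add' := fun f g => LinearMap.ext fun v => by
        simp [diffFunctional_apply, diffAt_add]
      map_smul' := fun c f => LinearMap.ext fun v => by
        simp [diffFunctional_apply, diffAt_smul] }
  let W := (I.restrictScalars K).map L
  have h1 : φ ∈ W.dualCoannihilator.dualAnnihilator := by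
    rw [Submodule.mem_dualAnnihilator]
    intro v hv
    apply hφ
    intro f hf
    rw [← diffFunctional_apply]
    exact (Submodule.mem_dualCoannihilator _).1 hv _ ⟨f, hf, rfl⟩
  rw [Subspace.dualCoannihilator_dualAnnihilator_eq] at h1
  obtain ⟨f, hf, hfφ⟩ := h1
  refine ⟨f, hf, fun v => ?_⟩
  rw [← diffFunctional_apply, ← hfφ]; rfl

end SecondOrder

end ProjSurf

namespace ProjSurf

open MvPolynomial

/-! ### Contact of order three and the span of second derivatives -/

section Osculating

universe u

set_option linter.unusedSectionVars false

variable {K : Type u} [Field K]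

theorem aeval_eq_eval' {σ : Type*} (x : σ → K) (f : MvPolynomial σ K) :
    aeval x f = eval x f := rfl

section MaximalIdeal

variable {σ : Type} [Fintype σ] (x : σ → K)

theorem exists_eq_add_sum_mul_sub (g : MvPolynomial σ K) :
    ∃ h : σ → MvPolynomial σ K, g = C (eval x g) + ∑ i, h i * (X i - C (x i)) := by
  classical
  induction g using MvPolynomial.induction_on with
  | C a => exact ⟨0, by simp⟩
  | add p q hp hq =>
    obtain ⟨h, hh⟩ := hp
    obtain ⟨k, hk⟩ := hq
    refine ⟨h + k, ?_⟩
    simp only [map_add, Pi.add_apply, add_mul, Finset.sum_add_distrib]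
    linear_combination hh + hk
  | mul_X p i hp =>
    obtain ⟨h, hh⟩ := hp
    refine ⟨fun j => h j * X i + if j = i then C (eval x p) else 0, ?_⟩
    simp only [map_mul, eval_X, add_mul, Finset.sum_add_distrib, ite_mul, zero_mul,
      Finset.sum_ite_eq', Finset.mem_univ, if_true]
    have h1 : ∑ j, h j * X i * (X j - C (x j)) = (∑ j, h j * (X j - C (x j))) * X i := by
      rw [Finset.sum_mul]; exact Finset.sum_congr rfl fun j _ => by ring
    rw [h1]
    linear_combination X i * hh

theorem X_sub_C_mem_ker_eval (i : σ) : (X i - C (x i) : MvPolynomial σ K) ∈ RingHom.ker (eval x) := by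
  simp [RingHom.mem_ker]

theorem derivation_mem_ker_pow (D : Derivation K (MvPolynomial σ K) (MvPolynomial σ K)) (k : ℕ)
    {g : MvPolynomial σ K} (hg : g ∈ RingHom.ker (eval x) ^ (k + 1)) :
    D g ∈ RingHom.ker (eval x) ^ k := by
  induction k generalizing g with
  | zero => simp
  | succ k ih =>
    rw [pow_succ] at hg
    induction hg using Submodule.mul_induction_on' with
    | mem_mul_mem a ha b hb =>
      rw [D.leibniz]
      refine Ideal.add_mem _ (Ideal.mul_mem_right _ _ ha) ?_
      rw [pow_succ', smul_eq_mul]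
      exact Ideal.mul_mem_mul hb (ih ha)
    | add a _ b _ ha hb => rw [map_add]; exact Ideal.add_mem _ ha hb

/-- The Euler derivation centred at a point. -/
noncomputable def eulerAt : Derivation K (MvPolynomial σ K) (MvPolynomial σ K) :=
  mkDerivation K fun i => X i - C (x i)

/-- Euler's identity at a point with maximal ideal m: the derivation acts on mᵏ/mᵏ⁺¹ as
multiplication by k. It follows from the case k = 1 by the product rule. -/
theorem eulerAt_sub_mem (k : ℕ) {g : MvPolynomial σ K} (hg : g ∈ RingHom.ker (eval x) ^ k) :
    eulerAt x g - (k : MvPolynomial σ K) * g ∈ RingHom.ker (eval x) ^ (k + 1) := by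
  have h0 : ∀ g, eulerAt x g ∈ RingHom.ker (eval x) := by
    intro g
    rw [eulerAt, mkDerivation_eq_sum]
    exact Ideal.sum_mem _ fun i _ => Ideal.mul_mem_left _ _ (X_sub_C_mem_ker_eval x i)
  have h1 : ∀ g ∈ RingHom.ker (eval x), eulerAt x g - g ∈ RingHom.ker (eval x) ^ 2 := by
    intro g hg
    obtain ⟨h, hh⟩ := exists_eq_add_sum_mul_sub x g
    rw [RingHom.mem_ker.1 hg, map_zero, zero_add] at hh
    have h2 : eulerAt x g - g = ∑ i, eulerAt x (h i) * (X i - C (x i)) := by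
      have h3 : ∀ i, eulerAt x (X i - C (x i)) = X i - C (x i) := fun i => by
        simp [eulerAt, mkDerivation_X]
      conv_lhs => rw [hh]
      simp only [map_sum, Derivation.leibniz, smul_eq_mul, h3, Finset.sum_add_distrib]
      rw [add_sub_cancel_left]
      exact Finset.sum_congr rfl fun i _ => mul_comm _ _
    rw [h2, pow_two]
    exact Ideal.sum_mem _ fun i _ => Ideal.mul_mem_mul (h0 _) (X_sub_C_mem_ker_eval x i)
  induction k generalizing g with
  | zero => simpa using h0 g
  | succ k ih =>
    rw [pow_succ] at hg
    induction hg using Submodule.mul_induction_on' with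
    | mem_mul_mem a ha b hb =>
      have : eulerAt x (a * b) - ((k + 1 : ℕ) : MvPolynomial σ K) * (a * b) =
          (eulerAt x a - (k : MvPolynomial σ K) * a) * b + a * (eulerAt x b - b) := by
        rw [Derivation.leibniz]; push_cast; simp only [smul_eq_mul]; ring
      rw [this]
      refine Ideal.add_mem _ ?_ ?_
      · rw [pow_succ _ (k + 1)]
        exact Ideal.mul_mem_mul (ih ha) hb
      · rw [show k + 1 + 1 = k + 2 by rfl, pow_add]
        exact Ideal.mul_mem_mul ha (h1 b hb)
    | add a _ b _ ha hb =>
      rw [map_add, mul_add, add_sub_add_comm]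
      exact Ideal.add_mem _ ha hb

/-- By Euler's identity (k+1)g agrees with ∑ (Xᵢ − xᵢ)∂ᵢg modulo the next power, and k+1 is
invertible in characteristic 0. -/
theorem mem_ker_pow_succ_of_pderiv [CharZero K] {k : ℕ} {g : MvPolynomial σ K}
    (hg : g ∈ RingHom.ker (eval x) ^ (k + 1))
    (h : ∀ i, pderiv i g ∈ RingHom.ker (eval x) ^ (k + 1)) :
    g ∈ RingHom.ker (eval x) ^ (k + 2) := by
  have h1 := eulerAt_sub_mem x (k + 1) hg
  have h2 : eulerAt x g ∈ RingHom.ker (eval x) ^ (k + 2) := by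
    rw [eulerAt, mkDerivation_eq_sum, pow_succ _ (k + 1)]
    exact Ideal.sum_mem _ fun i _ => Ideal.mul_mem_mul (h i) (X_sub_C_mem_ker_eval x i)
  have h3 := Ideal.sub_mem _ h2 h1
  rw [sub_sub_cancel] at h3
  have h4 := Ideal.mul_mem_left _ (C ((k + 1 : ℕ) : K)⁻¹) h3
  have hk : ((k + 1 : ℕ) : K) ≠ 0 := Nat.cast_ne_zero.2 (by omega)
  have h5 : (C ((k + 1 : ℕ) : K)⁻¹ : MvPolynomial σ K) * (((k + 1 : ℕ) : MvPolynomial σ K) * g) = g := by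
    rw [← mul_assoc, ← map_natCast (C : K →+* MvPolynomial σ K), ← C_mul, inv_mul_cancel₀ hk, C_1,
      one_mul]
  rwa [h5] at h4

end MaximalIdeal

variable {N : ℕ}

theorem smul_mem_affineCone {A : Set (PSpace K N)} {x : Fin (N + 1) → K} (hx : x ∈ affineCone A)
    {c : K} (hc : c ≠ 0) : c • x ∈ affineCone A := by
  obtain ⟨h0, h⟩ := hx
  refine ⟨smul_ne_zero hc h0, ?_⟩
  have : Projectivization.mk K (c • x) (smul_ne_zero hc h0) = Projectivization.mk K x h0 := by
    rw [Projectivization.mk_eq_mk_iff']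
    exact ⟨c, rfl⟩
  rwa [this]

theorem rep_mem_affineCone {A : Set (PSpace K N)} {p : PSpace K N} (hp : p ∈ A) :
    p.rep ∈ affineCone A := ⟨p.rep_nonzero, by rwa [p.mk_rep]⟩

theorem mem_idealOf {A : Set (PSpace K N)} {f : MvPolynomial (Fin (N + 1)) K} :
    f ∈ idealOf A ↔ ∀ x ∈ affineCone A, aeval x f = 0 := Iff.rfl

/-- The cone is stable under scaling. For `f` in the ideal, f(cx) is a polynomial in c with
infinitely many zeros; its derivative at c = 1 is the Euler field applied to `f`. -/
theorem isTangentField_X [CharZero K] (A : Set (PSpace K N)) : IsTangentField (idealOf A) X := by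
  intro f hf x hx
  have h0 : aeval (fun i => (Polynomial.X * Polynomial.C (x i) : Polynomial K)) f = 0 := by
    apply Polynomial.eq_zero_of_infinite_isRoot
    refine Set.Infinite.mono (s := {c : K | c ≠ 0}) ?_ ?_
    · intro c hc
      change Polynomial.eval c _ = 0
      rw [← Polynomial.coe_aeval_eq_eval]
      have := map_aeval' ((Polynomial.aeval c : Polynomial K →ₐ[K] K)) f
        (fun i => (Polynomial.X * Polynomial.C (x i) : Polynomial K))
      refine this.trans ?_
      have h1 := hf _ (smul_mem_affineCone hx hc)
      rw [← h1]
      congr 2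
      funext i
      simp only [map_mul, Polynomial.aeval_X, Polynomial.aeval_C]
      rfl
    · exact Set.Infinite.mono (fun c hc => hc) (Set.Finite.infinite_compl (Set.finite_singleton 0))
  have h1 := derivation_aeval (Polynomial.derivative' : Derivation K (Polynomial K) _)
    (fun i => (Polynomial.X * Polynomial.C (x i) : Polynomial K)) f
  rw [h0, map_zero] at h1
  have h2 := congrArg (Polynomial.aeval (1 : K)) h1
  rw [map_diffAt, map_zero] at h2
  rw [map_sum, h2]
  simp only [diffAt]
  refine Finset.sum_congr rfl fun i _ => ?_
  simp

theorem mem_tangentAt_self {I : Ideal (MvPolynomial (Fin (N + 1)) K)} (hI : IsTangentField I X)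
    {x : Fin (N + 1) → K} (hx : ∀ f ∈ I, aeval x f = 0) : x ∈ tangentAt I x := by
  intro f hf
  have := hx _ (hI f hf)
  simpa [diffAt] using this

variable {I : Ideal (MvPolynomial (Fin (N + 1)) K)} {x : Fin (N + 1) → K}
  {d : ℕ} {Δ : MvPolynomial (Fin (N + 1)) K}
  {B : Fin d → Fin (N + 1) → MvPolynomial (Fin (N + 1)) K} {e : Fin d → Fin (N + 1)}

/-- The derivative of the Euler field along Bⱼ is Bⱼ, which is tangent, so II(x, Bⱼ) = 0. This lets
II descend to the tangent space modulo the line of the point. -/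
theorem hessianMap_self (hI : IsTangentField I X) (h : IsFrame I Δ B e)
    (hx : ∀ f ∈ I, aeval x f = 0) (hΔ : aeval x Δ ≠ 0) {w : Fin (N + 1) → K}
    (hw : w ∈ tangentAt I x) : hessianMap I x x w = 0 := by
  have h1 : ∀ j, hessianMap I x x (evalVec (B j) x) = 0 := by
    intro j
    have h2 := conormalMap_dirDeriv hx (fun f hf => h.tangent f hf j) hI
    have h3 : dirDeriv (B j) X = B j := by
      classical
      funext k
      simp [dirDeriv, pderiv_X, Pi.single_apply]
    have h4 : evalVec (K := K) X x = x := by funext k; simp [evalVec]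
    have h5 : conormalMap I x (evalVec (B j) x) = 0 := by
      rw [← LinearMap.mem_ker, ker_conormalMap]; exact h.evalVec_mem hx j
    rw [h3, h4, h5] at h2
    rw [hessianMap_symm]
    exact neg_eq_zero.1 h2.symm
  rw [h.mem_span hΔ hw]
  simp [map_sum, h1]

theorem diffAt_linForm (a v : Fin (N + 1) → K) : diffAt (linForm a) x v = ∑ i, a i * v i := by
  classical
  simp only [diffAt, linForm, map_sum, Derivation.leibniz, pderiv_X, pderiv_C, smul_eq_mul]
  refine Finset.sum_congr rfl fun i _ => ?_
  simp [Pi.single_apply, apply_ite (eval x)]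

theorem diff2_linForm (a v w : Fin (N + 1) → K) : diff2 (linForm a) x v w = 0 := by
  classical
  simp only [diff2, linForm, map_sum, Derivation.leibniz, pderiv_X, pderiv_C, smul_eq_mul]
  refine Finset.sum_eq_zero fun i _ => Finset.sum_eq_zero fun j _ => ?_
  simp [Pi.single_apply, apply_ite (pderiv i)]

theorem diff2_add (f g : MvPolynomial (Fin (N + 1)) K) (v w : Fin (N + 1) → K) :
    diff2 (f + g) x v w = diff2 f x v w + diff2 g x v w := by
  simp [diff2, add_mul, Finset.sum_add_distrib]

theorem diff2_neg (f : MvPolynomial (Fin (N + 1)) K) (v w : Fin (N + 1) → K) :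
    diff2 (-f) x v w = - diff2 f x v w := by
  simp [diff2]

theorem diff2_sum {ι : Type*} (s : Finset ι) (f : ι → MvPolynomial (Fin (N + 1)) K)
    (v w : Fin (N + 1) → K) : diff2 (∑ k ∈ s, f k) x v w = ∑ k ∈ s, diff2 (f k) x v w := by
  classical
  induction s using Finset.induction_on with
  | empty => simp [diff2]
  | insert a s ha ih => rw [Finset.sum_insert ha, Finset.sum_insert ha, diff2_add, ih]

theorem diff2_mul (f g : MvPolynomial (Fin (N + 1)) K) (hf : aeval x f = 0) (hg : aeval x g = 0)
    (v w : Fin (N + 1) → K) : diff2 (f * g) x v w =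
      diffAt f x v * diffAt g x w + diffAt f x w * diffAt g x v := by
  rw [aeval_eq_eval'] at hf hg
  simp only [diff2, diffAt, Derivation.leibniz, smul_eq_mul, map_add, map_mul, hf, hg, zero_mul,
    zero_add, aeval_eq_eval', add_mul, Finset.sum_add_distrib, Finset.sum_mul_sum]
  congr 1
  · exact Finset.sum_congr rfl fun i _ => Finset.sum_congr rfl fun j _ => by ring
  · rw [Finset.sum_comm]
    exact Finset.sum_congr rfl fun i _ => Finset.sum_congr rfl fun j _ => by ring

/-- An equation with prescribed differential whose second differential vanishes. -/
theorem exists_mem_diff2_eq_zero [CharZero K] (hx : ∀ f ∈ I, aeval x f = 0)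
    {f : MvPolynomial (Fin (N + 1)) K} (hf : f ∈ I)
    (h : ∀ v ∈ tangentAt I x, ∀ w ∈ tangentAt I x, diff2 f x v w = 0) :
    ∃ g ∈ I, (∀ v, diffAt g x v = diffAt f x v) ∧ ∀ v w, diff2 g x v w = 0 := by
  classical
  obtain ⟨π, hπ⟩ := LinearMap.exists_extend (LinearMap.id : tangentAt I x →ₗ[K] tangentAt I x)
  have hπ' : ∀ v ∈ tangentAt I x, (π v : Fin (N + 1) → K) = v := fun v hv => by
    have := LinearMap.congr_fun hπ ⟨v, hv⟩
    exact congrArg Subtype.val this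
  let ρ : (Fin (N + 1) → K) →ₗ[K] (Fin (N + 1) → K) :=
    LinearMap.id - (tangentAt I x).subtype.comp π
  have hρ : ∀ v, ρ v = v - π v := fun v => rfl
  -- These functionals vanish on the tangent space, hence are differentials of equations. The factor
  -- 1/2 on the normal part is there because subtracting ∑ (Xᵢ − xᵢ)kᵢ changes the Hessian by a
  -- symmetrized expression, which counts that part twice.
  have hL : ∀ i : Fin (N + 1), ∃ k ∈ I, ∀ w, diffAt k x w =
      hessian f x (π (Pi.single i 1) + (2⁻¹ : K) • ρ (Pi.single i 1)) (ρ w) := by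
    intro i
    apply exists_diffAt_eq (φ := (hessian f x (π (Pi.single i 1) +
      (2⁻¹ : K) • ρ (Pi.single i 1))).comp ρ)
    intro v hv
    have h0 : ρ v = 0 := by rw [hρ, hπ' v hv, sub_self]
    rw [LinearMap.comp_apply, h0, map_zero]
  choose k hk hkd using hL
  have hk' : ∀ v w, ∑ i, v i * diffAt (k i) x w =
      hessian f x (π v + (2⁻¹ : K) • ρ v) (ρ w) := by
    intro v w
    have hv : v = ∑ i, v i • (Pi.single i 1 : Fin (N + 1) → K) := by
      funext j; simp [Finset.sum_apply, Pi.single_apply]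
    let Φ : (Fin (N + 1) → K) →ₗ[K] (Fin (N + 1) → K) :=
      (tangentAt I x).subtype.comp π + (2⁻¹ : K) • ρ
    have hΦ : ∀ v, (π v : Fin (N + 1) → K) + (2⁻¹ : K) • ρ v = Φ v := fun v => rfl
    simp only [hkd, hΦ]
    conv_rhs => rw [hv]
    simp only [map_sum, map_smul, LinearMap.sum_apply, LinearMap.smul_apply, smul_eq_mul]
  have hyx : ∀ i, aeval x (X i - C (x i) : MvPolynomial (Fin (N + 1)) K) = 0 := fun i => by simp
  have hyd : ∀ i v, diffAt (X i - C (x i)) x v = v i := fun i v => by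
    simp [diffAt, pderiv_X, Pi.single_apply]
  refine ⟨f + -∑ i, (X i - C (x i)) * k i, Ideal.add_mem _ hf (Ideal.neg_mem_iff _ |>.2
    (Ideal.sum_mem _ fun i _ => Ideal.mul_mem_left _ _ (hk i))), ?_, ?_⟩
  · intro v
    have : diffAt (-∑ i, (X i - C (x i)) * k i) x v = 0 := by
      simp only [diffAt, map_neg, map_sum, Derivation.leibniz, smul_eq_mul, map_add, map_mul, hyx,
        hx _ (hk _), zero_mul, add_zero, Finset.sum_const_zero, neg_zero]
    rw [diffAt_add, this, add_zero]
  · intro v w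
    rw [diff2_add, diff2_neg, diff2_sum]
    simp only [diff2_mul _ _ (hyx _) (hx _ (hk _)), hyd, Finset.sum_add_distrib, hk']
    have hvw : diff2 f x v w = hessian f x (π v + ρ v) (π w + ρ w) := by
      simp [hρ]
    have h0 : hessian f x (π v) (π w) = 0 := h _ (π v).2 _ (π w).2
    have hs : ∀ a b, hessian f x a b = hessian f x b a := fun a b => diff2_symm _ _ _ _
    rw [hvw]
    simp only [map_add, map_smul, LinearMap.add_apply, LinearMap.smul_apply, h0, smul_eq_mul]
    rw [hs (ρ v) (π w), hs (ρ w) (ρ v)]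
    ring

/-- If the form is f + r with f in `I` and r of order 3, then f has the differential of the form and
zero second differential, so it kills the derivatives of the frame. Conversely, a form that kills
the span is the differential of an equation whose Hessian vanishes on the tangent space. That
equation can be corrected to one with zero Hessian, and the difference has order 3 by
`mem_ker_pow_succ_of_pderiv`. -/
theorem linForm_mem_iff [CharZero K] (hI : IsTangentField I X) (h : IsFrame I Δ B e)
    (hx : ∀ f ∈ I, aeval x f = 0) (hΔ : aeval x Δ ≠ 0) (a : Fin (N + 1) → K) :
    linForm a ∈ I ⊔ RingHom.ker (eval x) ^ 3 ↔ ∀ v ∈ secondSpan B x, ∑ i, a i * v i = 0 := by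
  have hsum : ∀ f ∈ I, ∀ q : Fin d × Fin d,
      diffAt f x (evalVec (dirDeriv (B q.1) (B q.2)) x) =
        - diff2 f x (evalVec (B q.1) x) (evalVec (B q.2) x) := fun f hf q =>
    eq_neg_of_add_eq_zero_left (diffAt_dirDeriv_add_diff2 hx (fun f hf => h.tangent f hf _)
      (fun f hf => h.tangent f hf _) hf)
  constructor
  · intro ha v hv
    obtain ⟨f, hf, r, hr, hfr⟩ := Submodule.mem_sup.1 ha
    have hr1 : ∀ i, pderiv i r ∈ RingHom.ker (eval x) ^ 2 := fun i =>
      derivation_mem_ker_pow x (pderiv i) 2 hr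
    have hr1' : ∀ v, diffAt r x v = 0 := fun v => by
      refine Finset.sum_eq_zero fun i _ => ?_
      rw [aeval_eq_eval', RingHom.mem_ker.1 (Ideal.pow_le_self two_ne_zero (hr1 i)), zero_mul]
    have hr2 : ∀ v w, diff2 r x v w = 0 := fun v w => by
      refine Finset.sum_eq_zero fun i _ => Finset.sum_eq_zero fun j _ => ?_
      have := derivation_mem_ker_pow x (pderiv i) 1 (hr1 j)
      rw [pow_one, RingHom.mem_ker] at this
      rw [this]; ring
    have h1 : ∀ v, ∑ i, a i * v i = diffAt f x v := fun v => by
      rw [← diffAt_linForm (x := x), ← hfr, diffAt_add, hr1', add_zero]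
    have h2 : ∀ v w, diff2 f x v w = 0 := fun v w => by
      have := diff2_linForm (x := x) a v w
      rwa [← hfr, diff2_add, hr2, add_zero] at this
    rw [h1]
    have hle : secondSpan B x ≤ LinearMap.ker (diffFunctional x f) := by
      rw [secondSpan, Submodule.span_le]
      rintro _ ⟨i | q, rfl⟩
      · rw [Sum.elim_inl, SetLike.mem_coe, LinearMap.mem_ker, diffFunctional_apply]
        exact h.evalVec_mem hx i f hf
      · rw [Sum.elim_inr, SetLike.mem_coe, LinearMap.mem_ker, diffFunctional_apply, hsum f hf, h2,
          neg_zero]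
    rw [← diffFunctional_apply]
    exact hle hv
  · intro ha
    obtain ⟨f, hf, hfa⟩ := exists_diffAt_eq (I := I) (x := x)
      (φ := ∑ i, a i • LinearMap.proj i) (fun v hv => by
        rw [h.tangentAt_eq hx hΔ] at hv
        have := ha v (Submodule.span_mono (by
          rintro _ ⟨i, rfl⟩
          exact ⟨Sum.inl i, rfl⟩) hv)
        simpa [LinearMap.sum_apply] using this)
    have hfa' : ∀ v, diffAt f x v = ∑ i, a i * v i := fun v => by
      rw [hfa]; simp [LinearMap.sum_apply]
    have hB : ∀ i j, diff2 f x (evalVec (B i) x) (evalVec (B j) x) = 0 := fun i j => by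
      have := hsum f hf (i, j)
      have h0 := ha (evalVec (dirDeriv (B i) (B j)) x) (Submodule.subset_span ⟨Sum.inr (i, j), rfl⟩)
      rw [hfa', h0] at this
      exact neg_eq_zero.1 this.symm
    obtain ⟨g, hg, hg1, hg2⟩ := exists_mem_diff2_eq_zero hx hf (fun v hv w hw => by
      rw [← hessian_apply, h.mem_span hΔ hv, h.mem_span hΔ hw]
      simp [map_sum, LinearMap.sum_apply, hB])
    have hself : ∑ i, a i * x i = 0 := by
      rw [← hfa']; exact mem_tangentAt_self hI hx f hf
    have hr : linForm a - g ∈ RingHom.ker (eval x) ^ 3 := by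
      have e0 : linForm a - g ∈ RingHom.ker (eval x) ^ (0 + 1) := by
        have hgx : eval x g = 0 := hx g hg
        rw [zero_add, pow_one, RingHom.mem_ker, map_sub, hgx]
        simp [linForm, hself]
      have hd : ∀ v, diffAt (linForm a - g) x v = 0 := fun v => by
        have : linForm a - g = linForm a + (-1 : K) • g := by simp [sub_eq_add_neg]
        rw [this, diffAt_add, diffAt_smul, diffAt_linForm, hg1, hfa']
        simp
      have hdd : ∀ v w, diff2 (linForm a - g) x v w = 0 := fun v w => by
        rw [sub_eq_add_neg, diff2_add, diff2_neg, diff2_linForm, hg2]; simp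
      have e1 : ∀ i, pderiv i (linForm a - g) ∈ RingHom.ker (eval x) ^ (0 + 1) := fun i => by
        have := hd (Pi.single i 1)
        rw [zero_add, pow_one, RingHom.mem_ker, ← aeval_eq_eval']
        simpa [diffAt, Pi.single_apply] using this
      have e2 : ∀ i j, pderiv i (pderiv j (linForm a - g)) ∈ RingHom.ker (eval x) ^ (0 + 1) :=
        fun i j => by
          have := hdd (Pi.single i 1) (Pi.single j 1)
          rw [zero_add, pow_one, RingHom.mem_ker]
          simpa [diff2, Pi.single_apply] using this
      exact mem_ker_pow_succ_of_pderiv x (mem_ker_pow_succ_of_pderiv x e0 e1)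
        (fun j => mem_ker_pow_succ_of_pderiv x (e1 j) (fun i => e2 i j))
    exact Submodule.mem_sup.2 ⟨g, hg, _, hr, by ring⟩

end Osculating

end ProjSurf

namespace ProjSurf

open MvPolynomial

/-! ### Homogeneity: passing between projective points and the cone -/

section Scaling

universe u

set_option linter.unusedSectionVars false

variable {K : Type u} [Field K] {N : ℕ}

theorem eval_smul_of_isHomogeneous {σ : Type*} {f : MvPolynomial σ K} {n : ℕ}
    (hf : f.IsHomogeneous n) (c : K) (x : σ → K) : eval (c • x) f = c ^ n * eval x f := by
  rw [eval_eq, eval_eq, Finset.mul_sum]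
  refine Finset.sum_congr rfl fun d hd => ?_
  have h1 : ∑ i ∈ d.support, d i = n := by
    simpa [Finsupp.weight_apply, Finsupp.sum] using hf (mem_support_iff.1 hd)
  simp only [Pi.smul_apply, smul_eq_mul, mul_pow, Finset.prod_mul_distrib,
    Finset.prod_pow_eq_pow_sum, h1]
  ring

/-- The values of a polynomial along a line through the origin. -/
noncomputable def linePoly {σ : Type*} (f : MvPolynomial σ K) (x : σ → K) : Polynomial K :=
  ∑ n ∈ Finset.range (f.totalDegree + 1),
    Polynomial.C (eval x (homogeneousComponent n f)) * Polynomial.X ^ n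

theorem eval_linePoly {σ : Type*} (f : MvPolynomial σ K) (x : σ → K) (c : K) :
    (linePoly f x).eval c = eval (c • x) f := by
  conv_rhs => rw [← sum_homogeneousComponent f]
  rw [linePoly, Polynomial.eval_finsetSum, map_sum]
  refine Finset.sum_congr rfl fun n _ => ?_
  rw [eval_smul_of_isHomogeneous (homogeneousComponent_isHomogeneous n f)]
  simp only [Polynomial.eval_mul, Polynomial.eval_C, Polynomial.eval_pow, Polynomial.eval_X]
  exact mul_comm _ _

theorem coeff_linePoly {σ : Type*} (f : MvPolynomial σ K) (x : σ → K) (n : ℕ) :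
    (linePoly f x).coeff n = eval x (homogeneousComponent n f) := by
  rw [linePoly, Polynomial.finsetSum_coeff]
  simp only [Polynomial.coeff_C_mul, Polynomial.coeff_X_pow, mul_ite, mul_one, mul_zero]
  rw [Finset.sum_ite_eq]
  split_ifs with h
  · rfl
  · rw [homogeneousComponent_eq_zero, map_zero]
    rw [Finset.mem_range] at h
    omega

theorem linePoly_eq_zero [Infinite K] {σ : Type*} (f : MvPolynomial σ K) (x : σ → K)
    (h : ∀ c : K, c ≠ 0 → eval (c • x) f = 0) : linePoly f x = 0 := by
  apply Polynomial.eq_zero_of_infinite_isRoot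
  refine Set.Infinite.mono (s := {c : K | c ≠ 0}) (fun c hc => ?_)
    (Set.Infinite.mono (fun c hc => hc) (Set.Finite.infinite_compl (Set.finite_singleton 0)))
  exact (eval_linePoly f x c).trans (h c hc)

/-- Along a line through the origin the values of the components are the coefficients of a
polynomial in the scaling factor, which vanishes for all nonzero factors. -/
theorem homogeneousComponent_mem_idealOf [Infinite K] {A : Set (PSpace K N)}
    {f : MvPolynomial (Fin (N + 1)) K} (hf : f ∈ idealOf A) (n : ℕ) :
    homogeneousComponent n f ∈ idealOf A := by
  intro x hx
  change eval x _ = 0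
  rw [← coeff_linePoly, linePoly_eq_zero f x fun c hc => hf _ (smul_mem_affineCone hx hc),
    Polynomial.coeff_zero]

theorem exists_homogeneousComponent_notMem {I : Ideal (MvPolynomial (Fin (N + 1)) K)}
    {g : MvPolynomial (Fin (N + 1)) K} (hg : g ∉ I) : ∃ n, homogeneousComponent n g ∉ I := by
  by_contra! h
  apply hg
  rw [← sum_homogeneousComponent g]
  exact Ideal.sum_mem _ fun n _ => h n

theorem mk_smul {x : Fin (N + 1) → K} (hx : x ≠ 0) {c : K} (hc : c ≠ 0) :
    Projectivization.mk K (c • x) (smul_ne_zero hc hx) = Projectivization.mk K x hx := by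
  rw [Projectivization.mk_eq_mk_iff']
  exact ⟨c, rfl⟩

/-- Since `g` need not be homogeneous, the open set is the locus where some component of `g` is
nonzero; a suitable multiple of the representative then has g ≠ 0. -/
theorem atGeneralPoint_of_forall_cone [Infinite K] {A : Set (PSpace K N)} {P : PSpace K N → Prop}
    {g : MvPolynomial (Fin (N + 1)) K} (hg : g ∉ idealOf A)
    (h : ∀ x ∈ affineCone A, aeval x g ≠ 0 → ∀ h0 : x ≠ 0, P (Projectivization.mk K x h0)) :
    AtGeneralPoint A P := by
  refine ⟨{p | ∃ n, eval p.rep (homogeneousComponent n g) ≠ 0},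
    ⟨Set.range fun n => homogeneousComponent n g, ?_, ?_⟩, ?_, ?_⟩
  · rintro _ ⟨n, rfl⟩
    exact ⟨n, homogeneousComponent_isHomogeneous n g⟩
  · ext p; simp
  · obtain ⟨n, hn⟩ := exists_homogeneousComponent_notMem hg
    rw [mem_idealOf] at hn
    push Not at hn
    obtain ⟨x, ⟨hx0, hx⟩, hne⟩ := hn
    refine ⟨_, hx, n, ?_⟩
    obtain ⟨a, ha0, ha⟩ := exists_mk_rep_eq_smul (K := K) hx0
    rw [ha, eval_smul_of_isHomogeneous (homogeneousComponent_isHomogeneous n g)]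
    exact mul_ne_zero (pow_ne_zero _ ha0) hne
  · rintro p ⟨hp, n, hn⟩
    obtain ⟨c, hc0, hc⟩ : ∃ c : K, c ≠ 0 ∧ eval (c • p.rep) g ≠ 0 := by
      by_contra! hall
      apply hn
      rw [← coeff_linePoly, linePoly_eq_zero g _ hall, Polynomial.coeff_zero]
    have h1 := h _ (smul_mem_affineCone (rep_mem_affineCone hp) hc0) hc
      (smul_ne_zero hc0 p.rep_nonzero)
    rwa [mk_smul p.rep_nonzero hc0, p.mk_rep] at h1

theorem AtGeneralPoint.exists_forall_cone {A : Set (PSpace K N)} {P : PSpace K N → Prop}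
    (h : AtGeneralPoint A P) : ∃ g ∉ idealOf A,
      ∀ x ∈ affineCone A, aeval x g ≠ 0 → ∀ h0 : x ≠ 0, P (Projectivization.mk K x h0) := by
  obtain ⟨U, ⟨F, hF, hUF⟩, ⟨p, hpA, hpU⟩, hP⟩ := h
  have hmem : ∀ q, q ∈ U ↔ ∃ f ∈ F, eval q.rep f ≠ 0 := by
    intro q
    rw [← not_iff_not, ← Set.mem_compl_iff, hUF]
    simp
  obtain ⟨f, hf, hfp⟩ := (hmem p).1 hpU
  obtain ⟨n, hn⟩ := hF f hf
  refine ⟨f, fun hI => hfp (hI _ (rep_mem_affineCone hpA)), fun x hx hfx h0 => ?_⟩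
  refine hP _ ⟨hx.2, (hmem _).2 ⟨f, hf, ?_⟩⟩
  obtain ⟨a, ha0, ha⟩ := exists_mk_rep_eq_smul (K := K) h0
  rw [ha, eval_smul_of_isHomogeneous hn]
  exact mul_ne_zero (pow_ne_zero _ ha0) hfx

/-- The substitution `X ↦ c X`. -/
noncomputable def scaleHom (c : K) :
    MvPolynomial (Fin (N + 1)) K →ₐ[K] MvPolynomial (Fin (N + 1)) K :=
  aeval fun i => C c * X i

theorem aeval_scaleHom (c : K) (x : Fin (N + 1) → K) (f : MvPolynomial (Fin (N + 1)) K) :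
    aeval x (scaleHom c f) = aeval (c • x) f := by
  rw [scaleHom, map_aeval']
  congr 2
  funext i
  simp

theorem scaleHom_mem_idealOf {A : Set (PSpace K N)} {c : K} (hc : c ≠ 0)
    {f : MvPolynomial (Fin (N + 1)) K} (hf : f ∈ idealOf A) : scaleHom c f ∈ idealOf A := by
  intro x hx
  rw [aeval_scaleHom]
  exact hf _ (smul_mem_affineCone hx hc)

theorem diffAt_scaleHom (c : K) (x v : Fin (N + 1) → K) (f : MvPolynomial (Fin (N + 1)) K) :
    diffAt (scaleHom c f) x v = c * diffAt f (c • x) v := by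
  classical
  have h : ∀ i, pderiv i (scaleHom c f) = C c * scaleHom c (pderiv i f) := by
    intro i
    rw [scaleHom, derivation_aeval]
    simp only [diffAt, Derivation.leibniz, pderiv_X, pderiv_C, smul_eq_mul]
    rw [Finset.sum_eq_single i]
    · simp [mul_comm]
    · intro j _ hj; simp [hj]
    · simp
  simp only [diffAt, h, map_mul, aeval_scaleHom, Finset.mul_sum]
  exact Finset.sum_congr rfl fun i _ => by simp [mul_assoc]

theorem tangentAt_smul (A : Set (PSpace K N)) (x : Fin (N + 1) → K) {c : K} (hc : c ≠ 0) :
    tangentAt (idealOf A) (c • x) = tangentAt (idealOf A) x := by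
  have key : ∀ (x : Fin (N + 1) → K) {c : K}, c ≠ 0 →
      tangentAt (idealOf A) x ≤ tangentAt (idealOf A) (c • x) := by
    intro x c hc v hv f hf
    have := hv _ (scaleHom_mem_idealOf hc hf)
    rw [diffAt_scaleHom] at this
    exact (mul_eq_zero.1 this).resolve_left hc
  refine le_antisymm ?_ (key x hc)
  have := key (c • x) (inv_ne_zero hc)
  rwa [inv_smul_smul₀ hc] at this

theorem tangentSpace_mk (A : Set (PSpace K N)) {x : Fin (N + 1) → K} (hx : x ≠ 0) :
    tangentSpace A (Projectivization.mk K x hx) = tangentAt (idealOf A) x := by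
  obtain ⟨a, ha0, ha⟩ := exists_mk_rep_eq_smul (K := K) hx
  rw [tangentSpace_eq, ha, tangentAt_smul A x ha0]

/-- The substitution X ↦ c⁻¹X preserves the ideal of the cone, carries the maximal ideal of x into
that of cx, and only rescales a linear form. -/
theorem linForm_mem_sup_smul {A : Set (PSpace K N)} {x : Fin (N + 1) → K} {c : K} (hc : c ≠ 0)
    {k : ℕ} {a : Fin (N + 1) → K} (h : linForm a ∈ idealOf A ⊔ RingHom.ker (eval x) ^ k) :
    linForm a ∈ idealOf A ⊔ RingHom.ker (eval (c • x)) ^ k := by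
  have h1 := Ideal.mem_map_of_mem (scaleHom c⁻¹ : MvPolynomial (Fin (N + 1)) K →ₐ[K] _) h
  rw [Ideal.map_sup, Ideal.map_pow] at h1
  have h2 : Ideal.map (scaleHom c⁻¹ : MvPolynomial (Fin (N + 1)) K →ₐ[K] _) (idealOf A) ≤
      idealOf A := Ideal.map_le_iff_le_comap.2 fun f hf => scaleHom_mem_idealOf (inv_ne_zero hc) hf
  have h3 : Ideal.map (scaleHom c⁻¹ : MvPolynomial (Fin (N + 1)) K →ₐ[K] _)
      (RingHom.ker (eval x)) ≤ RingHom.ker (eval (c • x)) := by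
    refine Ideal.map_le_iff_le_comap.2 fun f hf => ?_
    rw [Ideal.mem_comap, RingHom.mem_ker]
    refine (aeval_scaleHom c⁻¹ (c • x) f).trans ?_
    rw [inv_smul_smul₀ hc]
    exact hf
  have h4 := sup_le_sup h2 (Ideal.pow_right_mono h3 k) h1
  have h5 : linForm a = C c * scaleHom c⁻¹ (linForm a) := by
    simp only [linForm, scaleHom, map_sum, map_mul, aeval_X, aeval_C, Finset.mul_sum,
      algebraMap_eq]
    refine Finset.sum_congr rfl fun i _ => ?_
    rw [mul_left_comm, ← mul_assoc (C c), ← C_mul, mul_inv_cancel₀ hc, C_1, one_mul]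
  rw [h5]
  exact Ideal.mul_mem_left _ _ h4

/-- By `linForm_mem_iff` the osculating hyperplanes are those containing the span, and a subspace is
the intersection of the hyperplanes through it. -/
theorem osculatingSpace_mk [CharZero K] {A : Set (PSpace K N)} {d : ℕ}
    {Δ : MvPolynomial (Fin (N + 1)) K}
    {B : Fin d → Fin (N + 1) → MvPolynomial (Fin (N + 1)) K} {e : Fin d → Fin (N + 1)}
    {x : Fin (N + 1) → K} (hx : x ∈ affineCone A) (h0 : x ≠ 0)
    (h : IsFrame (idealOf A) Δ B e) (hΔ : aeval x Δ ≠ 0) :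
    osculatingSpace 2 A (Projectivization.mk K x h0) = secondSpan B x := by
  obtain ⟨a, ha0, ha⟩ := exists_mk_rep_eq_smul (K := K) h0
  have key := linForm_mem_iff (isTangentField_X A) h (fun f hf => hf x hx) hΔ
  have h1 : ∀ b, linForm b ∈ idealOf A ⊔
      RingHom.ker (eval (Projectivization.mk K x h0).rep) ^ 3 ↔
      ∀ v ∈ secondSpan B x, ∑ i, b i * v i = 0 := by
    intro b
    rw [← key, ha]
    constructor
    · intro hb
      have := linForm_mem_sup_smul (inv_ne_zero ha0) hb
      rwa [inv_smul_smul₀ ha0] at this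
    · exact linForm_mem_sup_smul ha0
  ext v
  constructor
  · intro hv
    by_contra hne
    obtain ⟨φ, hφv, hφ⟩ := Submodule.exists_le_ker_of_notMem hne
    have hφa : ∀ w, φ w = ∑ i, φ (Pi.single i 1) * w i := fun w => by
      have hw : w = ∑ i, w i • (Pi.single i 1 : Fin (N + 1) → K) := by
        funext j; simp [Finset.sum_apply, Pi.single_apply]
      conv_lhs => rw [hw]
      simp [map_sum, mul_comm]
    apply hφv
    rw [hφa]
    exact hv _ ((h1 _).2 fun w hw => by rw [← hφa]; exact hφ hw)
  · intro hv b hb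
    exact (h1 b).1 hb v hv

theorem osculatingSpace_eq_secondSpan [CharZero K] {A : Set (PSpace K N)} {p : PSpace K N} {d : ℕ}
    {Δ : MvPolynomial (Fin (N + 1)) K}
    {B : Fin d → Fin (N + 1) → MvPolynomial (Fin (N + 1)) K} {e : Fin d → Fin (N + 1)}
    (hp : p ∈ A) (h : IsFrame (idealOf A) Δ B e) (hΔ : aeval p.rep Δ ≠ 0) :
    osculatingSpace 2 A p = secondSpan B p.rep := by
  have := osculatingSpace_mk (rep_mem_affineCone hp) p.rep_nonzero h hΔ
  rwa [p.mk_rep] at this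

end Scaling

end ProjSurf

namespace ProjSurf

open MvPolynomial

/-! ### Conjugate directions, osculating dimension and rank of the parametrization -/

section ConjugateDirections

universe u

set_option linter.unusedSectionVars false

variable {K : Type u} [Field K]

/-- Away from two lines, a symmetric bilinear map with a unique annihilated pair is injective. -/
theorem exists_functionals_of_existsUnique_pair {U Q : Type*} [AddCommGroup U] [Module K U]
    [AddCommGroup Q] [Module K Q] (hU : Module.finrank K U = 2)
    (β : U →ₗ[K] U →ₗ[K] Q) (hβ : ∀ u v, β u v = β v u)
    (h : ∃! s : Sym2 (Projectivization K U), ∀ d e, s = s(d, e) → β d.rep e.rep = 0) :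
    ∃ φ₁ φ₂ : Module.Dual K U, φ₁ ≠ 0 ∧ φ₂ ≠ 0 ∧
      ∀ u, φ₁ u ≠ 0 → φ₂ u ≠ 0 → ∀ w, β u w = 0 → w = 0 := by
  have : Module.Finite K U := Module.finite_of_finrank_pos (by omega)
  have hline : ∀ d : Projectivization K U, ∃ φ : Module.Dual K U, φ ≠ 0 ∧ φ d.rep = 0 := by
    intro d
    have hlt : Submodule.span K {d.rep} < ⊤ := by
      rw [lt_top_iff_ne_top]
      intro h
      have h1 := finrank_span_singleton (K := K) d.rep_nonzero
      rw [h, finrank_top] at h1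
      omega
    obtain ⟨φ, hφ, hle⟩ := Submodule.exists_le_ker_of_lt_top _ hlt
    exact ⟨φ, hφ, hle (Submodule.mem_span_singleton_self _)⟩
  obtain ⟨s, hs, huniq⟩ := h
  induction s using Sym2.ind with
  | _ d e =>
  obtain ⟨φ₁, hφ₁, hd⟩ := hline d
  obtain ⟨φ₂, hφ₂, he⟩ := hline e
  refine ⟨φ₁, φ₂, hφ₁, hφ₂, fun u h1 h2 w huw => ?_⟩
  by_contra hw
  have hu : u ≠ 0 := by rintro rfl; simp at h1
  obtain ⟨a, ha0, ha⟩ := exists_mk_rep_eq_smul (K := K) hu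
  obtain ⟨b, hb0, hb⟩ := exists_mk_rep_eq_smul (K := K) hw
  -- A nonzero `w` annihilated by `u` would make `u` span one of the two lines of the unique pair,
  -- where one of the functionals vanishes.
  have h3 := huniq s(Projectivization.mk K u hu, Projectivization.mk K w hw) (by
    intro d' e' hde
    rcases Sym2.eq_iff.1 hde with ⟨rfl, rfl⟩ | ⟨rfl, rfl⟩
    · rw [ha, hb]; simp [huw]
    · rw [ha, hb]; simp [hβ w u, huw])
  rcases Sym2.eq_iff.1 h3 with ⟨rfl, rfl⟩ | ⟨rfl, rfl⟩
  · rw [ha, map_smul, smul_eq_mul] at hd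
    exact (mul_ne_zero ha0 h1) hd
  · rw [ha, map_smul, smul_eq_mul] at he
    exact (mul_ne_zero ha0 h2) he

variable {N : ℕ} {I : Ideal (MvPolynomial (Fin (N + 1)) K)} {x : Fin (N + 1) → K}
  {Δ : MvPolynomial (Fin (N + 1)) K}

/-- Lift through a linear section: two lifts differ by a multiple of x, which the Hessian kills. -/
theorem exists_hessian_quotient (hself : ∀ w ∈ tangentAt I x, hessianMap I x x w = 0)
    (L : Submodule K (tangentAt I x)) (hL : ∀ v ∈ L, ∃ c : K, (v : Fin (N + 1) → K) = c • x) :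
    ∃ β : (tangentAt I x ⧸ L) →ₗ[K] (tangentAt I x ⧸ L) →ₗ[K] (I → K),
      ∀ v w : tangentAt I x, β (L.mkQ v) (L.mkQ w) = hessianMap I x v w := by
  obtain ⟨s, hs⟩ := L.mkQ.exists_rightInverse_of_surjective (Submodule.range_mkQ L)
  let s' : (tangentAt I x ⧸ L) →ₗ[K] (Fin (N + 1) → K) := (tangentAt I x).subtype.comp s
  refine ⟨(hessianMap I x).compl₁₂ s' s', fun v w => ?_⟩
  have hdiff : ∀ v : tangentAt I x, ∃ c : K, s' (L.mkQ v) = v + c • x := by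
    intro v
    have h1 : L.mkQ (s (L.mkQ v) - v) = 0 := by
      rw [map_sub, sub_eq_zero]; exact LinearMap.congr_fun hs (L.mkQ v)
    obtain ⟨c, hc⟩ := hL _ ((Submodule.Quotient.mk_eq_zero L).1 h1)
    refine ⟨c, ?_⟩
    rw [← hc]; simp [s']
  obtain ⟨a, ha⟩ := hdiff v
  obtain ⟨b, hb⟩ := hdiff w
  have hxx : ∀ w : tangentAt I x, hessianMap I x w x = 0 := fun w => by
    rw [hessianMap_symm]; exact hself _ w.2
  -- Only b • x, not x itself, is known here to be tangent.
  have hx0 : b • hessianMap I x x x = 0 := by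
    have h2 : (b • x : Fin (N + 1) → K) ∈ tangentAt I x := by
      have h3 := Submodule.sub_mem _ (s (L.mkQ w)).2 w.2
      rwa [show ((s (L.mkQ w) : tangentAt I x) : Fin (N + 1) → K) = w + b • x from hb,
        add_sub_cancel_left] at h3
    rw [← map_smul]; exact hself _ h2
  rw [LinearMap.compl₁₂_apply, ha, hb]
  simp only [map_add, map_smul, LinearMap.add_apply, LinearMap.smul_apply, hxx, hself _ w.2,
    smul_zero, add_zero, zero_add]
  rw [smul_comm, hx0, smul_zero, add_zero]

theorem span_range_hessian_quotient {L : Submodule K (tangentAt I x)}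
    {β : (tangentAt I x ⧸ L) →ₗ[K] (tangentAt I x ⧸ L) →ₗ[K] (I → K)}
    (hβ : ∀ v w : tangentAt I x, β (L.mkQ v) (L.mkQ w) = hessianMap I x v w) :
    Submodule.span K (Set.range fun p : (tangentAt I x ⧸ L) × (tangentAt I x ⧸ L) =>
        β p.1 p.2) = Submodule.span K
      (Set.range fun p : tangentAt I x × tangentAt I x => hessianMap I x p.1 p.2) := by
  congr 1
  ext y
  constructor
  · rintro ⟨⟨u, w⟩, rfl⟩
    obtain ⟨u, rfl⟩ := L.mkQ_surjective u
    obtain ⟨w, rfl⟩ := L.mkQ_surjective w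
    exact ⟨(u, w), (hβ u w).symm⟩
  · rintro ⟨⟨u, w⟩, rfl⟩
    exact ⟨(L.mkQ u, L.mkQ w), hβ u w⟩

theorem hessian_quotient_symm {L : Submodule K (tangentAt I x)}
    {β : (tangentAt I x ⧸ L) →ₗ[K] (tangentAt I x ⧸ L) →ₗ[K] (I → K)}
    (hβ : ∀ v w : tangentAt I x, β (L.mkQ v) (L.mkQ w) = hessianMap I x v w)
    (u w : tangentAt I x ⧸ L) : β u w = β w u := by
  obtain ⟨u, rfl⟩ := L.mkQ_surjective u
  obtain ⟨w, rfl⟩ := L.mkQ_surjective w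
  rw [hβ, hβ, hessianMap_symm]

variable {B : Fin 3 → Fin (N + 1) → MvPolynomial (Fin (N + 1)) K} {e : Fin 3 → Fin (N + 1)}

theorem finrank_tangentAt_quotient (h : IsFrame I Δ B e) (hx : ∀ f ∈ I, aeval x f = 0)
    (hΔ : aeval x Δ ≠ 0) {L : Submodule K (tangentAt I x)} (hL : Module.finrank K L = 1) :
    Module.finrank K (tangentAt I x ⧸ L) = 2 := by
  have h1 := Submodule.finrank_quotient_add_finrank L
  rw [h.finrank_tangentAt hx hΔ] at h1
  omega

/-- The osculating cone has dimension 3 plus that of the span of the values of II, and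
`existsUnique_pair_iff` on the plane T_pS says when the latter is 2. -/
theorem existsUnique_isConjugatePair_iff [IsAlgClosed K] [CharZero K] {A : Set (PSpace K N)}
    {p : PSpace K N} (hp : p ∈ A) (h : IsFrame (idealOf A) Δ B e) (hΔ : aeval p.rep Δ ≠ 0) :
    (∃! s : Sym2 (Direction A p), IsConjugatePair A p s) ↔
      Module.finrank K (osculatingSpace 2 A p) = 5 := by
  have hx : ∀ f ∈ idealOf A, aeval p.rep f = 0 := fun f hf => hf _ (rep_mem_affineCone hp)
  have hX := isTangentField_X A
  let L : Submodule K (tangentAt (idealOf A) p.rep) :=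
    p.submodule.submoduleOf (tangentAt (idealOf A) p.rep)
  have hLs : ∀ v ∈ L, ∃ c : K, (v : Fin (N + 1) → K) = c • p.rep := by
    intro v hv
    have h1 : (v : Fin (N + 1) → K) ∈ p.submodule := hv
    rw [Projectivization.submodule_eq, Submodule.mem_span_singleton] at h1
    obtain ⟨c, hc⟩ := h1
    exact ⟨c, hc.symm⟩
  have hLr : Module.finrank K L = 1 := by
    have hle : p.submodule ≤ tangentAt (idealOf A) p.rep := by
      rw [Projectivization.submodule_eq, Submodule.span_singleton_le_iff_mem]
      exact mem_tangentAt_self hX hx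
    rw [(Submodule.submoduleOfEquivOfLe hle).finrank_eq, Projectivization.finrank_submodule]
  obtain ⟨β, hβ⟩ := exists_hessian_quotient (fun w hw => hessianMap_self hX h hx hΔ hw) L hLs
  have hconj : ∀ v w : TangentVectors A p, IsConjugate A p v w ↔ β v w = 0 := by
    intro v w
    obtain ⟨v, rfl⟩ := L.mkQ_surjective v
    obtain ⟨w, rfl⟩ := L.mkQ_surjective w
    have h0 : ∀ f : MvPolynomial (Fin (N + 1)) K, diff1 f p.rep 0 = 0 := fun f => by simp [diff1]
    constructor
    · intro hc
      rw [hβ]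
      funext f
      have := hc v w rfl rfl f.1 f.2
      rwa [h0, zero_add] at this
    · intro hc v' w' hv' hw' f hf
      have h1 : β (L.mkQ v') (L.mkQ w') = 0 := by
        rw [← hc]
        exact congrArg₂ (fun a b => β a b) hv' hw'
      rw [h0, zero_add]
      exact congrFun ((hβ v' w').symm.trans h1) ⟨f, hf⟩
  have h1 := existsUnique_pair_iff (finrank_tangentAt_quotient h hx hΔ hLr) β
    (hessian_quotient_symm hβ)
  rw [span_range_hessian_quotient hβ] at h1
  rw [osculatingSpace_eq_secondSpan hp h hΔ, finrank_secondSpan h hx hΔ]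
  have h2 : (∃! s : Sym2 (Direction A p), IsConjugatePair A p s) ↔
      (∃! s : Sym2 (Projectivization K (tangentAt (idealOf A) p.rep ⧸ L)),
        ∀ d e, s = s(d, e) → β d.rep e.rep = 0) := by
    refine existsUnique_congr fun s => ?_
    exact forall_congr' fun d => forall_congr' fun e => imp_congr_right fun _ => hconj _ _
  rw [h2, h1]
  omega

/-- If the second osculating space has dimension four, then the parametrization of the tangent
variety has rank five at a general point of the tangent plane. -/
theorem exists_finrank_rulingTangent_eq [IsAlgClosed K] (hX : IsTangentField I X) (hx0 : x ≠ 0)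
    (h : IsFrame I Δ B e) (hx : ∀ f ∈ I, aeval x f = 0) (hΔ : aeval x Δ ≠ 0)
    (h5 : Module.finrank K (secondSpan B x) = 5) {g : MvPolynomial (Fin 3) K} (hg : g ≠ 0) :
    ∃ t, eval t g ≠ 0 ∧ Module.finrank K (rulingTangent B x t) = 5 := by
  let L : Submodule K (tangentAt I x) := (Submodule.span K {x}).submoduleOf (tangentAt I x)
  have hLs : ∀ v ∈ L, ∃ c : K, (v : Fin (N + 1) → K) = c • x := by
    intro v hv
    have h1 : (v : Fin (N + 1) → K) ∈ Submodule.span K {x} := hv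
    rw [Submodule.mem_span_singleton] at h1
    obtain ⟨c, hc⟩ := h1
    exact ⟨c, hc.symm⟩
  have hLr : Module.finrank K L = 1 := by
    have hle : Submodule.span K {x} ≤ tangentAt I x := by
      rw [Submodule.span_singleton_le_iff_mem]
      exact mem_tangentAt_self hX hx
    rw [(Submodule.submoduleOfEquivOfLe hle).finrank_eq, finrank_span_singleton hx0]
  obtain ⟨β, hβ⟩ := exists_hessian_quotient (fun w hw => hessianMap_self hX h hx hΔ hw) L hLs
  have hU := finrank_tangentAt_quotient h hx hΔ hLr
  have hsymm := hessian_quotient_symm hβ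
  rw [finrank_secondSpan h hx hΔ, ← span_range_hessian_quotient hβ] at h5
  obtain ⟨φ₁, φ₂, hφ₁, hφ₂, hφ⟩ := exists_functionals_of_existsUnique_pair hU β hsymm
    ((existsUnique_pair_iff hU β hsymm).2 (by omega))
  let b : Fin 3 → tangentAt I x := fun i => ⟨evalVec (B i) x, h.evalVec_mem hx i⟩
  let lin : Module.Dual K (tangentAt I x ⧸ L) → MvPolynomial (Fin 3) K :=
    fun φ => ∑ i, C (φ (L.mkQ (b i))) * X i
  have hb : ∀ t : Fin 3 → K, ((∑ i, t i • b i : tangentAt I x) : Fin (N + 1) → K) =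
      rulingPoint B x t := fun t => by
    rw [rulingPoint, AddSubmonoidClass.coe_finsetSum]; rfl
  have hlin : ∀ φ t, eval t (lin φ) = φ (L.mkQ (∑ i, t i • b i)) := fun φ t => by
    simp [lin, map_sum, mul_comm]
  have hlin0 : ∀ φ, φ ≠ 0 → lin φ ≠ 0 := by
    intro φ hne h0
    apply hne
    refine LinearMap.ext fun u => ?_
    obtain ⟨⟨v, hv⟩, rfl⟩ := L.mkQ_surjective u
    have hv' : (⟨v, hv⟩ : tangentAt I x) = ∑ i, ((aeval x Δ)⁻¹ * v (e i)) • b i := by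
      apply Subtype.ext
      rw [hb]
      exact h.mem_span hΔ hv
    rw [hv', ← hlin, h0]
    simp
  -- The parameters to avoid are the zeros of `g` and the preimages of the two conjugate lines.
  -- Elsewhere II(v, ·) is injective on a plane, and the rank is 3 + 2.
  have hprod : g * lin φ₁ * lin φ₂ ≠ 0 :=
    mul_ne_zero (mul_ne_zero hg (hlin0 _ hφ₁)) (hlin0 _ hφ₂)
  obtain ⟨t, ht⟩ : ∃ t, eval t (g * lin φ₁ * lin φ₂) ≠ 0 := by
    by_contra! hall
    exact hprod (MvPolynomial.funext fun t => by rw [hall t, map_zero])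
  rw [map_mul, map_mul, hlin, hlin] at ht
  refine ⟨t, left_ne_zero_of_mul (left_ne_zero_of_mul ht), ?_⟩
  rw [finrank_rulingTangent h hx hΔ, ← hb]
  have hinj : Function.Injective (β (L.mkQ (∑ i, t i • b i))) := by
    rw [injective_iff_map_eq_zero]
    exact hφ _ (right_ne_zero_of_mul (left_ne_zero_of_mul ht)) (right_ne_zero_of_mul ht)
  have hmap : (tangentAt I x).map (hessianMap I x ((∑ i, t i • b i : tangentAt I x) :
      Fin (N + 1) → K)) = LinearMap.range (β (L.mkQ (∑ i, t i • b i))) := by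
    ext y
    constructor
    · rintro ⟨w, hw, rfl⟩
      exact ⟨L.mkQ ⟨w, hw⟩, hβ _ _⟩
    · rintro ⟨u, rfl⟩
      obtain ⟨w, rfl⟩ := L.mkQ_surjective u
      exact ⟨w, w.2, (hβ _ _).symm⟩
  rw [hmap, LinearMap.finrank_range_of_inj hinj, hU]

end ConjugateDirections

end ProjSurf

namespace ProjSurf

open MvPolynomial

/-! ### Closures, density and the ideal of the tangent variety -/

section GeneralPoints

universe u

set_option linter.unusedSectionVars false

variable {K : Type u} [Field K] {N : ℕ}

theorem isNonsingularPoint_iff {A : Set (PSpace K N)} {d : ℕ} (hd : HasDim A d)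
    {p : PSpace K N} :
    IsNonsingularPoint A p ↔ p ∈ A ∧ Module.finrank K (tangentAt (idealOf A) p.rep) = d + 1 := by
  unfold HasDim at hd
  rw [IsNonsingularPoint, hd, tangentSpace_eq, ← Module.finrank_eq_rank]
  norm_cast

theorem isNonsingularPoint_mk_iff {A : Set (PSpace K N)} {d : ℕ} (hd : HasDim A d)
    {x : Fin (N + 1) → K} (hx : x ≠ 0) :
    IsNonsingularPoint A (Projectivization.mk K x hx) ↔
      Projectivization.mk K x hx ∈ A ∧ Module.finrank K (tangentAt (idealOf A) x) = d + 1 := by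
  rw [isNonsingularPoint_iff hd, ← tangentSpace_eq, tangentSpace_mk]

theorem mk_mem_embeddedTangentSpace {A : Set (PSpace K N)} {p : PSpace K N}
    {v : Fin (N + 1) → K} (hv : v ≠ 0) :
    Projectivization.mk K v hv ∈ embeddedTangentSpace A p ↔ v ∈ tangentSpace A p := by
  change (Projectivization.mk K v hv).submodule ≤ _ ↔ _
  rw [Projectivization.submodule_mk, Submodule.span_singleton_le_iff_mem]

theorem mem_embeddedTangentSpace {A : Set (PSpace K N)} {p q : PSpace K N} :
    q ∈ embeddedTangentSpace A p ↔ q.rep ∈ tangentSpace A p := by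
  change q.submodule ≤ _ ↔ _
  rw [Projectivization.submodule_eq, Submodule.span_singleton_le_iff_mem]

theorem embeddedTangentSpace_eq_iff {A : Set (PSpace K N)} {p q : PSpace K N} :
    embeddedTangentSpace A p = embeddedTangentSpace A q ↔ tangentSpace A p = tangentSpace A q := by
  constructor
  · intro h
    ext v
    by_cases hv : v = 0
    · simp [hv]
    · rw [← mk_mem_embeddedTangentSpace hv, h, mk_mem_embeddedTangentSpace hv]
  · intro h
    rw [embeddedTangentSpace, h]; rfl

theorem subset_zariskiClosure (A : Set (PSpace K N)) : A ⊆ zariskiClosure A :=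
  fun _ hp _ hf => hf _ (rep_mem_affineCone hp)

/-- The closure tests polynomials only at chosen representatives; homogeneous components carry the
vanishing to the whole cone. -/
theorem idealOf_zariskiClosure [Infinite K] (A : Set (PSpace K N)) :
    idealOf (zariskiClosure A) = idealOf A := by
  apply le_antisymm
  · intro f hf x hx
    exact hf x ⟨hx.1, subset_zariskiClosure A hx.2⟩
  · rintro f hf x ⟨hx0, hx⟩
    obtain ⟨a, ha0, ha⟩ := exists_mk_rep_eq_smul (K := K) hx0
    change eval x f = 0
    rw [← sum_homogeneousComponent f, map_sum]
    refine Finset.sum_eq_zero fun n _ => ?_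
    have h1 := hx _ (homogeneousComponent_mem_idealOf hf n)
    rw [ha, eval_smul_of_isHomogeneous (homogeneousComponent_isHomogeneous n f)] at h1
    exact (mul_eq_zero.1 h1).resolve_left (pow_ne_zero _ ha0)

theorem isZariskiClosed_zariskiClosure [Infinite K] (A : Set (PSpace K N)) :
    IsZariskiClosed (zariskiClosure A) := by
  refine ⟨{f | f ∈ idealOf A ∧ ∃ n, f.IsHomogeneous n}, fun f hf => hf.2, ?_⟩
  ext p
  constructor
  · intro hp f hf; exact hp f hf.1
  · intro hp f hf
    rw [← sum_homogeneousComponent f, map_sum]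
    exact Finset.sum_eq_zero fun n _ => hp _
      ⟨homogeneousComponent_mem_idealOf hf n, n, homogeneousComponent_isHomogeneous n f⟩

theorem IsFrame.exists_rulingPoint_eq {I : Ideal (MvPolynomial (Fin (N + 1)) K)} {d : ℕ}
    {Δ : MvPolynomial (Fin (N + 1)) K}
    {B : Fin d → Fin (N + 1) → MvPolynomial (Fin (N + 1)) K} {e : Fin d → Fin (N + 1)}
    (h : IsFrame I Δ B e) {x v : Fin (N + 1) → K} (hΔ : aeval x Δ ≠ 0) (hv : v ∈ tangentAt I x) :
    ∃ t, rulingPoint B x t = v := ⟨_, (h.mem_span hΔ hv).symm⟩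

theorem IsFrame.rulingPoint_mem {I : Ideal (MvPolynomial (Fin (N + 1)) K)} {d : ℕ}
    {Δ : MvPolynomial (Fin (N + 1)) K}
    {B : Fin d → Fin (N + 1) → MvPolynomial (Fin (N + 1)) K} {e : Fin d → Fin (N + 1)}
    (h : IsFrame I Δ B e) {x : Fin (N + 1) → K} (hx : ∀ f ∈ I, aeval x f = 0) (t : Fin d → K) :
    rulingPoint B x t ∈ tangentAt I x :=
  Submodule.sum_mem _ fun i _ => Submodule.smul_mem _ _ (h.evalVec_mem hx i)

section Density

variable {S : Set (Fin (N + 1) → K)} [hS : (vanishingIdeal K S).IsPrime] [Infinite K]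
  {τ : Type} [Fintype τ]

theorem genPair_ne_zero_iff {g : MvPolynomial τ (MvPolynomial (Fin (N + 1)) K)} :
    genPair (vanishingIdeal K S) g ≠ 0 ↔ ∃ x ∈ S, ∃ t, evalPair x t g ≠ 0 := by
  rw [Ne, genPair_eq_zero]
  push Not
  rfl

/-- Irreducibility of the product of the cone and the parameter space: two non-empty open conditions
meet. -/
theorem exists_evalPair_mul_ne_zero {g h : MvPolynomial τ (MvPolynomial (Fin (N + 1)) K)}
    (hg : ∃ x ∈ S, ∃ t, evalPair x t g ≠ 0) (hh : ∃ x ∈ S, ∃ t, evalPair x t h ≠ 0) :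
    ∃ x ∈ S, ∃ t, evalPair x t (g * h) ≠ 0 := by
  rw [← genPair_ne_zero_iff] at hg hh ⊢
  rw [map_mul]
  exact mul_ne_zero hg hh

theorem exists_evalPair_C_ne_zero {g : MvPolynomial (Fin (N + 1)) K} (hg : g ∉ vanishingIdeal K S) :
    ∃ x ∈ S, ∃ t : τ → K, evalPair x t (C g) ≠ 0 := by
  rw [mem_vanishingIdeal_iff] at hg
  push Not at hg
  obtain ⟨x, hx, h⟩ := hg
  exact ⟨x, hx, 0, by rwa [evalPair_C]⟩

theorem evalPair_eq_zero_of_dense {g h : MvPolynomial τ (MvPolynomial (Fin (N + 1)) K)}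
    (hh : ∃ x ∈ S, ∃ t, evalPair x t h ≠ 0)
    (hg : ∀ x ∈ S, ∀ t, evalPair x t h ≠ 0 → evalPair x t g = 0) :
    ∀ x ∈ S, ∀ t, evalPair x t g = 0 := by
  by_contra! hne
  obtain ⟨x, hx, t, ht⟩ := hne
  obtain ⟨x, hx, t, h1⟩ := exists_evalPair_mul_ne_zero ⟨x, hx, t, ht⟩ hh
  rw [map_mul] at h1
  exact left_ne_zero_of_mul h1 (hg x hx t (right_ne_zero_of_mul h1))

variable {d : ℕ} {Δ Δ' : MvPolynomial (Fin (N + 1)) K}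
    {B B' : Fin d → Fin (N + 1) → MvPolynomial (Fin (N + 1)) K} {e e' : Fin d → Fin (N + 1)}

/-- Where Δ ≠ 0 the first frame spans the tangent space, so it reaches every point parametrized by
the second. This locus is dense, so a frame adapted to any point computes inside the same variety.
-/
theorem vanishingIdeal_rulingSet_le (h : IsFrame (vanishingIdeal K S) Δ B e)
    (hΔ : Δ ∉ vanishingIdeal K S) (h' : IsFrame (vanishingIdeal K S) Δ' B' e') :
    vanishingIdeal K (rulingSet S B) ≤ vanishingIdeal K (rulingSet S B') := by
  rintro f hf _ ⟨x, hx, t, rfl⟩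
  have h1 := evalPair_eq_zero_of_dense (g := aeval (rulingVec B') f)
    (exists_evalPair_C_ne_zero hΔ) (fun x hx t hne => by
      rw [evalPair_C] at hne
      rw [map_aeval', evalPair_rulingVec]
      obtain ⟨s, hs⟩ := h.exists_rulingPoint_eq hne (h'.rulingPoint_mem (fun f hf => hf x hx) t)
      rw [← hs]
      exact hf _ ⟨x, hx, s, rfl⟩) x hx t
  rwa [map_aeval', evalPair_rulingVec] at h1

end Density

theorem mk_rulingPoint_mem {S : Set (PSpace K N)} {d : ℕ} (hd : HasDim S d)
    {Δ : MvPolynomial (Fin (N + 1)) K}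
    {B : Fin (d + 1) → Fin (N + 1) → MvPolynomial (Fin (N + 1)) K}
    {e : Fin (d + 1) → Fin (N + 1)} (h : IsFrame (idealOf S) Δ B e)
    {x : Fin (N + 1) → K} (hx : x ∈ affineCone S) (hΔ : aeval x Δ ≠ 0) :
    IsNonsingularPoint S (Projectivization.mk K x hx.1) ∧
      ∀ t (hv : rulingPoint B x t ≠ 0), Projectivization.mk K (rulingPoint B x t) hv ∈
        embeddedTangentSpace S (Projectivization.mk K x hx.1) := by
  have hxI : ∀ f ∈ idealOf S, aeval x f = 0 := fun f hf => hf x hx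
  refine ⟨(isNonsingularPoint_mk_iff hd hx.1).2 ⟨hx.2, h.finrank_tangentAt hxI hΔ⟩,
    fun t hv => ?_⟩
  rw [mk_mem_embeddedTangentSpace, tangentSpace_mk]
  exact h.rulingPoint_mem hxI t

theorem rulingPoint_ne_zero {I : Ideal (MvPolynomial (Fin (N + 1)) K)} {d : ℕ}
    {Δ : MvPolynomial (Fin (N + 1)) K}
    {B : Fin d → Fin (N + 1) → MvPolynomial (Fin (N + 1)) K} {e : Fin d → Fin (N + 1)}
    (h : IsFrame I Δ B e) {x : Fin (N + 1) → K} (hΔ : aeval x Δ ≠ 0) {t : Fin d → K} {i : Fin d}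
    (ht : t i ≠ 0) : rulingPoint B x t ≠ 0 := by
  intro hv
  have hli : LinearIndependent K fun j => evalVec (B j) x := h.linearIndependent hΔ
  rw [Fintype.linearIndependent_iff] at hli
  exact ht (hli t hv i)

/-- The ideal of the tangent variety. -/
theorem idealOf_tangentVariety [CharZero K] {S : Set (PSpace K N)} (hS : (idealOf S).IsPrime)
    {d : ℕ} (hd : HasDim S d) {Δ : MvPolynomial (Fin (N + 1)) K}
    {B : Fin (d + 1) → Fin (N + 1) → MvPolynomial (Fin (N + 1)) K}
    {e : Fin (d + 1) → Fin (N + 1)}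
    (h : IsFrame (idealOf S) Δ B e) (hΔ : Δ ∉ idealOf S) :
    idealOf (tangentVariety S) = vanishingIdeal K (rulingSet (affineCone S) B) := by
  have hprime : (vanishingIdeal K (affineCone S)).IsPrime := hS
  have hinf : Infinite K := CharZero.infinite K
  rw [tangentVariety, idealOf_zariskiClosure]
  apply le_antisymm
  · rintro f hf _ ⟨x, hx, t, rfl⟩
    -- Requiring a nonzero parameter ensures that the ruling point is nonzero and so defines a
    -- projective point.
    have hX : ∃ x ∈ affineCone S, ∃ t : Fin (d + 1) → K, evalPair x t (X 0) ≠ 0 := by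
      obtain ⟨x, hx, -⟩ := exists_evalPair_C_ne_zero (τ := Fin (d + 1)) hΔ
      refine ⟨x, hx, 1, ?_⟩
      rw [evalPair_X]
      exact one_ne_zero
    have h1 := evalPair_eq_zero_of_dense (g := aeval (rulingVec B) f)
      (exists_evalPair_mul_ne_zero (exists_evalPair_C_ne_zero hΔ) hX) (fun x hx t hne => by
        rw [map_mul, evalPair_C, evalPair_X] at hne
        obtain ⟨h2, h3⟩ := mk_rulingPoint_mem hd h hx (left_ne_zero_of_mul hne)
        have hv0 := rulingPoint_ne_zero h (left_ne_zero_of_mul hne) (right_ne_zero_of_mul hne)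
        rw [map_aeval', evalPair_rulingVec]
        exact hf _ ⟨hv0, _, h2, h3 t hv0⟩) x hx t
    rwa [map_aeval', evalPair_rulingVec] at h1
  · rintro f hf v ⟨hv0, p, hp, hv⟩
    rw [mk_mem_embeddedTangentSpace, tangentSpace_eq] at hv
    rw [isNonsingularPoint_iff hd] at hp
    have hxI : ∀ f ∈ idealOf S, aeval p.rep f = 0 := fun f hf => hf _ (rep_mem_affineCone hp.1)
    -- The given frame may degenerate at the non-singular point `p`; one adapted to `p` is used and
    -- then compared.
    obtain ⟨Δ', B', e', h', hΔ'⟩ := exists_isFrame hd hxI hp.2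
    obtain ⟨t, rfl⟩ := h'.exists_rulingPoint_eq hΔ' hv
    exact vanishingIdeal_rulingSet_le h hΔ h' hf _ ⟨_, rep_mem_affineCone hp.1, t, rfl⟩

end GeneralPoints

end ProjSurf

namespace ProjSurf

open MvPolynomial

/-! ### The equivalences -/

section TangentVariety

universe u

set_option linter.unusedSectionVars false

variable {K : Type u} [Field K] {N : ℕ}

/-- The equivalence holds at every non-singular point, as each has an adapted frame; the same open
set serves both sides. -/
theorem isPhiSurface_iff_hasUniqueConjugatePair [IsAlgClosed K] [CharZero K]
    {S : Set (PSpace K N)} (hS : (idealOf S).IsPrime) (hd : HasDim S 2) :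
    IsPhiSurface S ↔ HasUniqueConjugatePair S := by
  have key : ∀ p, IsNonsingularPoint S p →
      (Module.finrank K (osculatingSpace 2 S p) = 4 + 1 ↔
        ∃! s : Sym2 (Direction S p), IsConjugatePair S p s) := by
    intro p hp
    rw [isNonsingularPoint_iff hd] at hp
    have hxI : ∀ f ∈ idealOf S, aeval p.rep f = 0 := fun f hf => hf _ (rep_mem_affineCone hp.1)
    obtain ⟨Δ, B, e, h, hΔ⟩ := exists_isFrame hd hxI hp.2
    exact (existsUnique_isConjugatePair_iff hp.1 h hΔ).symm
  exact exists_congr fun U => and_congr_right fun _ => and_congr_right fun _ =>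
    forall₂_congr fun p _ => and_congr_right (key p)

theorem exists_trdeg_eq (J : Ideal (MvPolynomial (Fin (N + 1)) K)) [J.IsPrime] :
    ∃ d : ℕ, Algebra.trdeg K (MvPolynomial (Fin (N + 1)) K ⧸ J) = d := by
  obtain ⟨d, hd⟩ := Cardinal.lt_aleph0.1
    (trdeg_lt_aleph0_of_finiteType (R := K) (S := MvPolynomial (Fin (N + 1)) K ⧸ J))
  exact ⟨d, hd⟩

theorem evalPair_eq_eval_map {τ : Type} [Fintype τ] (x : Fin (N + 1) → K) (t : τ → K)
    (g : MvPolynomial τ (MvPolynomial (Fin (N + 1)) K)) :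
    evalPair x t g = eval t (mapAlgHom (aeval x : MvPolynomial (Fin (N + 1)) K →ₐ[K] K) g) := rfl

theorem evalPair_rename {τ τ' : Type} [Fintype τ] [Fintype τ'] (x : Fin (N + 1) → K) (s : τ' → K)
    (φ : τ → τ') (g : MvPolynomial τ (MvPolynomial (Fin (N + 1)) K)) :
    evalPair x s (rename φ g) = evalPair x (s ∘ φ) g := by
  induction g using MvPolynomial.induction_on with
  | C a => simp
  | add p q hp hq => simp [hp, hq]
  | mul_X p i hp => simp [hp]

variable {S : Set (PSpace K N)} {Δ : MvPolynomial (Fin (N + 1)) K}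
  {B : Fin 3 → Fin (N + 1) → MvPolynomial (Fin (N + 1)) K} {e : Fin 3 → Fin (N + 1)}

theorem IsPhiSurface.exists_finrank_secondSpan [CharZero K] (hΦ : IsPhiSurface S)
    (h : IsFrame (idealOf S) Δ B e) :
    ∃ g ∉ idealOf S, ∀ x ∈ affineCone S, aeval x g ≠ 0 → aeval x Δ ≠ 0 →
      Module.finrank K (secondSpan B x) = 5 := by
  obtain ⟨g, hg, hgP⟩ := AtGeneralPoint.exists_forall_cone hΦ
  refine ⟨g, hg, fun x hx hgx hΔ => ?_⟩
  have := (hgP x hx hgx hx.1).2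
  rwa [osculatingSpace_mk hx hx.1 h hΔ] at this

/-- By generic smoothness the dimension of the cone is the rank of the parametrization at a general
(x, t), which is 5 when the second osculating space has dimension 4. -/
theorem IsPhiSurface.trdeg_rulingSet [IsAlgClosed K] [CharZero K] (hΦ : IsPhiSurface S)
    (hS : (idealOf S).IsPrime) (h : IsFrame (idealOf S) Δ B e) (hΔ : Δ ∉ idealOf S) :
    Algebra.trdeg K (MvPolynomial (Fin (N + 1)) K ⧸
      vanishingIdeal K (rulingSet (affineCone S) B)) = (5 : ℕ) := by
  have hprime : (vanishingIdeal K (affineCone S)).IsPrime := hS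
  have hframe : IsFrame (vanishingIdeal K (affineCone S)) Δ B e := h
  have hJ := isPrime_vanishingIdeal_rulingSet (affineCone S) B
  obtain ⟨g, hg, h5⟩ := hΦ.exists_finrank_secondSpan h
  obtain ⟨d', hd'⟩ := exists_trdeg_eq (vanishingIdeal K (rulingSet (affineCone S) B))
  obtain ⟨k, hk0, hk⟩ := exists_tangentAt_eq_rulingTangent hframe hΔ hd'
  obtain ⟨x, hx, t, ht⟩ := exists_evalPair_mul_ne_zero (exists_evalPair_mul_ne_zero
    (exists_evalPair_C_ne_zero hg) (exists_evalPair_C_ne_zero hΔ)) (genPair_ne_zero_iff.1 hk0)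
  rw [map_mul, map_mul, evalPair_C, evalPair_C] at ht
  have hgx := left_ne_zero_of_mul (left_ne_zero_of_mul ht)
  have hΔx := right_ne_zero_of_mul (left_ne_zero_of_mul ht)
  -- Over the chosen x the open condition is still a nonzero polynomial in the parameters, so t may
  -- be moved within one tangent plane to reach rank 5.
  have hkx : mapAlgHom (aeval x : MvPolynomial (Fin (N + 1)) K →ₐ[K] K) k ≠ 0 := fun h0 =>
    right_ne_zero_of_mul ht (by rw [evalPair_eq_eval_map, h0, map_zero])
  obtain ⟨s, hs, hs5⟩ := exists_finrank_rulingTangent_eq (isTangentField_X S) hx.1 h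
    (fun f hf => hf x hx) hΔx (h5 x hx hgx hΔx) hkx
  rw [hd', ← (hk x hx s hs).2, hs5]

/-- Over general x the tangent spaces at general points v, v' of one plane both equal `secondSpan B
x`. To reach special x and t, take a frame of the tangent variety at the given v. That its vectors
at v are tangent at v' is a polynomial condition in (x, t, t'); it holds on a dense set, hence
everywhere. -/
theorem IsPhiSurface.tangentAt_rulingPoint_le [IsAlgClosed K] [CharZero K] (hΦ : IsPhiSurface S)
    (hS : (idealOf S).IsPrime) (h : IsFrame (idealOf S) Δ B e) {x : Fin (N + 1) → K}
    (hx : x ∈ affineCone S) (hΔx : aeval x Δ ≠ 0) {t t' : Fin 3 → K}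
    (h5 : Module.finrank K (tangentAt (vanishingIdeal K (rulingSet (affineCone S) B))
      (rulingPoint B x t)) = 5) :
    tangentAt (vanishingIdeal K (rulingSet (affineCone S) B)) (rulingPoint B x t) ≤
      tangentAt (vanishingIdeal K (rulingSet (affineCone S) B)) (rulingPoint B x t') := by
  have hΔ : Δ ∉ idealOf S := fun hm => hΔx (hm x hx)
  have hprime : (vanishingIdeal K (affineCone S)).IsPrime := hS
  have hframe : IsFrame (vanishingIdeal K (affineCone S)) Δ B e := h
  have hJ := isPrime_vanishingIdeal_rulingSet (affineCone S) B
  have hd := hΦ.trdeg_rulingSet hS h hΔ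
  obtain ⟨g, hg, hg5⟩ := hΦ.exists_finrank_secondSpan h
  obtain ⟨k, hk0, hk⟩ := exists_tangentAt_eq_rulingTangent hframe hΔ hd
  have hmem : ∀ x ∈ affineCone S, ∀ t, ∀ f ∈ vanishingIdeal K (rulingSet (affineCone S) B),
      aeval (rulingPoint B x t) f = 0 := fun x hx t f hf => hf _ ⟨x, hx, t, rfl⟩
  obtain ⟨Δ', C', e', h', hΔ'⟩ := exists_isFrame hd (hmem x hx t) h5
  rw [h'.tangentAt_eq (hmem x hx t) hΔ', Submodule.span_le]
  rintro _ ⟨j, rfl⟩ f hf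
  -- The left variables parametrize v, where the frame is evaluated; the right ones parametrize v',
  -- where the differential of f is taken.
  let H : MvPolynomial (Fin 3 ⊕ Fin 3) (MvPolynomial (Fin (N + 1)) K) :=
    diffAt f (fun i => rename Sum.inr (rulingVec B i))
      (fun i => aeval (fun l => rename Sum.inl (rulingVec B l)) (C' j i))
  have hr : ∀ (φ : Fin 3 → Fin 3 ⊕ Fin 3) x s,
      (fun l => evalPair x s (rename φ (rulingVec B l))) = rulingPoint B x (s ∘ φ) := by
    intro φ x s
    rw [← evalPair_rulingVec]
    funext l
    exact evalPair_rename _ _ _ _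
  have hH : ∀ x s, evalPair x s H = diffAt f (rulingPoint B x (s ∘ Sum.inr))
      (evalVec (C' j) (rulingPoint B x (s ∘ Sum.inl))) := by
    intro x s
    rw [map_diffAt, hr]
    congr 1
    funext i
    rw [map_aeval', hr, evalVec]
  have hren : ∀ φ : Fin 3 → Fin 3 ⊕ Fin 3, Function.Injective φ →
      ∃ x ∈ affineCone S, ∃ s, evalPair x s (rename φ k) ≠ 0 := by
    intro φ hφ
    obtain ⟨x, hx, t, ht⟩ := genPair_ne_zero_iff.1 hk0
    refine ⟨x, hx, Function.extend φ t 0, ?_⟩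
    rwa [evalPair_rename, Function.extend_comp hφ]
  have hdense := evalPair_eq_zero_of_dense (g := H)
    (exists_evalPair_mul_ne_zero (exists_evalPair_mul_ne_zero (exists_evalPair_mul_ne_zero
      (exists_evalPair_C_ne_zero hg) (exists_evalPair_C_ne_zero hΔ))
      (hren Sum.inl Sum.inl_injective)) (hren Sum.inr Sum.inr_injective))
    (fun x hx s hs => by
      rw [map_mul, map_mul, map_mul, evalPair_C, evalPair_C, evalPair_rename, evalPair_rename]
        at hs
      have h2 := hg5 x hx (left_ne_zero_of_mul (left_ne_zero_of_mul (left_ne_zero_of_mul hs)))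
        (right_ne_zero_of_mul (left_ne_zero_of_mul (left_ne_zero_of_mul hs)))
      -- The derivatives of the parametrization lie in the second-order span, and both spaces have
      -- dimension 5.
      have h3 : ∀ t, evalPair x t k ≠ 0 →
          tangentAt (vanishingIdeal K (rulingSet (affineCone S) B)) (rulingPoint B x t) =
            secondSpan B x := fun t ht => by
        rw [(hk x hx t ht).1]
        exact Submodule.eq_of_le_of_finrank_eq (rulingTangent_le_secondSpan x t)
          ((hk x hx t ht).2.trans h2.symm)
      rw [hH]
      have h4 := h'.evalVec_mem (hmem x hx (s ∘ Sum.inl)) j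
      rw [h3 _ (right_ne_zero_of_mul (left_ne_zero_of_mul hs)),
        ← h3 _ (right_ne_zero_of_mul hs)] at h4
      exact h4 f hf) x hx (Sum.elim t t')
  rwa [hH, Sum.elim_comp_inl, Sum.elim_comp_inr] at hdense

theorem IsPhiSurface.tangentVariety [IsAlgClosed K] [CharZero K] (hΦ : IsPhiSurface S)
    (hS : (idealOf S).IsPrime) (hd : HasDim S 2) : TangentVarietyIsFourfoldWithFixedTangent S := by
  have hprime : (vanishingIdeal K (affineCone S)).IsPrime := hS
  obtain ⟨Δ, B, e, h, hΔ⟩ := exists_isFrame_generic hd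
  have hdim : HasDim (ProjSurf.tangentVariety S) 4 := by
    unfold HasDim CoordRing
    rw [idealOf_tangentVariety hS hd h hΔ]
    exact hΦ.trdeg_rulingSet hS h hΔ
  refine ⟨⟨isZariskiClosed_zariskiClosure _, ?_⟩, hdim, fun p hp q hq q' hq' hqV hqV' => ?_⟩
  · rw [idealOf_tangentVariety hS hd h hΔ]
    exact isPrime_vanishingIdeal_rulingSet _ B
  -- The generic frame may degenerate at `p`; one adapted to `p` replaces it.
  clear! Δ B e
  rw [isNonsingularPoint_iff hd] at hp
  have hxI : ∀ f ∈ idealOf S, aeval p.rep f = 0 := fun f hf => hf _ (rep_mem_affineCone hp.1)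
  obtain ⟨Δ, B, e, h, hΔx⟩ := exists_isFrame hd hxI hp.2
  have hΔ : Δ ∉ idealOf S := fun hm => hΔx (hxI _ hm)
  have key : ∀ q q', q ∈ embeddedTangentSpace S p → q' ∈ embeddedTangentSpace S p →
      IsNonsingularPoint (ProjSurf.tangentVariety S) q →
      tangentSpace (ProjSurf.tangentVariety S) q ≤ tangentSpace (ProjSurf.tangentVariety S) q' := by
    intro q q' hq hq' hqV
    rw [mem_embeddedTangentSpace, tangentSpace_eq] at hq hq'
    obtain ⟨t, ht⟩ := h.exists_rulingPoint_eq hΔx hq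
    obtain ⟨t', ht'⟩ := h.exists_rulingPoint_eq hΔx hq'
    rw [isNonsingularPoint_iff hdim, idealOf_tangentVariety hS hd h hΔ, ← ht] at hqV
    rw [tangentSpace_eq, tangentSpace_eq, idealOf_tangentVariety hS hd h hΔ, ← ht, ← ht']
    exact hΦ.tangentAt_rulingPoint_le hS h (rep_mem_affineCone hp.1) hΔx hqV.2
  rw [embeddedTangentSpace_eq_iff]
  exact le_antisymm (key q q' hq hq' hqV) (key q' q hq' hq hqV')

/-- The derivative along Bⱼ is linear in t. A functional that kills `W` kills it for general t,
hence kills all its coefficients, which are the second derivatives. -/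
theorem secondSpan_le_of_forall_rulingTangent_le [Infinite K] {x : Fin (N + 1) → K}
    {W : Submodule K (Fin (N + 1) → K)} {k : MvPolynomial (Fin 3) K} (hk : k ≠ 0)
    (hW : ∀ t, eval t k ≠ 0 → rulingTangent B x t ≤ W) : secondSpan B x ≤ W := by
  have hlin : ∀ j i, evalVec (dirDeriv (B j) (B i)) x ∈ W := by
    intro j i
    by_contra hne
    obtain ⟨φ, hφ, hle⟩ := Submodule.exists_le_ker_of_notMem hne
    let L : MvPolynomial (Fin 3) K := ∑ i, C (φ (evalVec (dirDeriv (B j) (B i)) x)) * X i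
    have hL : ∀ t, eval t L = φ (rulingPoint (fun i => dirDeriv (B j) (B i)) x t) := fun t => by
      simp [L, rulingPoint, map_sum, mul_comm]
    have h0 : L * k = 0 := MvPolynomial.funext fun t => by
      rw [map_mul, map_zero, mul_eq_zero, or_iff_not_imp_right, hL]
      exact fun ht => hle (hW t ht (Submodule.subset_span ⟨Sum.inr j, rfl⟩))
    apply hφ
    have h1 := congrArg (eval (Pi.single i 1)) ((mul_eq_zero.1 h0).resolve_right hk)
    simpa [L, Pi.single_apply] using h1
  obtain ⟨t, ht⟩ : ∃ t, eval t k ≠ 0 := by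
    by_contra! hall
    exact hk (MvPolynomial.funext fun t => by rw [hall t, map_zero])
  rw [secondSpan, Submodule.span_le]
  rintro _ ⟨i | q, rfl⟩
  · exact hW t ht (Submodule.subset_span ⟨Sum.inl i, rfl⟩)
  · exact hlin _ _

/-- Fixedness makes the span of the derivatives of the parametrization one 5-dimensional space for
general t. This space contains the second-order span, and is contained in it. -/
theorem isPhiSurface_of_tangentVariety [IsAlgClosed K] [CharZero K]
    (hS : (idealOf S).IsPrime) (hd : HasDim S 2)
    (hV : TangentVarietyIsFourfoldWithFixedTangent S) : IsPhiSurface S := by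
  have hprime : (vanishingIdeal K (affineCone S)).IsPrime := hS
  obtain ⟨-, hdim, hfix⟩ := hV
  obtain ⟨Δ, B, e, h, hΔ⟩ := exists_isFrame_generic hd
  have hframe : IsFrame (vanishingIdeal K (affineCone S)) Δ B e := h
  have hJ := idealOf_tangentVariety hS hd h hΔ
  have hdJ : Algebra.trdeg K (MvPolynomial (Fin (N + 1)) K ⧸
      vanishingIdeal K (rulingSet (affineCone S) B)) = (5 : ℕ) := by
    rw [← hJ]; exact hdim
  obtain ⟨k, hk0, hk⟩ := exists_tangentAt_eq_rulingTangent hframe hΔ hdJ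
  -- Where this coefficient is nonzero at x, the open condition restricts to a nonzero polynomial on
  -- the tangent plane at x.
  obtain ⟨m, hm⟩ : ∃ m, coeff m k ∉ idealOf S := by
    by_contra! hall
    apply hk0
    rw [genPair_eq_zero_iff_map]
    ext m
    rw [coeff_map, coeff_zero, Ideal.Quotient.eq_zero_iff_mem]
    exact hall m
  refine atGeneralPoint_of_forall_cone (g := Δ * coeff m k)
    (fun hmem => (hS.mem_or_mem hmem).elim hΔ hm) fun x hx hgx h0 => ?_
  rw [map_mul] at hgx
  have hΔx := left_ne_zero_of_mul hgx
  obtain ⟨hns, hmk⟩ := mk_rulingPoint_mem hd h hx hΔx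
  refine ⟨hns, ?_⟩
  rw [osculatingSpace_mk hx h0 h hΔx]
  -- The factor X₀ again keeps the ruling point nonzero.
  have hkx : mapAlgHom (aeval x : MvPolynomial (Fin (N + 1)) K →ₐ[K] K) k * X 0 ≠ 0 := by
    refine mul_ne_zero (fun hz => right_ne_zero_of_mul hgx ?_) (X_ne_zero _)
    have := congrArg (coeff m) hz
    rwa [mapAlgHom_apply, coeff_map, coeff_zero] at this
  obtain ⟨t₀, ht₀⟩ : ∃ t, eval t (mapAlgHom (aeval x : MvPolynomial (Fin (N + 1)) K →ₐ[K] K) k *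
      X 0) ≠ 0 := by
    by_contra! hall
    exact hkx (MvPolynomial.funext fun t => by rw [hall t, map_zero])
  have hpt : ∀ t, eval t (mapAlgHom (aeval x : MvPolynomial (Fin (N + 1)) K →ₐ[K] K) k *
      X 0) ≠ 0 → ∃ q ∈ embeddedTangentSpace S (Projectivization.mk K x h0),
      IsNonsingularPoint (tangentVariety S) q ∧
        tangentSpace (tangentVariety S) q = rulingTangent B x t := by
    intro t ht
    rw [map_mul, eval_X] at ht
    have hv := rulingPoint_ne_zero h hΔx (right_ne_zero_of_mul ht)
    have h1 := hk x hx t (left_ne_zero_of_mul ht)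
    refine ⟨Projectivization.mk K _ hv, hmk t hv, ?_, ?_⟩
    · rw [isNonsingularPoint_mk_iff hdim, hJ, h1.1]
      exact ⟨subset_zariskiClosure _ ⟨_, hns, hmk t hv⟩, h1.2⟩
    · rw [tangentSpace_mk, hJ, h1.1]
  obtain ⟨q₀, hq₀, hq₀V, hT₀⟩ := hpt t₀ ht₀
  have hle := secondSpan_le_of_forall_rulingTangent_le (B := B) (x := x)
    (W := rulingTangent B x t₀) hkx fun t ht => by
      obtain ⟨q, hq, hqV, hT⟩ := hpt t ht
      rw [← hT, ← hT₀, embeddedTangentSpace_eq_iff.1 (hfix _ hns q hq q₀ hq₀ hqV hq₀V)]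
  rw [le_antisymm hle (rulingTangent_le_secondSpan x t₀)]
  rw [map_mul] at ht₀
  exact (hk x hx t₀ (left_ne_zero_of_mul ht₀)).2

end TangentVariety

end ProjSurf

theorem mainTheorem9 {K : Type*} [Field K] [IsAlgClosed K] [CharZero K] (N : ℕ) (hN : 5 ≤ N)
    (S : Set (ProjSurf.PSpace K N)) (hS : ProjSurf.IsProjVariety S) (hdim : ProjSurf.HasDim S 2) :
    List.TFAE [ProjSurf.IsPhiSurface S,
      ProjSurf.HasUniqueConjugatePair S,
      ProjSurf.TangentVarietyIsFourfoldWithFixedTangent S] := by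
  tfae_have 1 ↔ 2 := ProjSurf.isPhiSurface_iff_hasUniqueConjugatePair hS.prime hdim
  tfae_have 1 → 3 := fun h => h.tangentVariety hS.prime hdim
  tfae_have 3 → 1 := ProjSurf.isPhiSurface_of_tangentVariety hS.prime hdim
  tfae_finish
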